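/- For $\theta\in(0,1)$ let $$A(\eta)=\begin{pmatrix}1+\sqrt\theta\,\sin(\pi\eta_1)&0\\0&1+\sqrt\theta\,\sin(\pi\eta_2)\end{pmatrix}\begin{pmatrix}\eta_1\\ \eta_2\end{pmatrix},\qquad J=\begin{pmatrix}0&-1\\1&0\end{pmatrix},$$ $$\mathscr G=\left\{\begin{pmatrix}x_1&x_2\\x_3&x_4\end{pmatrix}\in\mathbb R^{2\times2}:\ x_1\neq0,\ x_2\ne 0,\ A\begin{pmatrix}x_1\\x_2\end{pmatrix}-J\begin{pmatrix}x_3\\x_4\end{pmatrix}=0\right\},$$ $$q_L=1-\frac1{1+L}+\frac1{1+L(1-\theta)},\qquad \bar q=\sup\{q_L:\ L\text{ a positive even integer}\}.$$ A regular domain is a non-empty, open, bounded, connected set $\Omega\subset\mathbb R^2$ with $|\partial\Omega|=0$. A map $w\in W^{1,1}(\Omega,\mathbb R^2)$ is piecewise affine if there are at most countably many pairwise disjoint regular domains $\Omega_i\subset\Omega$ that cover $\Omega$ up to a null set, such that $w$ is an affine map on each $\Omega_i$. For a matrix $X$, $|X|$ is the Euclidean norm; $\nabla w=(\partial_jw_i)_{ij}$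 is the weak gradient. **Theorem.** If $\theta\in(0,1)$ and $1<q<\bar q$, then there is a positive even integer $L$ with $q<q_L$. Moreover, for every real $q>1$ and every positive even integer $L$ there is a constant $C=C(q,L)\ge1$ with the following property. Let $\theta\in(0,1)$ be such that $q<q_L$, and let $M\in\mathbb R^{2\times2}$, $b\in\mathbb R^2$, $\varepsilon,\alpha\in(0,1)$, $s\in(1,\infty)$, and $\Omega\subset\mathbb R^2$ a regular domain. Then there is a piecewise affine map $w\in W^{1,1}(\Omega,\mathbb R^2)\cap C^\alpha(\overline\Omega,\mathbb R^2)$ such that, with $\Omega_{err}=\{x\in\Omega:\nabla w(x)\notin\mathscr G\}$: 1. $w(x)=Mx+b$ for $x\in\partial\Omega$; 2. $|\Omega_{err}|<\varepsilon|\Omega|$; 3. $\displaystyle\int_{\Omega_{err}}(1+|\nabla w|)^s\,dx<\varepsilon|\Omega|$; 4. $|\{x\in\Omega:|\nabla w(x)|>t\}|\le C\,(1+|M|^q)\,|\Omega|\,t^{-q}$ for all $t>0$. In particular, for every $\theta\in(0,1)$ and $1<q<\bar q$, $\mathbb R^{2\times2}$ can be reduced to $\mathscr G$ in weak $L^q$.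 -/

import Mathlib

open MeasureTheory Set
open scoped NNReal ContDiff Matrix

noncomputable section

namespace ConvexIntegration

/-- The Euclidean plane `ℝ²`. -/
abbrev Plane : Type := EuclideanSpace ℝ (Fin 2)

/-- The space `ℝ^{2×2}`. -/
abbrev Mat : Type := Matrix (Fin 2) (Fin 2) ℝ

/-- The Euclidean (Frobenius) norm `|X|` of a matrix. -/
def matNorm (X : Mat) : ℝ := Real.sqrt (∑ i, ∑ j, X i j ^ 2)

/-- The exponent `q_L = 1 - 1/(1+L) + 1/(1+L(1-θ))`. -/
def qExp (θ : ℝ) (L : ℕ) : ℝ := 1 - 1 / (1 + (L : ℝ)) + 1 / (1 + (L : ℝ) * (1 - θ))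

/-- The threshold exponent: the supremum of `q_L` over the positive even integers `L`. -/
def qBar (θ : ℝ) : ℝ := sSup (qExp θ '' {L : ℕ | 0 < L ∧ Even L})

/-- The nonlinearity `A(η) = diag(1 + √θ sin(π η₁), 1 + √θ sin(π η₂)) η`. -/
def fieldA (θ : ℝ) (η : Fin 2 → ℝ) : Fin 2 → ℝ :=
  !![1 + Real.sqrt θ * Real.sin (Real.pi * η 0), 0;
     0, 1 + Real.sqrt θ * Real.sin (Real.pi * η 1)] *ᵥ η

/-- The rotation matrix `J`. -/
def matJ : Mat := !![0, -1; 1, 0]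

/-- The good set: matrices `(x₁ x₂; x₃ x₄)` with `x₁, x₂ ≠ 0` and `A(x₁,x₂) - J(x₃,x₄) = 0`. -/
def goodSet (θ : ℝ) : Set Mat :=
  {X | X 0 0 ≠ 0 ∧ X 0 1 ≠ 0 ∧ fieldA θ ![X 0 0, X 0 1] - matJ *ᵥ ![X 1 0, X 1 1] = 0}

/-- A regular domain: open, connected (in particular non-empty), bounded, with Lebesgue-null
boundary. -/
structure IsRegularDomain (Ω : Set Plane) : Prop where
  isOpen : IsOpen Ω
  isConnected : IsConnected Ω
  isBounded : Bornology.IsBounded Ω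
  volume_frontier : volume (frontier Ω) = 0

/-- The affine map `l_{X,b}(x) = X x + b`. -/
def affineMap (X : Mat) (b : Plane) (x : Plane) : Plane := Matrix.toEuclideanLin X x + b

/-- `w ∈ W^{1,1}(Ω, ℝ²)` and `Dw` is (a representative of) its weak gradient,
`(Dw)_{ij} = ∂_j w_i`; both are integrable on `Ω`, and the gradient is tested against the smooth
functions with compact support in `Ω`. -/
structure IsW11WithGradient (Ω : Set Plane) (w : Plane → Plane) (Dw : Plane → Mat) : Prop where
  integrable : IntegrableOn w Ω
  gradient_integrable : ∀ i j, IntegrableOn (fun x => Dw x i j) Ω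
  weak_gradient : ∀ φ : Plane → ℝ, ContDiff ℝ ∞ φ → HasCompactSupport φ → tsupport φ ⊆ Ω →
    ∀ i j : Fin 2,
      ∫ x in Ω, w x i * fderiv ℝ φ x (EuclideanSpace.single j 1) = -∫ x in Ω, Dw x i j * φ x

/-- `w` is affine on each member of an at most countable family of pairwise disjoint regular
domains contained in `Ω` which cover `Ω` up to a null set. (That `w` is in `W^{1,1}`, the other
requirement on a piecewise affine map, is `IsW11WithGradient`.) -/
def IsPiecewiseAffineOn (Ω : Set Plane) (w : Plane → Plane) : Prop :=
  ∃ 𝒰 : Set (Set Plane), 𝒰.Countable ∧ 𝒰.PairwiseDisjoint id ∧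
    (∀ U ∈ 𝒰, IsRegularDomain U ∧ U ⊆ Ω ∧
      ∃ (X : Mat) (b : Plane), ∀ x ∈ U, w x = affineMap X b x) ∧
    volume (Ω \ ⋃₀ 𝒰) = 0

/-- The error set `{x ∈ Ω : ∇w(x) ∉ K}`. -/
def errorSet (Ω : Set Plane) (Dw : Plane → Mat) (K : Set Mat) : Set Plane :=
  {x ∈ Ω | Dw x ∉ K}

end ConvexIntegration

end

noncomputable section

namespace ConvexIntegration

open scoped ENNReal

/-! Since `matJ` sends (x₃, x₄) to (-x₄, x₃), membership in `goodSet θ` means x₄ = -a(x₁) and x₃ =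
a(x₂) with a = `oscillation √θ` and x₁, x₂ ≠ 0. The pairs (x₁, x₄) and (x₂, x₃) decouple, and in the
plane of one pair both coordinate directions are rank-one directions, because moving along them
changes a single entry. It suffices to push a point of the plane onto the graph by horizontal and
vertical splittings, for one pair and then for the other (`reduces_pairGood`, `reduces_goodSet`).

The graph of a oscillates between the lines of slopes 1 - √θ and 1 + √θ. From (x, -kx) split
horizontally into a point (-h, -kx) of the graph with 0 < h ≤ kx, and (x', -kx); split the latter
vertically into (x', a(x')), where x' is chosen with a(x') ≤ c x', and (x', -kx'). Repetition gives
an infinite staircase (`reduces_staircase`). With r = x'/x, the mass that stays on it is at most the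
fraction (1+k)/(r+k) · (cr+k)/((c+k)r), whose logarithmic derivative at r = 1 is -(1/(1+k) +
k/(c+k)). If q is below 1/(1+k) + k/(c+k), small steps keep at most the fraction (x/x')^q
(`exists_step_size`, `staircase_mass_le`), so the mass that reaches size t is O(t^(-q)): this is the
weak bound. For k = 1/L and c = 1 - √θ the threshold is q_L with √θ in place of θ. As √θ > θ there
is room to spare, and a common lower bound σ for √θ serves all admissible θ, which makes the
constant independent of θ (`exists_amplitude_bound`).

Splittings are realised by maps as follows. A tent, the positive part of the minimum of four affine
functions, is added to one component on a small rectangle; two of its slopes give the two prescribed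
matrices, the other two live on thin caps that go into the error (`reducesOn_cell`). A Vitali
covering by such rectangles fills any domain (`reduces_elementary`). The Hölder constant is
controlled by the height of the tents, hence as small as desired, and since all perturbations vanish
off their domains, gluing countably many costs only a factor 2 (`glue_perturbations`,
`IsPerturbation.patch`). `Reduces.iterate` carries out infinitely many steps: the volume still to be
changed tends to 0, so gradients stabilise almost everywhere, and they are dominated in L¹ because
size times remaining mass is summable for q > 1. -/

/-! ### Perturbations and reductions of an affine map -/

/-- The `ℓ¹` norm of the entries of a matrix, with values in `[0, ∞]`. -/
def entrySum (X : Mat) : ℝ≥0∞ := ∑ i, ∑ j, ‖X i j‖ₑ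

/-- Each member of `𝒰` is contained in `A` or disjoint from `A`. -/
def Subordinate (𝒰 : Set (Set Plane)) (A : Set Plane) : Prop := ∀ U ∈ 𝒰, U ⊆ A ∨ Disjoint U A

/-- `f` is a piecewise affine map on `Ω`, extended by zero, with gradient `Df`, affine pieces `𝒰`
and `α`-Hölder constant `H`. -/
structure IsPerturbation (α : ℝ) (Ω : Set Plane) (f : Plane → Plane) (Df : Plane → Mat) (H : ℝ)
    (𝒰 : Set (Set Plane)) : Prop where
  zero : ∀ x ∉ Ω, f x = 0
  grad_zero : ∀ x ∉ Ω, Df x = 0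
  holder : ∀ x y, ‖f x - f y‖ ≤ H * ‖x - y‖ ^ α
  integrable : ∀ i j, Integrable (fun x => Df x i j)
  weak : ∀ φ : Plane → ℝ, ContDiff ℝ ∞ φ → HasCompactSupport φ → ∀ i j : Fin 2,
    ∫ x, f x i * fderiv ℝ φ x (EuclideanSpace.single j 1) = -∫ x, Df x i j * φ x
  countable : 𝒰.Countable
  disjoint : 𝒰.PairwiseDisjoint id
  regular : ∀ U ∈ 𝒰, IsRegularDomain U
  subset : ∀ U ∈ 𝒰, U ⊆ Ω
  affine : ∀ U ∈ 𝒰, ∃ (Y : Mat) (c : Plane), ∀ x ∈ U, f x = affineMap Y c x ∧ Df x = Y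
  null : volume (Ω \ ⋃₀ 𝒰) = 0

/-- On `Ω` the affine map with gradient `X` can be perturbed, with Hölder constant `η` and zero
boundary values, so that off an exceptional set the gradient lies in `K` and falls into `S i` with
probability at most `F i`. -/
def ReducesOn {ι : Type} (α s : ℝ) (Ω : Set Plane) (X : Mat) (K : Set Mat) (S : ι → Set Mat)
    (F : ι → ℝ≥0∞) (c : ℝ≥0∞) (η : ℝ) : Prop :=
  ∃ (f : Plane → Plane) (Df : Plane → Mat) (𝒰 : Set (Set Plane)) (E : Set Plane),
    IsPerturbation α Ω f Df η 𝒰 ∧ E ⊆ Ω ∧ Subordinate 𝒰 E ∧ Ω \ E ⊆ ⋃₀ 𝒰 ∧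
    (∀ x ∈ Ω \ E, X + Df x ∈ K) ∧
    ∫⁻ x in E, ENNReal.ofReal ((1 + matNorm (X + Df x)) ^ s) ≤ ENNReal.ofReal η * volume Ω ∧
    (∀ i, volume {x ∈ Ω \ E | X + Df x ∈ S i} ≤ F i * volume Ω) ∧
    ∫⁻ x in Ω, entrySum (Df x) ≤ c * volume Ω

/-- `ReducesOn` for all regular domains and all `η > 0`. -/
def Reduces {ι : Type} (α s : ℝ) (X : Mat) (K : Set Mat) (S : ι → Set Mat) (F : ι → ℝ≥0∞)
    (c : ℝ≥0∞) : Prop :=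
  ∀ Ω, IsRegularDomain Ω → ∀ η : ℝ, 0 < η → ReducesOn α s Ω X K S F c η

lemma IsRegularDomain.measurableSet {Ω : Set Plane} (h : IsRegularDomain Ω) : MeasurableSet Ω :=
  h.isOpen.measurableSet

lemma IsRegularDomain.volume_lt_top {Ω : Set Plane} (h : IsRegularDomain Ω) : volume Ω < ⊤ :=
  h.isBounded.measure_lt_top

lemma IsRegularDomain.volume_pos {Ω : Set Plane} (h : IsRegularDomain Ω) : 0 < volume Ω :=
  h.isOpen.measure_pos _ h.isConnected.nonempty

lemma enorm_entry_le (X : Mat) (i j : Fin 2) : ‖X i j‖ₑ ≤ entrySum X :=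
  (Finset.single_le_sum (f := fun j => ‖X i j‖ₑ) (fun _ _ => zero_le) (Finset.mem_univ j)).trans
    (Finset.single_le_sum (f := fun i => ∑ j, ‖X i j‖ₑ) (fun _ _ => zero_le) (Finset.mem_univ i))

/-! ### Gluing perturbations of disjoint domains -/

lemma finsum_eq_of_mem {ι V : Type*} [AddCommMonoid V] {U : ι → Set Plane}
    (hU : Pairwise fun i j => Disjoint (U i) (U j)) {g : ι → Plane → V}
    (hg : ∀ i, ∀ x ∉ U i, g i x = 0) {i : ι} {x : Plane} (hx : x ∈ U i) :
    ∑ᶠ j, g j x = g i x :=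
  finsum_eq_single _ i fun j hj => hg j x fun hxj => (hU hj).le_bot ⟨hxj, hx⟩

lemma finsum_eq_zero_of_notMem {ι V : Type*} [AddCommMonoid V] {U : ι → Set Plane}
    {g : ι → Plane → V} (hg : ∀ i, ∀ x ∉ U i, g i x = 0) {x : Plane} (hx : x ∉ ⋃ i, U i) :
    ∑ᶠ j, g j x = 0 := by
  rw [finsum_congr fun j => hg j x fun h => hx (mem_iUnion.2 ⟨j, h⟩), finsum_zero]

section Holder

variable {α : ℝ} {f : Plane → Plane} {H : ℝ}

lemma continuous_of_holder (hα : 0 < α) (h : ∀ x y, ‖f x - f y‖ ≤ H * ‖x - y‖ ^ α) :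
    Continuous f := by
  rw [continuous_iff_continuousAt]
  intro x
  rw [ContinuousAt, tendsto_iff_norm_sub_tendsto_zero]
  have h2 : Filter.Tendsto (fun y : Plane => H * ‖y - x‖ ^ α) (nhds x) (nhds 0) := by
    have : Continuous fun y : Plane => H * ‖y - x‖ ^ α :=
      continuous_const.mul ((continuous_id.sub continuous_const).norm.rpow_const
        fun _ => Or.inr hα.le)
    have h3 := this.tendsto x
    simpa [Real.zero_rpow hα.ne'] using h3
  exact squeeze_zero (fun _ => norm_nonneg _) (fun y => h y x) h2

lemma integrable_of_holder {Ω : Set Plane} (hb : Bornology.IsBounded Ω) (hα : 0 < α)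
    (h : ∀ x y, ‖f x - f y‖ ≤ H * ‖x - y‖ ^ α) (h0 : ∀ x ∉ Ω, f x = 0) : Integrable f := by
  refine (continuous_of_holder hα h).integrable_of_hasCompactSupport ?_
  refine HasCompactSupport.intro (hb.isCompact_closure) fun x hx => h0 x fun hx' => hx ?_
  exact subset_closure hx'

end Holder

lemma integrable_mul_test {u : Plane → ℝ} (hu : Integrable u) {φ : Plane → ℝ}
    (hφ : Continuous φ) (hc : HasCompactSupport φ) : Integrable fun x => u x * φ x := by
  obtain ⟨C, hC⟩ := hφ.bounded_above_of_compact_support hc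
  exact hu.mul_bdd (c := C) hφ.aestronglyMeasurable (Filter.Eventually.of_forall hC)

lemma continuous_fderiv_apply_of_contDiff {φ : Plane → ℝ} (hφ : ContDiff ℝ ∞ φ) (v : Plane) :
    Continuous fun x => fderiv ℝ φ x v :=
  (hφ.continuous_fderiv (by simp)).clm_apply continuous_const

lemma hasCompactSupport_fderiv_apply' {φ : Plane → ℝ} (hφ : HasCompactSupport φ) (v : Plane) :
    HasCompactSupport fun x => fderiv ℝ φ x v :=
  hφ.fderiv_apply (𝕜 := ℝ) v

lemma continuous_entry {f : Plane → Plane} (hf : Continuous f) (i : Fin 2) :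
    Continuous fun x => f x i :=
  (EuclideanSpace.proj (𝕜 := ℝ) i).continuous.comp hf

lemma Integrable.entry {f : Plane → Plane} (hf : Integrable f) (i : Fin 2) :
    Integrable fun x => f x i :=
  (EuclideanSpace.proj (𝕜 := ℝ) i).integrable_comp hf

lemma affineMap_add (X Y : Mat) (b c x : Plane) :
    affineMap X b x + affineMap Y c x = affineMap (X + Y) (b + c) x := by
  simp only [affineMap, map_add, LinearMap.add_apply]
  abel

/-- Perturbations of pairwise disjoint domains add up. -/
theorem glue_perturbations {ι : Type*} [Countable ι] {α η : ℝ} (hα : 0 < α) (hη : 0 ≤ η)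
    {Ω : Set Plane} (hΩ : Bornology.IsBounded Ω)
    {U : ι → Set Plane} (hd : Pairwise fun i j => Disjoint (U i) (U j))
    (hreg : ∀ i, IsRegularDomain (U i)) (hsub : ∀ i, U i ⊆ Ω)
    {g : ι → Plane → Plane} {Dg : ι → Plane → Mat} {𝒱 : ι → Set (Set Plane)}
    (hg : ∀ i, IsPerturbation α (U i) (g i) (Dg i) η (𝒱 i))
    (hfin : ∑' i, ∫⁻ x in U i, entrySum (Dg i x) ≠ ⊤) :
    (∀ x y, ‖∑ᶠ k, g k x - ∑ᶠ k, g k y‖ ≤ 2 * η * ‖x - y‖ ^ α) ∧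
    (∀ i j, Integrable fun x => (∑ᶠ k, Dg k x) i j) ∧
    (∀ φ : Plane → ℝ, ContDiff ℝ ∞ φ → HasCompactSupport φ → ∀ i j : Fin 2,
      ∫ x, (∑ᶠ k, g k x) i * fderiv ℝ φ x (EuclideanSpace.single j 1) =
        -∫ x, (∑ᶠ k, Dg k x) i j * φ x) := by
  have hz := fun k => (hg k).zero
  have hDz := fun k => (hg k).grad_zero
  have hold : ∀ x y, ‖∑ᶠ k, g k x - ∑ᶠ k, g k y‖ ≤ 2 * η * ‖x - y‖ ^ α := by
    intro x y
    have hr : 0 ≤ η * ‖x - y‖ ^ α := by positivity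
    -- As `g k` vanishes at y, the Hölder bound controls its size at x. Two points in different
    -- domains thus cost two such terms, whatever the number of domains.
    have key : ∀ x y : Plane, ∀ k, x ∈ U k → y ∉ U k → ‖g k x‖ ≤ η * ‖x - y‖ ^ α := by
      intro x y k _ hy
      have := (hg k).holder x y
      rwa [hz k y hy, sub_zero] at this
    by_cases hx : x ∈ ⋃ k, U k
    · obtain ⟨k, hk⟩ := mem_iUnion.1 hx
      rw [finsum_eq_of_mem hd hz hk]
      by_cases hy : y ∈ ⋃ k, U k
      · obtain ⟨l, hl⟩ := mem_iUnion.1 hy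
        rw [finsum_eq_of_mem hd hz hl]
        by_cases hkl : k = l
        · subst hkl
          have := (hg k).holder x y
          linarith
        · have h1 := key x y k hk fun h => (hd hkl).le_bot ⟨h, hl⟩
          have h2 := key y x l hl fun h => (hd hkl).le_bot ⟨hk, h⟩
          rw [norm_sub_rev y x] at h2
          have := norm_sub_le (g k x) (g l y)
          linarith
      · rw [finsum_eq_zero_of_notMem hz hy, sub_zero]
        have h1 := key x y k hk fun h => hy (mem_iUnion.2 ⟨k, h⟩)
        linarith
    · rw [finsum_eq_zero_of_notMem hz hx]
      by_cases hy : y ∈ ⋃ k, U k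
      · obtain ⟨l, hl⟩ := mem_iUnion.1 hy
        rw [finsum_eq_of_mem hd hz hl, zero_sub, norm_neg]
        have h2 := key y x l hl fun h => hx (mem_iUnion.2 ⟨l, h⟩)
        rw [norm_sub_rev y x] at h2
        linarith
      · rw [finsum_eq_zero_of_notMem hz hy]
        simp only [sub_zero, norm_zero]
        linarith
  have hUm : ∀ k, MeasurableSet (U k) := fun k => (hreg k).measurableSet
  have hint : ∀ i j, Integrable fun x => (∑ᶠ k, Dg k x) i j := by
    intro i j
    rw [← integrableOn_iff_integrable_of_support_subset (s := ⋃ k, U k)]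
    · refine ⟨?_, ?_⟩
      · refine aestronglyMeasurable_iUnion_iff.2 fun k => ?_
        refine ((hg k).integrable i j).aestronglyMeasurable.restrict.congr ?_
        filter_upwards [ae_restrict_mem (hUm k)] with x hx
        rw [finsum_eq_of_mem hd hDz hx]
      · rw [hasFiniteIntegral_iff_enorm]
        refine ((lintegral_iUnion_le _ _).trans ?_).trans_lt (lt_top_iff_ne_top.2 hfin)
        refine ENNReal.tsum_le_tsum fun k => ?_
        refine setLIntegral_mono' (hUm k) fun x hx => ?_
        rw [finsum_eq_of_mem hd hDz hx]
        exact enorm_entry_le _ i j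
    · intro x hx
      by_contra hx'
      exact hx (by simp [finsum_eq_zero_of_notMem hDz hx'])
  refine ⟨hold, hint, fun φ hφ hc i j => ?_⟩
  have hG : Integrable fun x => ∑ᶠ k, g k x :=
    integrable_of_holder hΩ hα hold fun x hx =>
      finsum_eq_zero_of_notMem hz fun h => by
        obtain ⟨k, hk⟩ := mem_iUnion.1 h
        exact hx (hsub k hk)
  have h1 := integrable_mul_test (Integrable.entry hG i)
    (continuous_fderiv_apply_of_contDiff hφ (EuclideanSpace.single j 1))
    (hasCompactSupport_fderiv_apply' hc _)
  have h2 := integrable_mul_test (hint i j) hφ.continuous hc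
  rw [← setIntegral_eq_integral_of_forall_compl_eq_zero (s := ⋃ k, U k) (fun x hx => by
      simp [finsum_eq_zero_of_notMem hz hx]),
    ← setIntegral_eq_integral_of_forall_compl_eq_zero (s := ⋃ k, U k)
      (f := fun x => (∑ᶠ k, Dg k x) i j * φ x) (fun x hx => by
      simp [finsum_eq_zero_of_notMem hDz hx]),
    integral_iUnion hUm hd h1.integrableOn, integral_iUnion hUm hd h2.integrableOn, ← tsum_neg]
  congr 1
  ext k
  have e1 : ∫ x in U k, (∑ᶠ k, g k x) i * fderiv ℝ φ x (EuclideanSpace.single j 1) =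
      ∫ x, g k x i * fderiv ℝ φ x (EuclideanSpace.single j 1) := by
    rw [← setIntegral_eq_integral_of_forall_compl_eq_zero (s := U k)
      (f := fun x => g k x i * fderiv ℝ φ x (EuclideanSpace.single j 1))
      (fun x hx => by simp [hz k x hx])]
    exact setIntegral_congr_fun (hUm k) fun x hx => by simp only [finsum_eq_of_mem hd hz hx]
  have e2 : ∫ x in U k, (∑ᶠ k, Dg k x) i j * φ x = ∫ x, Dg k x i j * φ x := by
    rw [← setIntegral_eq_integral_of_forall_compl_eq_zero (s := U k)
      (f := fun x => Dg k x i j * φ x) (fun x hx => by simp [hDz k x hx])]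
    exact setIntegral_congr_fun (hUm k) fun x hx => by simp only [finsum_eq_of_mem hd hDz hx]
  rw [e1, e2]
  exact (hg k).weak φ hφ hc i j

/-- Sets that are unions of pieces are countable unions of open sets. This is the source of all
measurability below, and it lets integrals over them be summed piece by piece. -/
lemma exists_eq_sUnion_of_subordinate {𝒰 : Set (Set Plane)} {A : Set Plane} (hA : A ⊆ ⋃₀ 𝒰)
    (h : Subordinate 𝒰 A) : A = ⋃ U : {U // U ∈ 𝒰 ∧ U ⊆ A}, U.1 := by
  ext x
  simp only [mem_iUnion, Subtype.exists, exists_prop]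
  constructor
  · intro hx
    obtain ⟨U, hU, hxU⟩ := hA hx
    refine ⟨U, ⟨hU, ?_⟩, hxU⟩
    rcases h U hU with h | h
    · exact h
    · exact (h.le_bot ⟨hxU, hx⟩).elim
  · rintro ⟨U, ⟨_, hU⟩, hx⟩
    exact hU hx

lemma Subordinate.of_refine {𝒰 𝒱 : Set (Set Plane)} {A : Set Plane} (h : Subordinate 𝒰 A)
    (href : ∀ V ∈ 𝒱, ∃ U ∈ 𝒰, V ⊆ U) : Subordinate 𝒱 A := by
  intro V hV
  obtain ⟨U, hU, hVU⟩ := href V hV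
  exact (h U hU).imp hVU.trans fun h => h.mono_left hVU

/-- Perturb a piecewise affine map further on the pieces contained in `A`. -/
theorem IsPerturbation.patch {ι : Type} {α s H η : ℝ} (hα : 0 < α) (hη : 0 ≤ η) {Ω A : Set Plane}
    (hΩ : IsRegularDomain Ω) {f : Plane → Plane} {Df : Plane → Mat} {𝒰 : Set (Set Plane)}
    (hf : IsPerturbation α Ω f Df H 𝒰) (hA : A ⊆ ⋃₀ 𝒰) (hsub : Subordinate 𝒰 A) {M : Mat}
    {K : Mat → Set Mat} {S : ι → Set Mat} {F : Mat → ι → ℝ≥0∞} {c : ℝ≥0∞} (hc : c ≠ ⊤)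
    (hred : ∀ U ∈ 𝒰, U ⊆ A → ∀ x ∈ U,
      ReducesOn α s U (M + Df x) (K (M + Df x)) S (F (M + Df x)) c η) :
    ∃ (f' : Plane → Plane) (Df' : Plane → Mat) (𝒰' : Set (Set Plane)) (E : Set Plane),
      IsPerturbation α Ω f' Df' (H + 2 * η) 𝒰' ∧
      (∀ x y, ‖(f' x - f x) - (f' y - f y)‖ ≤ 2 * η * ‖x - y‖ ^ α) ∧
      (∀ x ∉ A, f' x = f x ∧ Df' x = Df x) ∧ E ⊆ A ∧
      (∀ x ∈ A \ E, M + Df' x ∈ K (M + Df x)) ∧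
      ∫⁻ x in E, ENNReal.ofReal ((1 + matNorm (M + Df' x)) ^ s) ≤
        ENNReal.ofReal η * volume A ∧
      (∀ i, volume {x ∈ A \ E | M + Df' x ∈ S i} ≤ ∫⁻ x in A, F (M + Df x) i) ∧
      ∫⁻ x in A, entrySum (Df' x - Df x) ≤ c * volume A ∧
      (∀ V ∈ 𝒰', ∃ U ∈ 𝒰, V ⊆ U) ∧ (∀ U ∈ 𝒰, Disjoint U A → U ∈ 𝒰') ∧
      Subordinate 𝒰' E ∧ A \ E ⊆ ⋃₀ 𝒰' := by
  set I := {U : Set Plane // U ∈ 𝒰 ∧ U ⊆ A} with hI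
  have hAU : A = ⋃ U : I, U.1 := exists_eq_sUnion_of_subordinate hA hsub
  have : Countable I := (hf.countable.mono (fun U hU => hU.1 :
    {U : Set Plane | U ∈ 𝒰 ∧ U ⊆ A} ⊆ 𝒰)).to_subtype
  have hd : Pairwise fun i j : I => Disjoint i.1 j.1 := fun i j hij =>
    hf.disjoint i.2.1 j.2.1 fun h => hij (Subtype.ext h)
  have hreg : ∀ U : I, IsRegularDomain U.1 := fun U => hf.regular _ U.2.1
  have hm : ∀ U : I, MeasurableSet U.1 := fun U => (hreg U).measurableSet
  have haff : ∀ U : I, ∃ (Y : Mat) (b : Plane), ∀ x ∈ U.1, f x = affineMap Y b x ∧ Df x = Y :=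
    fun U => hf.affine _ U.2.1
  choose Y b hY using haff
  have hred' : ∀ U : I, ReducesOn α s U.1 (M + Y U) (K (M + Y U)) S (F (M + Y U)) c η := by
    intro U
    obtain ⟨x, hx⟩ := (hreg U).isConnected.nonempty
    have := hred U.1 U.2.1 U.2.2 x hx
    rwa [(hY U x hx).2] at this
  choose g Dg 𝒱 E hg hE hsubE hEU hK hErr hS hL using hred'
  have hz := fun k => (hg k).zero
  have hDz := fun k => (hg k).grad_zero
  have hvol : ∑' U : I, volume U.1 = volume A := by
    conv_rhs => rw [hAU]
    rw [measure_iUnion hd hm]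
  have hfin : ∑' U : I, ∫⁻ x in U.1, entrySum (Dg U x) ≤ c * volume A := by
    rw [← hvol, ← ENNReal.tsum_mul_left]
    exact ENNReal.tsum_le_tsum hL
  have hAΩ : A ⊆ Ω := fun x hx => by
    obtain ⟨U, hU, hxU⟩ := hA hx
    exact hf.subset U hU hxU
  -- Smallness of the Hölder constants says nothing about gradients; the common L¹ bound c,
  -- proportional to volume, is what makes the glued gradient integrable.
  have hfin' : ∑' U : I, ∫⁻ x in U.1, entrySum (Dg U x) ≠ ⊤ :=
    (hfin.trans_lt (ENNReal.mul_lt_top hc.lt_top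
      ((measure_mono hAΩ).trans_lt hΩ.volume_lt_top))).ne
  obtain ⟨hold, hint, hweak⟩ := glue_perturbations hα hη hΩ.isBounded hd hreg
    (fun U => hf.subset _ U.2.1) hg hfin'
  set G : Plane → Plane := fun x => ∑ᶠ k, g k x with hG
  set DG : Plane → Mat := fun x => ∑ᶠ k, Dg k x with hDG
  have hGA : ∀ x ∉ A, G x = 0 := fun x hx =>
    finsum_eq_zero_of_notMem hz (by rwa [← hAU])
  have hDGA : ∀ x ∉ A, DG x = 0 := fun x hx =>
    finsum_eq_zero_of_notMem hDz (by rwa [← hAU])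
  have hGU : ∀ U : I, ∀ x ∈ U.1, G x = g U x := fun U x hx => finsum_eq_of_mem hd hz hx
  have hDGU : ∀ U : I, ∀ x ∈ U.1, DG x = Dg U x := fun U x hx => finsum_eq_of_mem hd hDz hx
  have hmem : ∀ x ∈ A, ∃ U : I, x ∈ U.1 := fun x hx => by
    rw [hAU] at hx
    exact mem_iUnion.1 hx
  have hIA : ∀ U : I, U.1 ⊆ A := fun U => U.2.2
  have hEA : ∀ U : I, E U ⊆ U.1 := hE
  have hEmem : ∀ U : I, ∀ x ∈ U.1, x ∈ ⋃ k, E k → x ∈ E U := by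
    intro U x hx hxE
    obtain ⟨V, hV⟩ := mem_iUnion.1 hxE
    by_cases hUV : U = V
    · exact hUV ▸ hV
    · exact ((hd hUV).le_bot ⟨hx, hEA V hV⟩).elim
  -- Pieces disjoint from A are kept, those inside A are replaced by their subdivisions.
  refine ⟨fun x => f x + G x, fun x => Df x + DG x, {U ∈ 𝒰 | Disjoint U A} ∪ ⋃ U : I, 𝒱 U,
    ⋃ U : I, E U, ?_, ?_, ?_, ?_, ?_, ?_, ?_, ?_, ?_, ?_, ?_, ?_⟩
  · refine ⟨?_, ?_, ?_, ?_, ?_, ?_, ?_, ?_, ?_, ?_, ?_⟩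
    · intro x hx
      simp [hf.zero x hx, hGA x fun h => hx (hAΩ h)]
    · intro x hx
      simp [hf.grad_zero x hx, hDGA x fun h => hx (hAΩ h)]
    · intro x y
      have h1 := hf.holder x y
      have h2 := hold x y
      calc ‖f x + G x - (f y + G y)‖ = ‖(f x - f y) + (G x - G y)‖ := by congr 1; abel
        _ ≤ ‖f x - f y‖ + ‖G x - G y‖ := norm_add_le _ _
        _ ≤ H * ‖x - y‖ ^ α + 2 * η * ‖x - y‖ ^ α := add_le_add h1 h2
        _ = _ := by ring
    · exact fun i j => (hf.integrable i j).add (hint i j)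
    · intro φ hφ hc i j
      have hv := continuous_fderiv_apply_of_contDiff hφ (EuclideanSpace.single j 1)
      have hvc := hasCompactSupport_fderiv_apply' hc (EuclideanSpace.single j 1)
      have i1 := integrable_mul_test (Integrable.entry
        (integrable_of_holder hΩ.isBounded hα hf.holder hf.zero) i) hv hvc
      have i2 := integrable_mul_test (Integrable.entry
        (integrable_of_holder hΩ.isBounded hα hold fun x hx => hGA x fun h => hx (hAΩ h)) i) hv hvc
      have i3 := integrable_mul_test (hf.integrable i j) hφ.continuous hc
      have i4 := integrable_mul_test (hint i j) hφ.continuous hc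
      simp only [PiLp.add_apply, Matrix.add_apply, add_mul]
      rw [integral_add i1 i2, integral_add i3 i4, hf.weak φ hφ hc i j, hweak φ hφ hc i j]
      ring
    · exact (hf.countable.mono (sep_subset _ _)).union
        (countable_iUnion fun U => (hg U).countable)
    · rintro V hV W hW hVW
      rcases hV with ⟨hV, hVA⟩ | hV
      · rcases hW with ⟨hW, hWA⟩ | hW
        · exact hf.disjoint hV hW hVW
        · obtain ⟨U, hU⟩ := mem_iUnion.1 hW
          exact hVA.mono_right (((hg U).subset W hU).trans (hIA U))
      · obtain ⟨U, hU⟩ := mem_iUnion.1 hV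
        rcases hW with ⟨hW, hWA⟩ | hW
        · exact (hWA.mono_right (((hg U).subset V hU).trans (hIA U))).symm
        · obtain ⟨U', hU'⟩ := mem_iUnion.1 hW
          by_cases hUU : U = U'
          · subst hUU
            exact (hg U).disjoint hU hU' hVW
          · exact (hd hUU).mono ((hg U).subset V hU) ((hg U').subset W hU')
    · rintro V (⟨hV, _⟩ | hV)
      · exact hf.regular V hV
      · obtain ⟨U, hU⟩ := mem_iUnion.1 hV
        exact (hg U).regular V hU
    · rintro V (⟨hV, _⟩ | hV)
      · exact hf.subset V hV
      · obtain ⟨U, hU⟩ := mem_iUnion.1 hV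
        exact ((hg U).subset V hU).trans ((hIA U).trans hAΩ)
    · rintro V (⟨hV, hVA⟩ | hV)
      · obtain ⟨Z, d, h⟩ := hf.affine V hV
        refine ⟨Z, d, fun x hx => ?_⟩
        have hxA : x ∉ A := fun hxA => hVA.le_bot ⟨hx, hxA⟩
        simpa [hGA x hxA, hDGA x hxA] using h x hx
      · obtain ⟨U, hU⟩ := mem_iUnion.1 hV
        obtain ⟨Z, d, h⟩ := (hg U).affine V hU
        refine ⟨Y U + Z, b U + d, fun x hx => ?_⟩
        have hxU := (hg U).subset V hU hx
        rw [hGU U x hxU, hDGU U x hxU, (hY U x hxU).1, (hY U x hxU).2, (h x hx).1, (h x hx).2]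
        exact ⟨affineMap_add _ _ _ _ _, rfl⟩
    · refine measure_mono_null (t := (Ω \ ⋃₀ 𝒰) ∪ ⋃ U : I, (U.1 \ ⋃₀ 𝒱 U)) ?_
        (measure_union_null hf.null (measure_iUnion_null fun U => (hg U).null))
      rintro x ⟨hxΩ, hx⟩
      by_cases hxU : x ∈ ⋃₀ 𝒰
      · right
        obtain ⟨U, hU, hxU⟩ := hxU
        rcases hsub U hU with h | h
        · refine mem_iUnion.2 ⟨⟨U, hU, h⟩, hxU, ?_⟩
          rintro ⟨V, hV, hxV⟩
          exact hx ⟨V, Or.inr (mem_iUnion.2 ⟨_, hV⟩), hxV⟩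
        · exact (hx ⟨U, Or.inl ⟨hU, h⟩, hxU⟩).elim
      · exact Or.inl ⟨hxΩ, hxU⟩
  · intro x y
    have := hold x y
    simpa using this
  · intro x hx
    simp [hGA x hx, hDGA x hx]
  · exact iUnion_subset fun U => (hEA U).trans (hIA U)
  · rintro x ⟨hxA, hxE⟩
    obtain ⟨U, hU⟩ := hmem x hxA
    have := hK U x ⟨hU, fun h => hxE (mem_iUnion.2 ⟨U, h⟩)⟩
    change M + (Df x + DG x) ∈ K (M + Df x)
    rwa [hDGU U x hU, (hY U x hU).2, ← add_assoc]
  · refine (lintegral_iUnion_le _ _).trans ?_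
    rw [← hvol, ← ENNReal.tsum_mul_left]
    refine ENNReal.tsum_le_tsum fun U => le_trans (le_of_eq ?_) (hErr U)
    rw [← Measure.restrict_restrict_of_subset (hEA U)]
    refine lintegral_congr_ae (ae_restrict_of_ae ?_)
    filter_upwards [ae_restrict_mem (hm U)] with x hx
    rw [hDGU U x hx, (hY U x hx).2, ← add_assoc]
  · intro i
    calc volume {x ∈ A \ ⋃ U, E U | M + (Df x + DG x) ∈ S i}
        ≤ volume (⋃ U : I, {x ∈ U.1 \ E U | M + Y U + Dg U x ∈ S i}) := by
          refine measure_mono ?_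
          rintro x ⟨⟨hxA, hxE⟩, hx⟩
          obtain ⟨U, hU⟩ := hmem x hxA
          refine mem_iUnion.2 ⟨U, ⟨hU, fun h => hxE (mem_iUnion.2 ⟨U, h⟩)⟩, ?_⟩
          rwa [hDGU U x hU, (hY U x hU).2, ← add_assoc] at hx
      _ ≤ ∑' U : I, volume {x ∈ U.1 \ E U | M + Y U + Dg U x ∈ S i} := measure_iUnion_le _
      _ ≤ ∑' U : I, F (M + Y U) i * volume U.1 := ENNReal.tsum_le_tsum fun U => hS U i
      _ = ∑' U : I, ∫⁻ x in U.1, F (M + Df x) i := by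
          congr 1
          ext U
          rw [← setLIntegral_const]
          exact setLIntegral_congr_fun (hm U) fun x hx => by simp only [(hY U x hx).2]
      _ = ∫⁻ x in A, F (M + Df x) i := by
          conv_rhs => rw [hAU]
          rw [lintegral_iUnion hm hd]
  · refine le_trans (le_of_eq ?_) hfin
    conv_lhs => rw [hAU]
    rw [lintegral_iUnion hm hd]
    congr 1
    ext U
    refine setLIntegral_congr_fun (hm U) fun x hx => ?_
    simp only [add_sub_cancel_left, hDGU U x hx]
  · rintro V (⟨hV, _⟩ | hV)
    · exact ⟨V, hV, Subset.rfl⟩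
    · obtain ⟨U, hU⟩ := mem_iUnion.1 hV
      exact ⟨U.1, U.2.1, (hg U).subset V hU⟩
  · exact fun U hU h => Or.inl ⟨hU, h⟩
  · rintro V (⟨hV, hVA⟩ | hV)
    · exact Or.inr (hVA.mono_right (iUnion_subset fun U => (hEA U).trans (hIA U)))
    · obtain ⟨U, hU⟩ := mem_iUnion.1 hV
      rcases hsubE U V hU with h | h
      · exact Or.inl (h.trans (subset_iUnion E U))
      · refine Or.inr (disjoint_left.2 fun x hx hxE => ?_)
        exact h.le_bot ⟨hx, hEmem U x ((hg U).subset V hU hx) hxE⟩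
  · rintro x ⟨hxA, hxE⟩
    obtain ⟨U, hU⟩ := hmem x hxA
    obtain ⟨V, hV, hxV⟩ := hEU U ⟨hU, fun h => hxE (mem_iUnion.2 ⟨U, h⟩)⟩
    exact ⟨V, Or.inr (mem_iUnion.2 ⟨U, hV⟩), hxV⟩

/-! ### Tents: truncated minima of affine functions -/

lemma volume_hyperplane {n : Plane →L[ℝ] ℝ} (hn : n ≠ 0) (c : ℝ) :
    volume {x : Plane | n x = c} = 0 := by
  by_cases h : ∃ x₀, n x₀ = c
  · obtain ⟨x₀, rfl⟩ := h
    have h1 : {x : Plane | n x = n x₀} =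
        (fun x => x + -x₀) ⁻¹' (LinearMap.ker n.toLinearMap : Set Plane) := by
      ext x
      simp [add_neg_eq_zero]
    rw [h1, measure_preimage_add_right]
    refine Measure.addHaar_submodule _ _ fun h => hn ?_
    ext x
    have : x ∈ LinearMap.ker n.toLinearMap := h ▸ Submodule.mem_top
    simpa using this
  · have : {x : Plane | n x = c} = ∅ := by
      ext x
      simpa using fun hx => h ⟨x, hx⟩
    rw [this, measure_empty]

section Tent

set_option linter.unusedSectionVars false

variable {κ : Type} [Fintype κ] [Nonempty κ]

/-- The positive part of the minimum of finitely many affine functions. -/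
def tent (n : κ → Plane →L[ℝ] ℝ) (c : κ → ℝ) (x : Plane) : ℝ :=
  max 0 (Finset.univ.inf' Finset.univ_nonempty fun k => n k x + c k)

/-- The set where all the affine functions are positive. -/
def tentCell (n : κ → Plane →L[ℝ] ℝ) (c : κ → ℝ) : Set Plane := {x | ∀ k, 0 < n k x + c k}

/-- The set where the minimum is attained at `k` only, and is positive. -/
def tentPiece (n : κ → Plane →L[ℝ] ℝ) (c : κ → ℝ) (k : κ) : Set Plane :=
  {x | 0 < n k x + c k ∧ ∀ l, l ≠ k → n k x + c k < n l x + c l}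

open Classical in
/-- The gradient of `tent n c x • v`. -/
def tentGrad (n : κ → Plane →L[ℝ] ℝ) (c : κ → ℝ) (v : Plane) (x : Plane) : Mat :=
  if h : ∃ k, x ∈ tentPiece n c k then
    Matrix.of fun p q => v p * n h.choose (EuclideanSpace.single q 1) else 0

variable {n : κ → Plane →L[ℝ] ℝ} {c : κ → ℝ}

lemma tentPiece_subset (k : κ) : tentPiece n c k ⊆ tentCell n c := by
  rintro x ⟨h0, h⟩ l
  by_cases hl : l = k
  · rwa [hl]
  · exact h0.trans (h l hl)

lemma tentPiece_unique {k l : κ} {x : Plane} (hk : x ∈ tentPiece n c k)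
    (hl : x ∈ tentPiece n c l) : k = l := by
  by_contra h
  exact lt_asymm (hk.2 l (Ne.symm h)) (hl.2 k h)

lemma tentGrad_of_mem {v : Plane} {k : κ} {x : Plane} (hk : x ∈ tentPiece n c k) :
    tentGrad n c v x = Matrix.of fun p q => v p * n k (EuclideanSpace.single q 1) := by
  have h : ∃ k, x ∈ tentPiece n c k := ⟨k, hk⟩
  rw [tentGrad, dif_pos h, tentPiece_unique h.choose_spec hk]

lemma tentGrad_of_notMem {v : Plane} {x : Plane} (hk : ∀ k, x ∉ tentPiece n c k) :
    tentGrad n c v x = 0 := by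
  rw [tentGrad, dif_neg (by simpa using hk)]

lemma tent_of_mem {k : κ} {x : Plane} (hk : x ∈ tentPiece n c k) :
    tent n c x = n k x + c k := by
  have : (Finset.univ.inf' Finset.univ_nonempty fun k => n k x + c k) = n k x + c k := by
    refine le_antisymm (Finset.inf'_le _ (Finset.mem_univ k)) (Finset.le_inf' _ _ fun l _ => ?_)
    by_cases hl : l = k
    · rw [hl]
    · exact (hk.2 l hl).le
  rw [tent, this, max_eq_right hk.1.le]

lemma tent_of_notMem {x : Plane} (hx : x ∉ tentCell n c) : tent n c x = 0 := by
  simp only [tentCell, mem_ofPred_eq, not_forall, not_lt] at hx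
  obtain ⟨k, hk⟩ := hx
  exact max_eq_left ((Finset.inf'_le _ (Finset.mem_univ k)).trans hk)

lemma tent_nonneg (x : Plane) : 0 ≤ tent n c x := le_max_left _ _

lemma tent_le {m : ℝ} (hm : 0 ≤ m) {x : Plane} (h : ∃ k, n k x + c k ≤ m) : tent n c x ≤ m := by
  obtain ⟨k, hk⟩ := h
  exact max_le hm ((Finset.inf'_le _ (Finset.mem_univ k)).trans hk)

lemma tent_le_add {N : ℝ} (hN0 : 0 ≤ N) (hN : ∀ k, ‖n k‖ ≤ N) (x y : Plane) :
    tent n c x ≤ tent n c y + N * ‖x - y‖ := by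
  have hr : 0 ≤ N * ‖x - y‖ := by positivity
  refine max_le (by linarith [tent_nonneg (n := n) (c := c) y]) ?_
  obtain ⟨k, -, hk⟩ := Finset.exists_mem_eq_inf' (s := Finset.univ) Finset.univ_nonempty
    fun k => n k y + c k
  have h1 := Finset.inf'_le (fun k => n k x + c k) (Finset.mem_univ k)
  have h2 : n k x - n k y ≤ N * ‖x - y‖ := by
    rw [← map_sub]
    exact (le_abs_self _).trans (((n k).le_opNorm _).trans
      (mul_le_mul_of_nonneg_right (hN k) (norm_nonneg _)))
  have h3 : (Finset.univ.inf' Finset.univ_nonempty fun k => n k y + c k) ≤ tent n c y :=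
    le_max_right _ _
  rw [hk] at h3
  linarith

lemma abs_tent_sub_le {N : ℝ} (hN0 : 0 ≤ N) (hN : ∀ k, ‖n k‖ ≤ N) (x y : Plane) :
    |tent n c x - tent n c y| ≤ N * ‖x - y‖ := by
  have h1 := tent_le_add (c := c) hN0 hN x y
  have h2 := tent_le_add (c := c) hN0 hN y x
  rw [norm_sub_rev y x] at h2
  exact abs_le.2 ⟨by linarith, by linarith⟩

lemma lipschitzWith_tent {N : ℝ} (hN0 : 0 ≤ N) (hN : ∀ k, ‖n k‖ ≤ N) :
    LipschitzWith N.toNNReal (tent n c) :=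
  LipschitzWith.of_dist_le_mul fun x y => by
    rw [Real.dist_eq, dist_eq_norm, Real.coe_toNNReal _ hN0]
    exact abs_tent_sub_le hN0 hN x y

lemma isOpen_tentPiece (k : κ) : IsOpen (tentPiece n c k) := by
  have h : tentPiece n c k =
      {x | 0 < n k x + c k} ∩ ⋂ l, {x | l ≠ k → n k x + c k < n l x + c l} := by
    ext x
    simp [tentPiece]
  rw [h]
  refine (isOpen_lt (by fun_prop) (by fun_prop)).inter (isOpen_iInter_of_finite fun l => ?_)
  by_cases hl : l = k
  · simp [hl]
  · simpa [hl] using isOpen_lt (by fun_prop : Continuous fun x => n k x + c k)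
      (by fun_prop : Continuous fun x => n l x + c l)

lemma convex_affine_lt (m m' : Plane →L[ℝ] ℝ) (a a' : ℝ) :
    Convex ℝ {x | m x + a < m' x + a'} := by
  have h : {x | m x + a < m' x + a'} = {x | (m - m') x < a' - a} := by
    ext x
    simp only [mem_ofPred_eq, _root_.sub_apply]
    constructor <;> intro h <;> linarith
  rw [h]
  exact convex_halfSpace_lt (m - m').isLinear _

lemma convex_affine_pos (m : Plane →L[ℝ] ℝ) (a : ℝ) : Convex ℝ {x | 0 < m x + a} := by
  simpa using convex_affine_lt 0 m 0 a

lemma convex_tentPiece (k : κ) : Convex ℝ (tentPiece n c k) := by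
  have h : tentPiece n c k =
      {x | 0 < n k x + c k} ∩ ⋂ l, {x | l ≠ k → n k x + c k < n l x + c l} := by
    ext x
    simp [tentPiece]
  rw [h]
  refine (convex_affine_pos _ _).inter (convex_iInter fun l => ?_)
  by_cases hl : l = k
  · simpa [hl] using convex_univ
  · simpa [hl] using convex_affine_lt (n k) (n l) (c k) (c l)

lemma isOpen_tentCell : IsOpen (tentCell n c) := by
  have h : tentCell n c = ⋂ k, {x | 0 < n k x + c k} := by
    ext x
    simp [tentCell]
  rw [h]
  exact isOpen_iInter_of_finite fun k => isOpen_lt (by fun_prop) (by fun_prop)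

lemma convex_tentCell : Convex ℝ (tentCell n c) := by
  have h : tentCell n c = ⋂ k, {x | 0 < n k x + c k} := by
    ext x
    simp [tentCell]
  rw [h]
  exact convex_iInter fun k => convex_affine_pos _ _

lemma isRegularDomain_of_convex {U : Set Plane} (ho : IsOpen U) (hc : Convex ℝ U)
    (hne : U.Nonempty) (hb : Bornology.IsBounded U) : IsRegularDomain U :=
  ⟨ho, ⟨hne, hc.isPreconnected⟩, hb, hc.addHaar_frontier volume⟩

/-- A point of the cell outside all pieces is a tie between two of the affine functions. Their
gradients differ, so the ties lie in finitely many lines. -/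
lemma volume_tentCell_diff (hn : Function.Injective n) :
    volume (tentCell n c \ ⋃ k, tentPiece n c k) = 0 := by
  refine measure_mono_null (t := ⋃ k, ⋃ l, {x | k ≠ l ∧ (n k - n l) x = c l - c k}) ?_ ?_
  · rintro x ⟨hx, hx'⟩
    obtain ⟨k, -, hk⟩ := Finset.exists_mem_eq_inf' (s := Finset.univ) Finset.univ_nonempty
      fun k => n k x + c k
    simp only [tentPiece, mem_iUnion, mem_ofPred_eq, not_exists, not_and, not_forall, not_lt] at hx'
    obtain ⟨l, hl, h⟩ := hx' k (hx k)
    have h2 := Finset.inf'_le (fun k => n k x + c k) (Finset.mem_univ l)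
    rw [hk] at h2
    refine mem_iUnion.2 ⟨k, mem_iUnion.2 ⟨l, Ne.symm hl, ?_⟩⟩
    rw [_root_.sub_apply]
    linarith
  · refine measure_iUnion_null fun k => measure_iUnion_null fun l => ?_
    by_cases hkl : k = l
    · simp [hkl]
    · refine measure_mono_null (fun x hx => hx.2)
        (volume_hyperplane (sub_ne_zero.2 (hn.ne hkl)) _)

/-- Off the null set of ties and the null frontier of the convex cell, the tent is locally affine or
locally zero. -/
lemma ae_lineDeriv_tent (hn : Function.Injective n) (v : Plane) (p q : Fin 2) :
    ∀ᵐ x, v p * lineDeriv ℝ (tent n c) x (EuclideanSpace.single q 1) = tentGrad n c v x p q := by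
  have h1 := convex_tentCell (n := n) (c := c).addHaar_frontier volume
  have h2 := volume_tentCell_diff (c := c) hn
  filter_upwards [compl_mem_ae_iff.2 h1, compl_mem_ae_iff.2 h2] with x hx1 hx2
  by_cases hx : x ∈ ⋃ k, tentPiece n c k
  · obtain ⟨k, hk⟩ := mem_iUnion.1 hx
    rw [tentGrad_of_mem hk]
    have he : tent n c =ᶠ[nhds x] fun y => n k y + c k := by
      filter_upwards [(isOpen_tentPiece k).mem_nhds hk] with y hy using tent_of_mem hy
    have hd : HasFDerivAt (tent n c) (n k) x :=
      ((n k).hasFDerivAt.add_const (c k)).congr_of_eventuallyEq he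
    rw [(hd.hasLineDerivAt _).lineDeriv]
    rfl
  · have hxc : x ∉ tentCell n c := fun h => hx2 ⟨h, hx⟩
    have hxc' : x ∈ (closure (tentCell n c))ᶜ := fun h => hx1 ⟨h, by
      rwa [isOpen_tentCell.interior_eq]⟩
    rw [tentGrad_of_notMem fun k hk => hx (mem_iUnion.2 ⟨k, hk⟩)]
    have he : tent n c =ᶠ[nhds x] fun _ => 0 := by
      filter_upwards [isClosed_closure.isOpen_compl.mem_nhds hxc'] with y hy
      exact tent_of_notMem fun h => hy (subset_closure h)
    have hd : HasFDerivAt (tent n c) (0 : Plane →L[ℝ] ℝ) x :=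
      (hasFDerivAt_const (0 : ℝ) x).congr_of_eventuallyEq he
    rw [(hd.hasLineDerivAt _).lineDeriv]
    simp

lemma fderiv_single_eq (k : κ) (v : Plane) (x : Plane) :
    affineMap (Matrix.of fun p q => v p * n k (EuclideanSpace.single q 1)) (c k • v) x =
      (n k x + c k) • v := by
  have hx : x = x 0 • EuclideanSpace.single 0 1 + x 1 • EuclideanSpace.single 1 1 := by
    ext i
    fin_cases i <;> simp
  have hnx : n k x = x 0 * n k (EuclideanSpace.single 0 1) +
      x 1 * n k (EuclideanSpace.single 1 1) := by
    conv_lhs => rw [hx]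
    simp
  ext i
  simp only [affineMap, PiLp.add_apply, PiLp.smul_apply, Matrix.toLpLin_apply,
    Matrix.mulVec, dotProduct, Fin.sum_univ_two, Matrix.of_apply, smul_eq_mul, hnx]
  ring

/-- The map `tent n c • v` is a perturbation of its cell. -/
theorem isPerturbation_tent {α N m H : ℝ} (hα0 : 0 < α) (hα1 : α < 1)
    (hn : Function.Injective n) (hN0 : 0 ≤ N) (hN : ∀ k, ‖n k‖ ≤ N) (hm : 0 ≤ m)
    (hle : ∀ x, ∃ k, n k x + c k ≤ m) (hb : Bornology.IsBounded (tentCell n c)) (v : Plane)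
    (hH : N ^ α * m ^ (1 - α) * ‖v‖ ≤ H) :
    IsPerturbation α (tentCell n c) (fun x => tent n c x • v) (tentGrad n c v) H
      {U | U.Nonempty ∧ ∃ k, U = tentPiece n c k} := by
  have hreg : ∀ k, (tentPiece n c k).Nonempty → IsRegularDomain (tentPiece n c k) := fun k hne =>
    isRegularDomain_of_convex (isOpen_tentPiece k) (convex_tentPiece k) hne
      (hb.subset (tentPiece_subset k))
  have hcont : Continuous (tent n c) := (lipschitzWith_tent hN0 hN).continuous
  have hcs : HasCompactSupport (tent n c) :=
    HasCompactSupport.intro hb.isCompact_closure fun x hx =>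
      tent_of_notMem fun h => hx (subset_closure h)
  refine ⟨?_, ?_, ?_, ?_, ?_, ?_, ?_, ?_, ?_, ?_, ?_⟩
  · intro x hx
    simp [tent_of_notMem hx]
  · intro x hx
    exact tentGrad_of_notMem fun k hk => hx (tentPiece_subset k hk)
  · intro x y
    have h1 := abs_tent_sub_le (c := c) hN0 hN x y
    have h2 : |tent n c x - tent n c y| ≤ m := by
      have a1 := tent_le hm (hle x)
      have a2 := tent_le hm (hle y)
      have a3 := tent_nonneg (n := n) (c := c) x
      have a4 := tent_nonneg (n := n) (c := c) y
      exact abs_le.2 ⟨by linarith, by linarith⟩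
    -- Interpolation: a power α of the difference is estimated by the Lipschitz bound, the remaining
    -- power 1 - α by the height m. Lowering the tent therefore makes the Hölder constant small.
    have h3 : |tent n c x - tent n c y| ≤ (N * ‖x - y‖) ^ α * m ^ (1 - α) := by
      calc |tent n c x - tent n c y|
          = |tent n c x - tent n c y| ^ α * |tent n c x - tent n c y| ^ (1 - α) := by
            rw [← Real.rpow_add_of_nonneg (abs_nonneg _) hα0.le (by linarith)]
            simp
        _ ≤ _ := mul_le_mul (Real.rpow_le_rpow (abs_nonneg _) h1 hα0.le)
            (Real.rpow_le_rpow (abs_nonneg _) h2 (by linarith)) (by positivity) (by positivity)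
    rw [← sub_smul, norm_smul, Real.norm_eq_abs]
    rw [Real.mul_rpow hN0 (norm_nonneg _)] at h3
    calc |tent n c x - tent n c y| * ‖v‖
        ≤ N ^ α * ‖x - y‖ ^ α * m ^ (1 - α) * ‖v‖ :=
          mul_le_mul_of_nonneg_right h3 (norm_nonneg _)
      _ = N ^ α * m ^ (1 - α) * ‖v‖ * ‖x - y‖ ^ α := by ring
      _ ≤ H * ‖x - y‖ ^ α := mul_le_mul_of_nonneg_right hH (by positivity)
  · intro p q
    have hmeas : AEStronglyMeasurable (fun x => tentGrad n c v x p q) volume := by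
      refine AEStronglyMeasurable.congr ?_ (ae_lineDeriv_tent hn v p q)
      exact ((measurable_lineDeriv hcont).const_mul _).aestronglyMeasurable
    rw [← integrableOn_iff_integrable_of_support_subset (s := tentCell n c)]
    · refine Measure.integrableOn_of_bounded (M := |v p| * N) hb.measure_lt_top.ne hmeas ?_
      refine Filter.Eventually.of_forall fun x => ?_
      by_cases hx : ∃ k, x ∈ tentPiece n c k
      · obtain ⟨k, hk⟩ := hx
        rw [tentGrad_of_mem hk, Matrix.of_apply, norm_mul, Real.norm_eq_abs (v p)]
        refine mul_le_mul_of_nonneg_left (((n k).le_opNorm _).trans ?_) (abs_nonneg _)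
        simpa using hN k
      · rw [tentGrad_of_notMem (by simpa using hx)]
        simp only [Matrix.zero_apply, norm_zero]
        positivity
    · intro x hx
      by_contra hx'
      exact hx (by
        simp only [tentGrad_of_notMem fun k hk => hx' (tentPiece_subset k hk), Matrix.zero_apply])
  · intro φ hφ hc p q
    obtain ⟨D, hD⟩ := hφ.lipschitzWith_of_hasCompactSupport hc (by simp)
    -- Integration by parts for Lipschitz functions; its line derivative is almost everywhere the
    -- explicit gradient.
    have h1 := (lipschitzWith_tent (c := c) hN0 hN).integral_lineDeriv_mul_eq (μ := volume) hD hc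
      (EuclideanSpace.single q 1)
    have h2 : ∫ x, tentGrad n c v x p q * φ x =
        v p * ∫ x, lineDeriv ℝ (tent n c) x (EuclideanSpace.single q 1) * φ x := by
      rw [← integral_const_mul]
      refine integral_congr_ae ?_
      filter_upwards [ae_lineDeriv_tent (c := c) hn v p q] with x hx
      rw [← hx]
      ring
    rw [h2, h1, ← integral_const_mul, ← integral_neg]
    congr 1
    ext x
    have : lineDeriv ℝ φ x (-EuclideanSpace.single q 1) =
        -fderiv ℝ φ x (EuclideanSpace.single q 1) := by
      rw [((hφ.differentiable (by simp)).differentiableAt).lineDeriv_eq_fderiv, map_neg]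
    rw [this]
    simp only [PiLp.smul_apply, smul_eq_mul]
    ring
  · refine (countable_range fun k => tentPiece n c k).mono ?_
    rintro U ⟨_, k, rfl⟩
    exact ⟨k, rfl⟩
  · rintro U ⟨_, k, rfl⟩ V ⟨_, l, rfl⟩ hUV
    exact disjoint_left.2 fun x hx hx' => hUV (by rw [tentPiece_unique hx hx'])
  · rintro U ⟨hne, k, rfl⟩
    exact hreg k hne
  · rintro U ⟨_, k, rfl⟩
    exact tentPiece_subset k
  · rintro U ⟨_, k, rfl⟩
    refine ⟨Matrix.of fun p q => v p * n k (EuclideanSpace.single q 1), c k • v, fun x hx => ?_⟩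
    rw [tentGrad_of_mem hx, tent_of_mem hx, fderiv_single_eq]
    exact ⟨rfl, rfl⟩
  · refine measure_mono_null ?_ (volume_tentCell_diff (c := c) hn)
    rintro x ⟨hx, hx'⟩
    refine ⟨hx, fun h => ?_⟩
    obtain ⟨k, hk⟩ := mem_iUnion.1 h
    exact hx' ⟨_, ⟨⟨x, hk⟩, k, rfl⟩, hk⟩

end Tent

/-! ### The elementary lamination on one rectangle -/

/-- The sum of the absolute values of the entries. -/
def absSum (X : Mat) : ℝ := ∑ i, ∑ j, |X i j|

lemma absSum_nonneg (X : Mat) : 0 ≤ absSum X :=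
  Finset.sum_nonneg fun _ _ => Finset.sum_nonneg fun _ _ => abs_nonneg _

lemma absSum_add_le (X Y : Mat) : absSum (X + Y) ≤ absSum X + absSum Y := by
  simp only [absSum, ← Finset.sum_add_distrib]
  exact Finset.sum_le_sum fun i _ => Finset.sum_le_sum fun j _ => abs_add_le _ _

lemma matNorm_le_absSum (X : Mat) : matNorm X ≤ absSum X := by
  refine Real.sqrt_le_iff.2 ⟨absSum_nonneg X, ?_⟩
  simp only [absSum, Fin.sum_univ_two]
  rw [← sq_abs (X 0 0), ← sq_abs (X 0 1), ← sq_abs (X 1 0), ← sq_abs (X 1 1)]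
  have h1 := abs_nonneg (X 0 0)
  have h2 := abs_nonneg (X 0 1)
  have h3 := abs_nonneg (X 1 0)
  have h4 := abs_nonneg (X 1 1)
  nlinarith [mul_nonneg h1 h2, mul_nonneg h1 h3, mul_nonneg h1 h4, mul_nonneg h2 h3,
    mul_nonneg h2 h4, mul_nonneg h3 h4]

lemma matNorm_nonneg (X : Mat) : 0 ≤ matNorm X := Real.sqrt_nonneg _

lemma abs_entry_le_matNorm (X : Mat) (i j : Fin 2) : |X i j| ≤ matNorm X := by
  refine Real.abs_le_sqrt ?_
  exact (Finset.single_le_sum (f := fun j => X i j ^ 2) (fun _ _ => sq_nonneg _)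
    (Finset.mem_univ j)).trans (Finset.single_le_sum (f := fun i => ∑ j, X i j ^ 2)
      (fun _ _ => Finset.sum_nonneg fun _ _ => sq_nonneg _) (Finset.mem_univ i))

lemma entrySum_eq (X : Mat) : entrySum X = ENNReal.ofReal (absSum X) := by
  simp only [entrySum, absSum]
  rw [ENNReal.ofReal_sum_of_nonneg (f := fun i => ∑ j, |X i j|)
    fun _ _ => Finset.sum_nonneg fun _ _ => abs_nonneg _]
  refine Finset.sum_congr rfl fun i _ => ?_
  rw [ENNReal.ofReal_sum_of_nonneg (f := fun j => |X i j|) fun _ _ => abs_nonneg _]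
  exact Finset.sum_congr rfl fun j _ => Real.enorm_eq_ofReal_abs _

lemma volume_rectangle {j j' : Fin 2} (hj : j ≠ j') (a b a' b' : ℝ) :
    volume {x : Plane | x j ∈ Ioo a b ∧ x j' ∈ Ioo a' b'} =
      ENNReal.ofReal (b - a) * ENNReal.ofReal (b' - a') := by
  have h : {x : Plane | x j ∈ Ioo a b ∧ x j' ∈ Ioo a' b'} = WithLp.ofLp ⁻¹'
      (pi univ fun k => Ioo (if k = j then a else a') (if k = j then b else b')) := by
    ext x
    simp only [mem_ofPred_eq, mem_preimage, mem_univ_pi]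
    constructor
    · rintro ⟨h1, h2⟩ k
      by_cases hk : k = j
      · simpa [hk] using h1
      · have : k = j' := by omega
        subst this
        simpa [hk] using h2
    · intro h
      exact ⟨by simpa using h j, by simpa [Ne.symm hj] using h j'⟩
  rw [h, (PiLp.volume_preserving_ofLp (Fin 2)).measure_preimage
    (MeasurableSet.univ_pi fun _ => measurableSet_Ioo).nullMeasurableSet, Real.volume_pi_Ioo,
    Fin.prod_univ_two]
  fin_cases j <;> fin_cases j' <;> simp_all [mul_comm]

/-- The gradients of the four affine functions whose minimum is the tent over a rectangle with
slopes `1 - lam` and `-lam` in direction `j`. -/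
def cellSlope (lam : ℝ) (j j' : Fin 2) : Fin 4 → Plane →L[ℝ] ℝ :=
  ![(1 - lam) • EuclideanSpace.proj j, (-lam) • EuclideanSpace.proj j,
    -EuclideanSpace.proj j', EuclideanSpace.proj j']

/-- The constant terms of the four affine functions, for the rectangle at `p` of size `r` and
aspect ratio `ρ`. -/
def cellConst (lam ρ r : ℝ) (j j' : Fin 2) (p : Plane) : Fin 4 → ℝ :=
  ![ρ * r - (1 - lam) * p j, ρ * r + lam * p j, r + p j', r - p j']

section Cell

variable {lam ρ r : ℝ} {j j' : Fin 2} {p : Plane}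

lemma mem_cell_iff (h0 : 0 < lam) (h1 : lam < 1) (x : Plane) :
    x ∈ tentCell (cellSlope lam j j') (cellConst lam ρ r j j' p) ↔
      x j ∈ Ioo (p j - ρ * r / (1 - lam)) (p j + ρ * r / lam) ∧
        x j' ∈ Ioo (p j' - r) (p j' + r) := by
  have h1' : 0 < 1 - lam := by linarith
  have hu : (1 - lam) * (ρ * r / (1 - lam)) = ρ * r := by field_simp
  have hv : lam * (ρ * r / lam) = ρ * r := by field_simp
  set u := ρ * r / (1 - lam)
  set v := ρ * r / lam
  simp only [tentCell, mem_ofPred_eq, Fin.forall_fin_succ, cellSlope, cellConst, mem_Ioo]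
  simp
  constructor
  · rintro ⟨a, b, c, d⟩
    exact ⟨⟨by nlinarith, by nlinarith⟩, by linarith, by linarith⟩
  · rintro ⟨⟨a, b⟩, c, d⟩
    exact ⟨by nlinarith, by nlinarith, by linarith, by linarith⟩

lemma cell_eq (h0 : 0 < lam) (h1 : lam < 1) :
    tentCell (cellSlope lam j j') (cellConst lam ρ r j j' p) =
      {x | x j ∈ Ioo (p j - ρ * r / (1 - lam)) (p j + ρ * r / lam) ∧
        x j' ∈ Ioo (p j' - r) (p j' + r)} := by
  ext x
  exact mem_cell_iff h0 h1 x

lemma volume_cell (hj : j ≠ j') (h0 : 0 < lam) (h1 : lam < 1) :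
    volume (tentCell (cellSlope lam j j') (cellConst lam ρ r j j' p)) =
      ENNReal.ofReal (ρ * r / lam + ρ * r / (1 - lam)) * ENNReal.ofReal (2 * r) := by
  rw [cell_eq h0 h1, volume_rectangle hj]
  congr 2 <;> ring

lemma cellSlope_injective (hj : j ≠ j') : Function.Injective (cellSlope lam j j') := by
  intro k l h
  have e1 := congrArg (fun m : Plane →L[ℝ] ℝ => m (EuclideanSpace.single j 1)) h
  have e2 := congrArg (fun m : Plane →L[ℝ] ℝ => m (EuclideanSpace.single j' 1)) h
  have hj' := hj.symm
  fin_cases k <;> fin_cases l <;>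
    simp [cellSlope, hj, hj'] at e1 e2 ⊢ <;> linarith

lemma norm_cellSlope_le (h0 : 0 < lam) (h1 : lam < 1) (k : Fin 4) :
    ‖cellSlope lam j j' k‖ ≤ 1 := by
  have hp : ∀ i : Fin 2, ‖(EuclideanSpace.proj i : Plane →L[ℝ] ℝ)‖ ≤ 1 := fun i =>
    ContinuousLinearMap.opNorm_le_bound _ zero_le_one fun x => by
      simpa using PiLp.norm_apply_le x i
  have hs : ∀ (t : ℝ) (i : Fin 2), |t| ≤ 1 →
      ‖t • (EuclideanSpace.proj i : Plane →L[ℝ] ℝ)‖ ≤ 1 := fun t i ht => by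
    rw [norm_smul, Real.norm_eq_abs]
    exact mul_le_one₀ ht (norm_nonneg _) (hp i)
  fin_cases k
  · exact hs _ _ (abs_le.2 ⟨by linarith, by linarith⟩)
  · exact hs _ _ (abs_le.2 ⟨by linarith, by linarith⟩)
  · simpa [cellSlope] using hp j'
  · exact hp j'

/-- Each of the four slopes is a multiple, of modulus at most 1, of a coordinate functional, so the
gradient has at most one nonzero entry. -/
lemma absSum_tentGrad_cell_le (hj : j ≠ j') (h0 : 0 < lam) (h1 : lam < 1) (c : Fin 4 → ℝ)
    (i : Fin 2) (d : ℝ) (x : Plane) :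
    absSum (tentGrad (cellSlope lam j j') c (EuclideanSpace.single i d) x) ≤ |d| := by
  have hd := abs_nonneg d
  have a0 : |1 - lam| = 1 - lam := abs_of_pos (by linarith)
  have a1 : |lam| = lam := abs_of_pos h0
  by_cases hx : ∃ k, x ∈ tentPiece (cellSlope lam j j') c k
  · obtain ⟨k, hk⟩ := hx
    rw [tentGrad_of_mem hk]
    fin_cases i <;> fin_cases j <;> fin_cases j' <;> first | exact absurd rfl hj | skip
    all_goals
      fin_cases k <;> simp [absSum, cellSlope, Fin.sum_univ_two, abs_mul, a0, a1] <;> nlinarith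
  · rw [tentGrad_of_notMem (by simpa using hx)]
    simp [absSum]

lemma tentGrad_cell_zero {c : Fin 4 → ℝ} {i : Fin 2} {d : ℝ} {x : Plane}
    (hx : x ∈ tentPiece (cellSlope lam j j') c 0) :
    tentGrad (cellSlope lam j j') c (EuclideanSpace.single i d) x =
      Matrix.single i j ((1 - lam) * d) := by
  rw [tentGrad_of_mem hx]
  ext a b
  fin_cases i <;> fin_cases j <;> fin_cases a <;> fin_cases b <;>
    simp [cellSlope, Matrix.single, mul_comm]

lemma tentGrad_cell_one {c : Fin 4 → ℝ} {i : Fin 2} {d : ℝ} {x : Plane}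
    (hx : x ∈ tentPiece (cellSlope lam j j') c 1) :
    tentGrad (cellSlope lam j j') c (EuclideanSpace.single i d) x =
      Matrix.single i j (-lam * d) := by
  rw [tentGrad_of_mem hx]
  ext a b
  fin_cases i <;> fin_cases j <;> fin_cases a <;> fin_cases b <;>
    simp [cellSlope, Matrix.single, mul_comm]

lemma isBounded_rectangle (hj : j ≠ j') (a b a' b' : ℝ) :
    Bornology.IsBounded {x : Plane | x j ∈ Ioo a b ∧ x j' ∈ Ioo a' b'} := by
  refine (Metric.isBounded_closedBall (x := (0 : Plane))
    (r := (|a| + |b|) + (|a'| + |b'|))).subset ?_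
  rintro x ⟨h1, h2⟩
  have key : ∀ {a b t : ℝ}, t ∈ Ioo a b → |t| ≤ |a| + |b| := fun {a b t} h =>
    abs_le.2 ⟨by linarith [h.1, neg_abs_le a, abs_nonneg b],
      by linarith [h.2, le_abs_self b, abs_nonneg a]⟩
  have k1 := key h1
  have k2 := key h2
  rw [mem_closedBall_zero_iff, EuclideanSpace.norm_eq]
  refine Real.sqrt_le_iff.2 ⟨by positivity, ?_⟩
  have hsum : ∑ i, ‖x i‖ ^ 2 = |x j| ^ 2 + |x j'| ^ 2 := by
    rw [Fin.sum_univ_two]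
    fin_cases j <;> fin_cases j' <;> simp_all [add_comm]
  rw [hsum]
  have p1 := abs_nonneg (x j)
  have p2 := abs_nonneg (x j')
  nlinarith [mul_nonneg p1 p2]

end Cell

lemma ofReal_mul_mul_le {a b t u v : ℝ} (ht : 0 ≤ t) (h : a ≤ t * u)
    (hb : b ≤ v) :
    ENNReal.ofReal a * ENNReal.ofReal b ≤
      ENNReal.ofReal t * (ENNReal.ofReal u * ENNReal.ofReal v) := by
  rw [← mul_assoc, ← ENNReal.ofReal_mul ht]
  exact mul_le_mul' (ENNReal.ofReal_le_ofReal h) (ENNReal.ofReal_le_ofReal hb)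

/-- The elementary lamination on a small rectangle. -/
theorem reducesOn_cell {α s lam ρ r η d : ℝ} {i j j' : Fin 2} (hα0 : 0 < α) (hα1 : α < 1)
    (hs : 0 ≤ s) (hj : j ≠ j') (h0 : 0 < lam) (h1 : lam < 1) (hρ : 0 < ρ)
    (hr : 0 < r) (hd : d ≠ 0) (M : Mat) (p : Plane)
    (hH : (ρ * r) ^ (1 - α) * |d| ≤ η) (hη : (1 + (absSum M + |d|)) ^ s * ρ ≤ η) :
    ReducesOn α s (tentCell (cellSlope lam j j') (cellConst lam ρ r j j' p)) M
      {M + Matrix.single i j ((1 - lam) * d), M + Matrix.single i j (-lam * d)}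
      (fun t : Bool => {M + Matrix.single i j (if t then (1 - lam) * d else -lam * d)})
      (fun t : Bool => ENNReal.ofReal (if t then lam else 1 - lam)) ‖d‖ₑ η := by
  set n := cellSlope lam j j' with hn
  set c := cellConst lam ρ r j j' p with hc
  have h1' : 0 < 1 - lam := by linarith
  have hb : Bornology.IsBounded (tentCell n c) := by
    rw [hn, hc, cell_eq h0 h1]
    exact isBounded_rectangle hj _ _ _ _
  -- This convex combination of the first two functions is constant, so their minimum never exceeds
  -- ρ r: the height of the tent is independent of the caps.
  have hle : ∀ x, (1 - lam) * (n 1 x + c 1) + lam * (n 0 x + c 0) = ρ * r := by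
    intro x
    simp [hn, hc, cellSlope, cellConst]
    ring
  have hpert := isPerturbation_tent (n := n) (c := c) (N := 1) (m := ρ * r) (H := η) hα0 hα1
    (cellSlope_injective hj) zero_le_one (norm_cellSlope_le h0 h1) (by positivity)
    (fun x => by
      by_contra! h
      have e0 := h 0
      have e1 := h 1
      have := hle x
      nlinarith)
    hb (EuclideanSpace.single i d) (by simpa using hH)
  have hvol := volume_cell (ρ := ρ) (r := r) (p := p) hj h0 h1
  have hcell : ∀ x ∈ tentCell n c, x j ∈ Ioo (p j - ρ * r / (1 - lam)) (p j + ρ * r / lam) ∧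
      x j' ∈ Ioo (p j' - r) (p j' + r) := fun x => (mem_cell_iff h0 h1 x).1
  -- The ridge between the first two slopes lies over x j = p j and divides the rectangle in the
  -- ratio lam : 1 - lam.
  have hv0 : volume (tentPiece n c 0) ≤ ENNReal.ofReal lam * volume (tentCell n c) := by
    refine (measure_mono (t := {x : Plane | x j ∈ Ioo (p j - ρ * r / (1 - lam)) (p j) ∧
        x j' ∈ Ioo (p j' - r) (p j' + r)}) fun x hx => ?_).trans ?_
    · obtain ⟨⟨a, _⟩, b⟩ := hcell x (tentPiece_subset 0 hx)
      refine ⟨⟨a, ?_⟩, b⟩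
      have := hx.2 1 (by decide)
      simp [hn, hc, cellSlope, cellConst] at this
      linarith
    · rw [volume_rectangle hj, hvol]
      refine ofReal_mul_mul_le h0.le (le_of_eq ?_) (by linarith)
      field_simp
      ring
  have hv1 : volume (tentPiece n c 1) ≤ ENNReal.ofReal (1 - lam) * volume (tentCell n c) := by
    refine (measure_mono (t := {x : Plane | x j ∈ Ioo (p j) (p j + ρ * r / lam) ∧
        x j' ∈ Ioo (p j' - r) (p j' + r)}) fun x hx => ?_).trans ?_
    · obtain ⟨⟨_, a⟩, b⟩ := hcell x (tentPiece_subset 1 hx)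
      refine ⟨⟨?_, a⟩, b⟩
      have := hx.2 0 (by decide)
      simp [hn, hc, cellSlope, cellConst] at this
      linarith
    · rw [volume_rectangle hj, hvol]
      refine ofReal_mul_mul_le h1'.le (le_of_eq ?_) (by linarith)
      field_simp
      ring
  -- On a cap the minimum is strictly below both main slopes, hence below ρ r. Each cap therefore
  -- lies within ρ r of a short side and takes up at most the fraction ρ / 2.
  have hsmall : ∀ k : Fin 4, k ≠ 0 → k ≠ 1 → ∀ x ∈ tentPiece n c k, n k x + c k < ρ * r := by
    intro k hk0 hk1 x hx
    have e0 := hx.2 0 hk0.symm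
    have e1 := hx.2 1 hk1.symm
    have := hle x
    nlinarith
  have hv2 : volume (tentPiece n c 2) ≤ ENNReal.ofReal (ρ / 2) * volume (tentCell n c) := by
    refine (measure_mono (t := {x : Plane | x j ∈ Ioo (p j - ρ * r / (1 - lam))
        (p j + ρ * r / lam) ∧ x j' ∈ Ioo (p j' + r - ρ * r) (p j' + r)}) fun x hx => ?_).trans ?_
    · obtain ⟨a, _, b⟩ := hcell x (tentPiece_subset 2 hx)
      refine ⟨a, ?_, b⟩
      have := hsmall 2 (by decide) (by decide) x hx
      simp [hn, hc, cellSlope, cellConst] at this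
      linarith
    · rw [volume_rectangle hj, hvol, mul_comm, mul_comm (ENNReal.ofReal (ρ * r / lam + _))]
      refine ofReal_mul_mul_le (by positivity) (le_of_eq ?_) (by linarith)
      ring
  have hv3 : volume (tentPiece n c 3) ≤ ENNReal.ofReal (ρ / 2) * volume (tentCell n c) := by
    refine (measure_mono (t := {x : Plane | x j ∈ Ioo (p j - ρ * r / (1 - lam))
        (p j + ρ * r / lam) ∧ x j' ∈ Ioo (p j' - r) (p j' - r + ρ * r)}) fun x hx => ?_).trans ?_
    · obtain ⟨a, b, _⟩ := hcell x (tentPiece_subset 3 hx)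
      refine ⟨a, b, ?_⟩
      have := hsmall 3 (by decide) (by decide) x hx
      simp [hn, hc, cellSlope, cellConst] at this
      linarith
    · rw [volume_rectangle hj, hvol, mul_comm, mul_comm (ENNReal.ofReal (ρ * r / lam + _))]
      refine ofReal_mul_mul_le (by positivity) (le_of_eq ?_) (by linarith)
      ring
  have hmemE : ∀ x ∈ tentCell n c \ (tentCell n c \ (tentPiece n c 0 ∪ tentPiece n c 1)),
      x ∈ tentPiece n c 0 ∨ x ∈ tentPiece n c 1 := by
    rintro x ⟨hx, hxE⟩
    by_contra h
    exact hxE ⟨hx, h⟩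
  have hne : Matrix.single i j ((1 - lam) * d) ≠ Matrix.single i j (-lam * d) := by
    intro h
    have := congrFun (congrFun h i) j
    simp only [Matrix.single_apply_same] at this
    exact hd (by linarith)
  -- The exceptional set consists of the two caps and the ties; its relative volume is at most ρ.
  refine ⟨_, _, _, tentCell n c \ (tentPiece n c 0 ∪ tentPiece n c 1), hpert, sdiff_subset,
    ?_, ?_, ?_, ?_, ?_, ?_⟩
  · rintro U ⟨_, k, rfl⟩
    by_cases hk : k = 0 ∨ k = 1
    · refine Or.inr (disjoint_left.2 fun x hx hxE => hxE.2 ?_)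
      rcases hk with rfl | rfl
      · exact Or.inl hx
      · exact Or.inr hx
    · refine Or.inl fun x hx => ⟨tentPiece_subset k hx, ?_⟩
      rintro (h | h)
      · exact hk (Or.inl (tentPiece_unique hx h))
      · exact hk (Or.inr (tentPiece_unique hx h))
  · intro x hx
    rcases hmemE x hx with h | h
    · exact ⟨_, ⟨⟨x, h⟩, 0, rfl⟩, h⟩
    · exact ⟨_, ⟨⟨x, h⟩, 1, rfl⟩, h⟩
  · intro x hx
    rcases hmemE x hx with h | h
    · exact Or.inl (by rw [tentGrad_cell_zero h])
    · exact Or.inr (by rw [tentGrad_cell_one h]; rfl)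
  · have hE : volume (tentCell n c \ (tentPiece n c 0 ∪ tentPiece n c 1)) ≤
        ENNReal.ofReal ρ * volume (tentCell n c) := by
      refine (measure_mono (t := (tentPiece n c 2 ∪ tentPiece n c 3) ∪
        (tentCell n c \ ⋃ k, tentPiece n c k)) ?_).trans ?_
      · rintro x ⟨hx, hx'⟩
        by_cases h : x ∈ ⋃ k, tentPiece n c k
        · obtain ⟨k, hk⟩ := mem_iUnion.1 h
          left
          fin_cases k
          · exact (hx' (Or.inl hk)).elim
          · exact (hx' (Or.inr hk)).elim
          · exact Or.inl hk
          · exact Or.inr hk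
        · exact Or.inr ⟨hx, h⟩
      · refine (measure_union_le _ _).trans ?_
        rw [volume_tentCell_diff (cellSlope_injective hj), add_zero]
        refine (measure_union_le _ _).trans ((add_le_add hv2 hv3).trans (le_of_eq ?_))
        rw [← add_mul, ← ENNReal.ofReal_add (by positivity) (by positivity)]
        congr 2
        ring
    calc ∫⁻ x in tentCell n c \ (tentPiece n c 0 ∪ tentPiece n c 1),
          ENNReal.ofReal ((1 + matNorm (M + tentGrad n c (EuclideanSpace.single i d) x)) ^ s)
        ≤ ∫⁻ x in tentCell n c \ (tentPiece n c 0 ∪ tentPiece n c 1),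
          ENNReal.ofReal ((1 + (absSum M + |d|)) ^ s) := by
          refine lintegral_mono fun x => ENNReal.ofReal_le_ofReal ?_
          refine Real.rpow_le_rpow (add_nonneg zero_le_one (matNorm_nonneg _)) ?_ hs
          have := absSum_tentGrad_cell_le hj h0 h1 c i d x
          have h2 := absSum_add_le M (tentGrad n c (EuclideanSpace.single i d) x)
          have h3 := matNorm_le_absSum (M + tentGrad n c (EuclideanSpace.single i d) x)
          linarith
      _ ≤ ENNReal.ofReal ((1 + (absSum M + |d|)) ^ s) *
            (ENNReal.ofReal ρ * volume (tentCell n c)) := by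
          rw [setLIntegral_const]
          gcongr
      _ ≤ ENNReal.ofReal η * volume (tentCell n c) := by
          have hM := absSum_nonneg M
          rw [← mul_assoc, ← ENNReal.ofReal_mul (by positivity)]
          gcongr
  · rintro (_ | _)
    · refine (measure_mono fun x hx => ?_).trans hv1
      rcases hmemE x hx.1 with h | h
      · have := hx.2
        rw [tentGrad_cell_zero h] at this
        exact (hne (add_left_cancel this)).elim
      · exact h
    · refine (measure_mono fun x hx => ?_).trans hv0
      rcases hmemE x hx.1 with h | h
      · exact h
      · have := hx.2
        rw [tentGrad_cell_one h] at this
        exact (hne (add_left_cancel this).symm).elim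
  · rw [← setLIntegral_const]
    refine lintegral_mono fun x => ?_
    rw [entrySum_eq, Real.enorm_eq_ofReal_abs]
    exact ENNReal.ofReal_le_ofReal (absSum_tentGrad_cell_le hj h0 h1 c i d x)

/-! ### Reducing again outside the exceptional set -/

lemma entrySum_add_le (X Y : Mat) : entrySum (X + Y) ≤ entrySum X + entrySum Y := by
  simp only [entrySum, ← Finset.sum_add_distrib]
  exact Finset.sum_le_sum fun i _ => Finset.sum_le_sum fun j _ => enorm_add_le _ _

lemma entrySum_zero : entrySum 0 = 0 := by simp [entrySum]

lemma IsPerturbation.aemeasurable_entrySum {α H : ℝ} {Ω : Set Plane} {f : Plane → Plane}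
    {Df : Plane → Mat} {𝒰 : Set (Set Plane)} (hf : IsPerturbation α Ω f Df H 𝒰) :
    AEMeasurable fun x => entrySum (Df x) := by
  simp only [entrySum]
  exact Finset.aemeasurable_fun_sum _ fun i _ => Finset.aemeasurable_fun_sum _ fun j _ =>
    (hf.integrable i j).aestronglyMeasurable.enorm

lemma IsPerturbation.measurableSet_of_subordinate {α H : ℝ} {Ω A : Set Plane} {f : Plane → Plane}
    {Df : Plane → Mat} {𝒰 : Set (Set Plane)} (hf : IsPerturbation α Ω f Df H 𝒰) (hA : A ⊆ ⋃₀ 𝒰)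
    (hsub : Subordinate 𝒰 A) : MeasurableSet A := by
  rw [exists_eq_sUnion_of_subordinate hA hsub]
  have : Countable {U : Set Plane // U ∈ 𝒰 ∧ U ⊆ A} :=
    (hf.countable.mono (fun U hU => hU.1 : {U : Set Plane | U ∈ 𝒰 ∧ U ⊆ A} ⊆ 𝒰)).to_subtype
  exact MeasurableSet.iUnion fun U => (hf.regular _ U.2.1).measurableSet

/-- Exceptional sets are not assumed measurable, so agreement of the integrands is tested on a
measurable set containing them. -/
lemma lintegral_congr_of_subset {E T : Set Plane} (hT : MeasurableSet T) (hE : E ⊆ T)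
    {f g : Plane → ℝ≥0∞} (h : ∀ x ∈ T, f x = g x) : ∫⁻ x in E, f x = ∫⁻ x in E, g x := by
  rw [← Measure.restrict_restrict_of_subset hE]
  refine lintegral_congr_ae (ae_restrict_of_ae ?_)
  filter_upwards [ae_restrict_mem hT] with x hx using h x hx

/-- Reduce further on the pieces of a perturbation outside of its exceptional set. -/
theorem IsPerturbation.reducesOn {ι : Type} {α s H η η₁ H' : ℝ} (hα : 0 < α) (hη : 0 ≤ η)
    (hη₁ : 0 ≤ η₁) {Ω E₁ : Set Plane} (hΩ : IsRegularDomain Ω) {f : Plane → Plane}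
    {Df : Plane → Mat} {𝒰 : Set (Set Plane)} (hf : IsPerturbation α Ω f Df H 𝒰)
    (hE₁ : E₁ ⊆ Ω) (hsub : Subordinate 𝒰 E₁) (hcov : Ω \ E₁ ⊆ ⋃₀ 𝒰) {M : Mat} {c₁ c : ℝ≥0∞}
    (hErr : ∫⁻ x in E₁, ENNReal.ofReal ((1 + matNorm (M + Df x)) ^ s) ≤
      ENNReal.ofReal η₁ * volume Ω)
    (hL : ∫⁻ x in Ω, entrySum (Df x) ≤ c₁ * volume Ω) (hc : c ≠ ⊤)
    {K : Mat → Set Mat} {K' : Set Mat} {S : ι → Set Mat} {F : Mat → ι → ℝ≥0∞} {F' : ι → ℝ≥0∞}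
    (hred : ∀ U ∈ 𝒰, U ⊆ Ω \ E₁ → ∀ x ∈ U,
      ReducesOn α s U (M + Df x) (K (M + Df x)) S (F (M + Df x)) c η)
    (hK : ∀ x ∈ Ω \ E₁, K (M + Df x) ⊆ K')
    (hF : ∀ i, ∫⁻ x in Ω \ E₁, F (M + Df x) i ≤ F' i * volume Ω)
    (hH : H + 2 * η ≤ H') (hη' : η₁ + η ≤ H') :
    ReducesOn α s Ω M K' S F' (c₁ + c) H' := by
  -- Only the good part is perturbed again. The error on `E₁` is unchanged, and the new one is added
  -- to it.
  set A := Ω \ E₁ with hA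
  have hsubA : Subordinate 𝒰 A := by
    intro U hU
    rcases hsub U hU with h | h
    · exact Or.inr (disjoint_left.2 fun x hx hxA => hxA.2 (h hx))
    · exact Or.inl fun x hx => ⟨hf.subset U hU hx, fun hE => h.le_bot ⟨hx, hE⟩⟩
  obtain ⟨f', Df', 𝒰', E, hf', -, hoff, hEA, hK', hErr', hS, hL', href, hkeep, hsubE, hcov'⟩ :=
    hf.patch hα hη hΩ hcov hsubA hc hred
  have hAΩ : A ⊆ Ω := sdiff_subset
  have hdiff : Ω \ (E₁ ∪ E) = A \ E := by
    rw [hA, sdiff_sdiff]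
  refine ⟨f', Df', 𝒰', E₁ ∪ E, ?_, union_subset hE₁ (hEA.trans hAΩ), ?_, ?_, ?_, ?_, ?_, ?_⟩
  · exact { hf' with
      holder := fun x y => (hf'.holder x y).trans
        (mul_le_mul_of_nonneg_right hH (by positivity)) }
  · intro V hV
    rcases (hsub.of_refine href) V hV with h | h
    · exact Or.inl (h.trans subset_union_left)
    · rcases hsubE V hV with h' | h'
      · exact Or.inl (h'.trans subset_union_right)
      · exact Or.inr (disjoint_union_right.2 ⟨h, h'⟩)
  · rw [hdiff]
    exact hcov'
  · intro x hx
    rw [hdiff] at hx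
    exact hK x hx.1 (hK' x hx)
  · refine (lintegral_union_le _ _ _).trans ?_
    have e1 : ∫⁻ x in E₁, ENNReal.ofReal ((1 + matNorm (M + Df' x)) ^ s) ≤
        ENNReal.ofReal η₁ * volume Ω := by
      refine le_trans (le_of_eq ?_) hErr
      refine lintegral_congr_of_subset (hf.measurableSet_of_subordinate hcov hsubA).compl
        (fun x hx hxA => hxA.2 hx) fun x hx => ?_
      rw [(hoff x hx).2]
    calc _ ≤ ENNReal.ofReal η₁ * volume Ω + ENNReal.ofReal η * volume Ω := by
          refine add_le_add e1 (hErr'.trans ?_)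
          gcongr
      _ ≤ ENNReal.ofReal H' * volume Ω := by
          rw [← add_mul, ← ENNReal.ofReal_add hη₁ hη]
          gcongr
  · intro i
    rw [hdiff]
    exact (hS i).trans (hF i)
  · calc ∫⁻ x in Ω, entrySum (Df' x)
        ≤ ∫⁻ x in Ω, entrySum (Df x) + A.indicator (fun x => entrySum (Df' x - Df x)) x := by
          refine lintegral_mono fun x => ?_
          by_cases hx : x ∈ A
          · rw [indicator_of_mem hx]
            simpa using entrySum_add_le (Df x) (Df' x - Df x)
          · rw [(hoff x hx).2]
            exact le_self_add
      _ = (∫⁻ x in Ω, entrySum (Df x)) +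
            ∫⁻ x in Ω, A.indicator (fun x => entrySum (Df' x - Df x)) x :=
          lintegral_add_left' hf.aemeasurable_entrySum.restrict _
      _ ≤ c₁ * volume Ω + c * volume Ω := by
          refine add_le_add hL ?_
          refine (lintegral_indicator_le _ _).trans ?_
          rw [Measure.restrict_restrict_of_subset hAΩ]
          refine hL'.trans ?_
          gcongr
      _ = (c₁ + c) * volume Ω := by rw [add_mul]

/-! ### Vitali covering by rectangles of a fixed shape -/

section Cover

variable {lam ρ : ℝ} {j j' : Fin 2}

/-- The closed rectangle with the same vertices as a cell. -/
def closedCell (lam ρ : ℝ) (j j' : Fin 2) (a : Plane × ℝ) : Set Plane :=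
  {x | x j ∈ Icc (a.1 j - ρ * a.2 / (1 - lam)) (a.1 j + ρ * a.2 / lam) ∧
    x j' ∈ Icc (a.1 j' - a.2) (a.1 j' + a.2)}

lemma isClosed_closedCell (a : Plane × ℝ) : IsClosed (closedCell lam ρ j j' a) := by
  have h : ∀ i : Fin 2, Continuous fun x : Plane => x i := fun i =>
    (EuclideanSpace.proj (𝕜 := ℝ) i).continuous
  exact (isClosed_Icc.preimage (h j)).inter (isClosed_Icc.preimage (h j'))

lemma volume_coord_eq (i : Fin 2) (t : ℝ) : volume {x : Plane | x i = t} = 0 := by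
  refine volume_hyperplane (n := EuclideanSpace.proj i) (fun h => ?_) t
  have := congrArg (fun m : Plane →L[ℝ] ℝ => m (EuclideanSpace.single i 1)) h
  simp at this

lemma norm_le_add_of_ne (hj : j ≠ j') (x : Plane) : ‖x‖ ≤ |x j| + |x j'| := by
  have hsum : ∑ i, ‖x i‖ ^ 2 = |x j| ^ 2 + |x j'| ^ 2 := by
    rw [Fin.sum_univ_two]
    fin_cases j <;> fin_cases j' <;> simp_all [add_comm]
  rw [EuclideanSpace.norm_eq, hsum]
  refine Real.sqrt_le_iff.2 ⟨by positivity, ?_⟩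
  nlinarith [mul_nonneg (abs_nonneg (x j)) (abs_nonneg (x j'))]

/-- An open set is covered up to a null set by small disjoint rectangles of a given shape. -/
theorem exists_cells (hj : j ≠ j') (h0 : 0 < lam) (h1 : lam < 1) (hρ : 0 < ρ) {Ω : Set Plane}
    (hΩ : IsOpen Ω) {r₀ : ℝ} (hr₀ : 0 < r₀) :
    ∃ u : Set (Plane × ℝ), u.Countable ∧ (∀ a ∈ u, 0 < a.2 ∧ a.2 ≤ r₀ ∧
      tentCell (cellSlope lam j j') (cellConst lam ρ a.2 j j' a.1) ⊆ Ω) ∧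
      (u.PairwiseDisjoint fun a => tentCell (cellSlope lam j j') (cellConst lam ρ a.2 j j' a.1)) ∧
      volume (Ω \ ⋃ a ∈ u, tentCell (cellSlope lam j j') (cellConst lam ρ a.2 j j' a.1)) = 0 := by
  have h1' : 0 < 1 - lam := by linarith
  set R : ℝ := ρ / (1 - lam) + ρ / lam + 1 with hR
  have hp1 : 0 < ρ / (1 - lam) := by positivity
  have hp2 : 0 < ρ / lam := by positivity
  have hR1 : 1 ≤ R := by linarith
  set cell : Plane × ℝ → Set Plane := fun a =>
    tentCell (cellSlope lam j j') (cellConst lam ρ a.2 j j' a.1) with hcell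
  have hcc : ∀ a, cell a ⊆ closedCell lam ρ j j' a := by
    intro a x hx
    obtain ⟨a1, a2⟩ := (mem_cell_iff h0 h1 x).1 hx
    exact ⟨Ioo_subset_Icc_self a1, Ioo_subset_Icc_self a2⟩
  have hnull : ∀ a, volume (closedCell lam ρ j j' a \ cell a) = 0 := by
    intro a
    refine measure_mono_null (t := ({x : Plane | x j = a.1 j - ρ * a.2 / (1 - lam)} ∪
      {x : Plane | x j = a.1 j + ρ * a.2 / lam}) ∪ ({x : Plane | x j' = a.1 j' - a.2} ∪
      {x : Plane | x j' = a.1 j' + a.2})) ?_ (measure_union_null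
        (measure_union_null (volume_coord_eq _ _) (volume_coord_eq _ _))
        (measure_union_null (volume_coord_eq _ _) (volume_coord_eq _ _)))
    rintro x ⟨⟨⟨b1, b2⟩, b3, b4⟩, hx⟩
    by_contra h
    simp only [mem_union, mem_ofPred_eq, not_or] at h
    refine hx ((mem_cell_iff h0 h1 x).2 ⟨⟨lt_of_le_of_ne b1 (Ne.symm h.1.1),
      lt_of_le_of_ne b2 h.1.2⟩, lt_of_le_of_ne b3 (Ne.symm h.2.1), lt_of_le_of_ne b4 h.2.2⟩)
  set t : Set (Plane × ℝ) := {a | 0 < a.2 ∧ a.2 ≤ r₀ ∧ closedCell lam ρ j j' a ⊆ Ω} with ht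
  have hball : ∀ a ∈ t, closedCell lam ρ j j' a ⊆ Metric.closedBall a.1 (R * a.2) := by
    rintro a ha x ⟨⟨b1, b2⟩, b3, b4⟩
    have ha0 : 0 < a.2 := ha.1
    rw [mem_closedBall_iff_norm]
    refine (norm_le_add_of_ne hj _).trans ?_
    have e1 : ρ * a.2 / (1 - lam) = ρ / (1 - lam) * a.2 := by ring
    have e2 : ρ * a.2 / lam = ρ / lam * a.2 := by ring
    rw [e1] at b1
    rw [e2] at b2
    have q1 : 0 < ρ / (1 - lam) * a.2 := by positivity
    have q2 : 0 < ρ / lam * a.2 := by positivity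
    have c1 : |(x - a.1) j| ≤ (ρ / (1 - lam) + ρ / lam) * a.2 := by
      rw [PiLp.sub_apply]
      exact abs_le.2 ⟨by linarith, by linarith⟩
    have c2 : |(x - a.1) j'| ≤ a.2 := by
      rw [PiLp.sub_apply]
      exact abs_le.2 ⟨by linarith, by linarith⟩
    rw [hR]
    linarith
  -- The ball of radius 3Ra₂ lies in an open square of side 8Ra₂, of area 64R²a₂²; the cell has area
  -- 2(ρ/lam + ρ/(1 - lam))a₂². The quotient does not depend on the scale.
  have hμ : ∀ a ∈ t, volume (Metric.closedBall a.1 (3 * (R * a.2))) ≤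
      ((64 * R ^ 2 / (2 * (ρ / lam + ρ / (1 - lam)))).toNNReal : ℝ≥0∞) *
        volume (closedCell lam ρ j j' a) := by
    intro a ha
    have ha0 : 0 < a.2 := ha.1
    have hsub : Metric.closedBall a.1 (3 * (R * a.2)) ⊆
        {x : Plane | x j ∈ Ioo (a.1 j - 4 * R * a.2) (a.1 j + 4 * R * a.2) ∧
          x j' ∈ Ioo (a.1 j' - 4 * R * a.2) (a.1 j' + 4 * R * a.2)} := by
      intro x hx
      rw [mem_closedBall_iff_norm] at hx
      have hb : ∀ i, |x i - a.1 i| < 4 * R * a.2 := fun i => by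
        have := PiLp.norm_apply_le (x - a.1) i
        rw [PiLp.sub_apply, Real.norm_eq_abs] at this
        nlinarith
      have hb1 := abs_lt.1 (hb j)
      have hb2 := abs_lt.1 (hb j')
      exact ⟨⟨by linarith, by linarith⟩, by linarith, by linarith⟩
    refine (measure_mono hsub).trans ?_
    rw [volume_rectangle hj]
    refine le_trans ?_ (mul_le_mul_right (measure_mono (hcc a)) _)
    rw [hcell, volume_cell hj h0 h1, ← ENNReal.ofReal_mul (by nlinarith),
      ← ENNReal.ofReal_mul (by positivity), ← ENNReal.ofReal_coe_nnreal,
      Real.coe_toNNReal _ (by positivity), ← ENNReal.ofReal_mul (by positivity)]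
    refine ENNReal.ofReal_le_ofReal (le_of_eq ?_)
    field_simp
    ring
  have hint : ∀ a ∈ t, (interior (closedCell lam ρ j j' a)).Nonempty := by
    intro a ha
    have ha0 : 0 < a.2 := ha.1
    refine ⟨a.1, interior_mono (hcc a) ?_⟩
    rw [hcell, isOpen_tentCell.interior_eq]
    have q1 : 0 < ρ * a.2 / (1 - lam) := by positivity
    have q2 : 0 < ρ * a.2 / lam := by positivity
    exact (mem_cell_iff h0 h1 a.1).2
      ⟨⟨by linarith, by linarith⟩, by linarith, by linarith⟩
  have hfine : ∀ x ∈ Ω, ∀ ε > (0 : ℝ), ∃ a ∈ t, R * a.2 ≤ ε ∧ a.1 = x := by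
    intro x hx ε hε
    obtain ⟨δ, hδ, hball'⟩ := Metric.isOpen_iff.1 hΩ x hx
    -- The three bounds keep the scale below `r₀`, the radius below ε, and the closed rectangle
    -- inside Ω.
    set m := min r₀ (min ε (δ / 2)) with hm
    have hm0 : 0 < m := lt_min hr₀ (lt_min hε (by linarith))
    have hRr : R * (m / R) = m := by field_simp
    have hmR : m / R ≤ m := div_le_self hm0.le hR1
    have hpos : 0 < m / R := by positivity
    have hcl : closedCell lam ρ j j' (x, m / R) ⊆ Metric.closedBall x (R * (m / R)) := by
      rintro y ⟨⟨b1, b2⟩, b3, b4⟩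
      rw [mem_closedBall_iff_norm]
      refine (norm_le_add_of_ne hj _).trans ?_
      simp only at b1 b2 b3 b4
      have e1 : ρ * (m / R) / (1 - lam) = ρ / (1 - lam) * (m / R) := by ring
      have e2 : ρ * (m / R) / lam = ρ / lam * (m / R) := by ring
      rw [e1] at b1
      rw [e2] at b2
      have q1 : 0 < ρ / (1 - lam) * (m / R) := by positivity
      have q2 : 0 < ρ / lam * (m / R) := by positivity
      have c1 : |(y - x) j| ≤ (ρ / (1 - lam) + ρ / lam) * (m / R) := by
        rw [PiLp.sub_apply]
        exact abs_le.2 ⟨by linarith, by linarith⟩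
      have c2 : |(y - x) j'| ≤ m / R := by
        rw [PiLp.sub_apply]
        exact abs_le.2 ⟨by linarith, by linarith⟩
      have : R * (m / R) = (ρ / (1 - lam) + ρ / lam) * (m / R) + m / R := by rw [hR]; ring
      linarith
    refine ⟨(x, m / R), ⟨hpos, hmR.trans (min_le_left _ _), hcl.trans ?_⟩, ?_, rfl⟩
    · rw [hRr]
      refine (Metric.closedBall_subset_ball ?_).trans hball'
      have : m ≤ δ / 2 := (min_le_right _ _).trans (min_le_right _ _)
      linarith
    · change R * (m / R) ≤ ε
      rw [hRr]
      exact (min_le_right _ _).trans (min_le_left _ _)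
  obtain ⟨u, hut, huc, hud, hunull⟩ := Vitali.exists_disjoint_covering_ae (volume : Measure Plane)
    Ω t (64 * R ^ 2 / (2 * (ρ / lam + ρ / (1 - lam)))).toNNReal (fun a => R * a.2)
    (fun a => a.1) (closedCell lam ρ j j') hball hμ hint (fun a _ => isClosed_closedCell a) hfine
  refine ⟨u, huc, fun a ha => ⟨(hut ha).1, (hut ha).2.1, (hcc a).trans (hut ha).2.2⟩,
    fun a ha b hb hab => (hud ha hb hab).mono (hcc a) (hcc b), ?_⟩
  refine measure_mono_null (t := (Ω \ ⋃ a ∈ u, closedCell lam ρ j j' a) ∪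
    ⋃ a ∈ u, (closedCell lam ρ j j' a \ cell a)) ?_ (measure_union_null hunull
      ((measure_biUnion_null_iff huc).2 fun a _ => hnull a))
  rintro x ⟨hx, hx'⟩
  by_cases h : x ∈ ⋃ a ∈ u, closedCell lam ρ j j' a
  · obtain ⟨a, ha, hxa⟩ := mem_iUnion₂.1 h
    exact Or.inr (mem_iUnion₂.2 ⟨a, ha, hxa, fun hc => hx' (mem_iUnion₂.2 ⟨a, ha, hc⟩)⟩)
  · exact Or.inl ⟨hx, h⟩

end Cover

/-! ### Splitting a matrix by changing one entry -/

/-- The elementary lamination: changing one entry of `M` splits it into two matrices. -/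
theorem reduces_elementary {α s lam d : ℝ} (hα0 : 0 < α) (hα1 : α < 1) (hs : 0 ≤ s)
    (h0 : 0 < lam) (h1 : lam < 1) (hd : d ≠ 0) (M : Mat) (i j : Fin 2) :
    Reduces α s M
      {M + Matrix.single i j ((1 - lam) * d), M + Matrix.single i j (-lam * d)}
      (fun t : Bool => {M + Matrix.single i j (if t then (1 - lam) * d else -lam * d)})
      (fun t : Bool => ENNReal.ofReal (if t then lam else 1 - lam)) ‖d‖ₑ := by
  intro Ω hΩ η hη
  obtain ⟨j', hj'⟩ := exists_ne j
  have hj : j ≠ j' := hj'.symm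
  have h1' : 0 < 1 - lam := by linarith
  have hM := absSum_nonneg M
  set B := (1 + (absSum M + |d|)) ^ s with hB
  have hB0 : 0 < B := by positivity
  -- The aspect ratio ρ makes the error on the caps η/2. The height m below makes the Hölder
  -- constant η/2. Cells of size at most m / ρ have height at most m.
  set ρ := η / 2 / B with hρ
  have hρ0 : 0 < ρ := by positivity
  have hd0 : 0 < |d| := abs_pos.2 hd
  set m := (η / 2 / |d|) ^ (1 / (1 - α)) with hm
  have hm0 : 0 < m := by positivity
  have hα1' : 0 < 1 - α := by linarith
  have hmα : m ^ (1 - α) * |d| = η / 2 := by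
    rw [hm, ← Real.rpow_mul (by positivity), one_div, inv_mul_cancel₀ hα1'.ne', Real.rpow_one]
    field_simp
  obtain ⟨u, huc, hu, hud, hunull⟩ := exists_cells (ρ := ρ) hj h0 h1 hρ0 hΩ.isOpen
    (r₀ := m / ρ) (by positivity)
  set cell : Plane × ℝ → Set Plane := fun a =>
    tentCell (cellSlope lam j j') (cellConst lam ρ a.2 j j' a.1) with hcell
  have hreg : ∀ a ∈ u, IsRegularDomain (cell a) := by
    intro a ha
    have ha0 := (hu a ha).1
    have q1 : 0 < ρ * a.2 / (1 - lam) := by positivity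
    have q2 : 0 < ρ * a.2 / lam := by positivity
    refine isRegularDomain_of_convex isOpen_tentCell convex_tentCell ⟨a.1, ?_⟩
      (hΩ.isBounded.subset (hu a ha).2.2)
    exact (mem_cell_iff h0 h1 a.1).2 ⟨⟨by linarith, by linarith⟩, by linarith, by linarith⟩
  have hunion : ⋃₀ (cell '' u) = ⋃ a ∈ u, cell a := sUnion_image _ _
  -- The zero map with the cells as pieces serves as a first perturbation; its exceptional set is
  -- the null set missed by the covering, and each cell is then reduced separately.
  have hzero : IsPerturbation α Ω (fun _ => 0) (fun _ => 0) 0 (cell '' u) := by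
    refine ⟨fun _ _ => rfl, fun _ _ => rfl, by simp, by simp, by simp, huc.image _, ?_, ?_, ?_,
      ?_, ?_⟩
    · rintro _ ⟨a, ha, rfl⟩ _ ⟨b, hb, rfl⟩ hab
      exact hud ha hb fun h => hab (by rw [h])
    · rintro _ ⟨a, ha, rfl⟩
      exact hreg a ha
    · rintro _ ⟨a, ha, rfl⟩
      exact (hu a ha).2.2
    · rintro _ ⟨a, ha, rfl⟩
      exact ⟨0, 0, fun x _ => ⟨by simp [affineMap], rfl⟩⟩
    · rw [hunion]
      exact hunull
  have hdd : Ω \ (Ω \ ⋃₀ (cell '' u)) = ⋃₀ (cell '' u) := by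
    refine sdiff_sdiff_cancel_left ?_
    rintro x ⟨U, hU, hx⟩
    exact hzero.subset U hU hx
  have hvol0 : volume (Ω \ ⋃₀ (cell '' u)) = 0 := hzero.null
  rw [← zero_add (‖d‖ₑ)]
  refine hzero.reducesOn (η := η / 2) (η₁ := 0) (c₁ := 0) (c := ‖d‖ₑ)
    (E₁ := Ω \ ⋃₀ (cell '' u)) 
    (K := fun _ => {M + Matrix.single i j ((1 - lam) * d), M + Matrix.single i j (-lam * d)})
    (F := fun _ t => ENNReal.ofReal (if t then lam else 1 - lam)) hα0 (by linarith) le_rfl hΩ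
    sdiff_subset ?_ hdd.le ?_ ?_ (by simp) ?_ (fun _ _ => Subset.rfl) ?_ (by linarith)
    (by linarith)
  · intro U hU
    exact Or.inr (disjoint_left.2 fun x hx hx' => hx'.2 ⟨U, hU, hx⟩)
  · rw [Measure.restrict_eq_zero.2 hvol0]
    simp
  · simp [entrySum_zero]
  · rintro _ ⟨a, ha, rfl⟩ _ x _
    rw [add_zero]
    obtain ⟨ha0, ha1, _⟩ := hu a ha
    refine reducesOn_cell hα0 hα1 hs hj h0 h1 hρ0 ha0 hd M a.1 ?_ ?_
    · have : ρ * a.2 ≤ m := by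
        rw [le_div_iff₀ hρ0] at ha1
        linarith
      calc (ρ * a.2) ^ (1 - α) * |d| ≤ m ^ (1 - α) * |d| := by gcongr
        _ = η / 2 := hmα
    · rw [← hB, hρ]
      exact le_of_eq (by field_simp)
  · intro t
    rw [setLIntegral_const, hdd]
    gcongr
    rintro x ⟨U, hU, hx⟩
    exact hzero.subset U hU hx

lemma isPerturbation_zero {Ω : Set Plane} (hΩ : IsRegularDomain Ω) (α : ℝ) {H : ℝ} (hH : 0 ≤ H) :
    IsPerturbation α Ω (fun _ => 0) (fun _ => 0) H {Ω} := by
  refine ⟨fun _ _ => rfl, fun _ _ => rfl, fun x y => ?_, by simp, by simp, by simp, by simp,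
    by simpa using hΩ, by simp, ?_, by simp⟩
  · simp only [sub_zero, norm_zero]
    positivity
  · exact fun U _ => ⟨0, 0, fun x _ => ⟨by simp [affineMap], rfl⟩⟩

/-- A matrix in `K` needs no perturbation. -/
theorem reduces_of_mem {ι : Type} {α s : ℝ} {X : Mat} {K : Set Mat} (hX : X ∈ K)
    {S : ι → Set Mat} {F : ι → ℝ≥0∞} (hF : ∀ i, X ∈ S i → 1 ≤ F i) : Reduces α s X K S F 0 := by
  intro Ω hΩ η hη
  refine ⟨_, _, _, ∅, isPerturbation_zero hΩ α hη.le, empty_subset _,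
    fun U _ => Or.inr (disjoint_empty U), by simp, fun x _ => by simpa using hX, by simp,
    fun i => ?_, by simp [entrySum_zero]⟩
  by_cases hi : X ∈ S i
  · calc volume {x ∈ Ω \ ∅ | X + 0 ∈ S i} ≤ 1 * volume Ω := by
          rw [one_mul]
          exact measure_mono fun x hx => hx.1.1
      _ ≤ F i * volume Ω := by
          gcongr
          exact hF i hi
  · simp [hi]

theorem ReducesOn.mono {ι : Type} {α s η : ℝ} {Ω : Set Plane} {X : Mat} {K K' : Set Mat}
    {S : ι → Set Mat} {F F' : ι → ℝ≥0∞} {c c' : ℝ≥0∞} (h : ReducesOn α s Ω X K S F c η)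
    (hK : K ⊆ K') (hF : ∀ i, F i ≤ F' i) (hc : c ≤ c') : ReducesOn α s Ω X K' S F' c' η := by
  obtain ⟨f, Df, 𝒰, E, hf, hE, hsub, hcov, hval, hErr, hS, hL⟩ := h
  refine ⟨f, Df, 𝒰, E, hf, hE, hsub, hcov, fun x hx => hK (hval x hx), hErr,
    fun i => (hS i).trans ?_, hL.trans ?_⟩
  · gcongr
    exact hF i
  · gcongr

theorem Reduces.mono {ι : Type} {α s : ℝ} {X : Mat} {K K' : Set Mat}
    {S : ι → Set Mat} {F F' : ι → ℝ≥0∞} {c c' : ℝ≥0∞} (h : Reduces α s X K S F c)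
    (hK : K ⊆ K') (hF : ∀ i, F i ≤ F' i) (hc : c ≤ c') : Reduces α s X K' S F' c' :=
  fun Ω hΩ η hη => (h Ω hΩ η hη).mono hK hF hc

/-- Split `M` into two matrices by changing one entry, then reduce both. -/
theorem Reduces.split {ι : Type} {α s lam d : ℝ} (hα0 : 0 < α) (hα1 : α < 1) (hs : 0 ≤ s)
    (h0 : 0 < lam) (h1 : lam < 1) (hd : d ≠ 0) {M X₁ X₂ : Mat} {i j : Fin 2}
    (hX₁ : X₁ = M + Matrix.single i j ((1 - lam) * d))
    (hX₂ : X₂ = M + Matrix.single i j (-lam * d))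
    {K : Set Mat} {S : ι → Set Mat} {F₁ F₂ : ι → ℝ≥0∞} {c₁ c₂ : ℝ≥0∞} (hc₁ : c₁ ≠ ⊤)
    (hc₂ : c₂ ≠ ⊤) (hr₁ : Reduces α s X₁ K S F₁ c₁) (hr₂ : Reduces α s X₂ K S F₂ c₂) :
    Reduces α s M K S (fun i => ENNReal.ofReal lam * F₁ i + ENNReal.ofReal (1 - lam) * F₂ i)
      (‖d‖ₑ + (c₁ + c₂)) := by
  classical
  intro Ω hΩ η hη
  obtain ⟨f, Df, 𝒰, E, hf, hE, hsub, hcov, hval, hErr, hS, hL⟩ :=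
    reduces_elementary hα0 hα1 hs h0 h1 hd M i j Ω hΩ (η / 3) (by linarith)
  rw [← hX₁, ← hX₂] at hval
  have hS1 := hS true
  have hS2 := hS false
  simp only [if_true, Bool.false_eq_true, if_false, ← hX₁, ← hX₂] at hS1 hS2
  -- Gluing doubles the second Hölder constant: η/3 + 2 · η/3 = η.
  refine hf.reducesOn (η := η / 3) (η₁ := η / 3) (K := fun _ => K)
    (F := fun X => if X = X₁ then F₁ else F₂) hα0 (by linarith) (by linarith) hΩ hE hsub hcov hErr
    hL (ENNReal.add_ne_top.2 ⟨hc₁, hc₂⟩) ?_ (fun _ _ => Subset.rfl) ?_ (by linarith) (by linarith)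
  · intro U hU hUE x hx
    by_cases hX : M + Df x = X₁
    · rw [if_pos hX, hX]
      exact (hr₁ U (hf.regular U hU) _ (by linarith)).mono Subset.rfl (fun _ => le_rfl)
        le_self_add
    · rw [if_neg hX]
      rcases hval x (hUE hx) with h | h
      · exact (hX h).elim
      · rw [h]
        exact (hr₂ U (hf.regular U hU) _ (by linarith)).mono Subset.rfl (fun _ => le_rfl)
          le_add_self
  · intro k
    have hcover : Ω \ E ⊆ {x ∈ Ω \ E | M + Df x ∈ ({X₁} : Set Mat)} ∪
        {x ∈ Ω \ E | M + Df x ∈ ({X₂} : Set Mat)} := by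
      intro x hx
      rcases hval x hx with h | h
      · exact Or.inl ⟨hx, h⟩
      · exact Or.inr ⟨hx, h⟩
    have hmeas : ∀ X : Mat, MeasurableSet {x ∈ Ω \ E | M + Df x ∈ ({X} : Set Mat)} := by
      intro X
      refine hf.measurableSet_of_subordinate (fun x hx => hcov hx.1) fun U hU => ?_
      obtain ⟨Y, b, hY⟩ := hf.affine U hU
      by_cases hYX : M + Y = X
      · rcases hsub U hU with h | h
        · exact Or.inr (disjoint_left.2 fun x hx hx' => hx'.1.2 (h hx))
        · refine Or.inl fun x hx => ⟨⟨hf.subset U hU hx, fun hE => h.le_bot ⟨hx, hE⟩⟩, ?_⟩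
          rw [(hY x hx).2]
          exact hYX
      · refine Or.inr (disjoint_left.2 fun x hx hx' => hYX ?_)
        rw [← (hY x hx).2]
        exact hx'.2
    have hle : ∀ (X : Mat) (F : ι → ℝ≥0∞),
        (∀ x, M + Df x = X → (if M + Df x = X₁ then F₁ else F₂) k ≤ F k) →
        ∫⁻ x in {x ∈ Ω \ E | M + Df x ∈ ({X} : Set Mat)},
          (if M + Df x = X₁ then F₁ else F₂) k ≤
        F k * volume {x ∈ Ω \ E | M + Df x ∈ ({X} : Set Mat)} := by
      intro X F hF
      rw [← setLIntegral_const]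
      exact setLIntegral_mono' (hmeas X) fun x hx => hF x hx.2
    have hne : X₁ ≠ X₂ := by
      rw [hX₁, hX₂]
      intro h
      have := congrFun (congrFun h i) j
      simp only [Matrix.add_apply, Matrix.single_apply_same] at this
      exact hd (by linarith)
    calc ∫⁻ x in Ω \ E, (if M + Df x = X₁ then F₁ else F₂) k
        ≤ _ := lintegral_mono_set hcover
      _ ≤ _ := lintegral_union_le _ _ _
      _ ≤ F₁ k * (ENNReal.ofReal lam * volume Ω) +
            F₂ k * (ENNReal.ofReal (1 - lam) * volume Ω) := by
          refine add_le_add ((hle X₁ F₁ fun x hx => ?_).trans ?_)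
            ((hle X₂ F₂ fun x hx => ?_).trans ?_)
          · rw [if_pos hx]
          · gcongr
          · rw [if_neg (by rw [hx]; exact hne.symm)]
          · gcongr
      _ = _ := by ring

/-! ### The plane of one pair of entries -/

/-- Replace the entries `(0, j)` and `(1, j + 1)` of `B` by `u` and `v`. -/
def emb (j : Fin 2) (B : Mat) (u v : ℝ) : Mat :=
  Matrix.of fun p q => if (q = j ↔ p = 0) then (if p = 0 then u else v) else B p q

lemma emb_add_fst (j : Fin 2) (B : Mat) (u v t : ℝ) :
    emb j B u v + Matrix.single 0 j t = emb j B (u + t) v := by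
  ext p q
  fin_cases j <;> fin_cases p <;> fin_cases q <;> simp [emb, Matrix.single]

lemma emb_add_snd (j : Fin 2) (B : Mat) (u v t : ℝ) :
    emb j B u v + Matrix.single 1 (j + 1) t = emb j B u (v + t) := by
  ext p q
  fin_cases j <;> fin_cases p <;> fin_cases q <;> simp [emb, Matrix.single]

lemma emb_self (j : Fin 2) (B : Mat) : emb j B (B 0 j) (B 1 (j + 1)) = B := by
  ext p q
  fin_cases j <;> fin_cases p <;> fin_cases q <;> simp [emb]

lemma emb_fst (j : Fin 2) (B : Mat) (u v : ℝ) : emb j B u v 0 j = u := by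
  fin_cases j <;> simp [emb]

lemma emb_snd (j : Fin 2) (B : Mat) (u v : ℝ) : emb j B u v 1 (j + 1) = v := by
  fin_cases j <;> simp [emb]

lemma emb_other_fst (j : Fin 2) (B : Mat) (u v : ℝ) : emb j B u v 0 (j + 1) = B 0 (j + 1) := by
  fin_cases j <;> simp [emb]

lemma emb_other_snd (j : Fin 2) (B : Mat) (u v : ℝ) : emb j B u v 1 j = B 1 j := by
  fin_cases j <;> simp [emb]

section Split

variable {ι : Type} {α s lam : ℝ} {j : Fin 2} {B : Mat} {K : Set Mat} {S : ι → Set Mat}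
  {F₁ F₂ : ι → ℝ≥0∞} {c₁ c₂ : ℝ≥0∞}

theorem Reduces.split_fst (hα0 : 0 < α) (hα1 : α < 1) (hs : 0 ≤ s) (h0 : 0 < lam) (h1 : lam < 1)
    {u u₁ u₂ v : ℝ} (hne : u₁ ≠ u₂) (hu : u = lam * u₁ + (1 - lam) * u₂) (hc₁ : c₁ ≠ ⊤)
    (hc₂ : c₂ ≠ ⊤) (hr₁ : Reduces α s (emb j B u₁ v) K S F₁ c₁)
    (hr₂ : Reduces α s (emb j B u₂ v) K S F₂ c₂) :
    Reduces α s (emb j B u v) K S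
      (fun i => ENNReal.ofReal lam * F₁ i + ENNReal.ofReal (1 - lam) * F₂ i)
      (‖u₁ - u₂‖ₑ + (c₁ + c₂)) := by
  refine Reduces.split hα0 hα1 hs h0 h1 (sub_ne_zero.2 hne) (i := 0) (j := j) ?_ ?_ hc₁ hc₂ hr₁ hr₂
  · rw [emb_add_fst]
    congr 1
    rw [hu]
    ring
  · rw [emb_add_fst]
    congr 1
    rw [hu]
    ring

theorem Reduces.split_snd (hα0 : 0 < α) (hα1 : α < 1) (hs : 0 ≤ s) (h0 : 0 < lam) (h1 : lam < 1)
    {u v v₁ v₂ : ℝ} (hne : v₁ ≠ v₂) (hv : v = lam * v₁ + (1 - lam) * v₂) (hc₁ : c₁ ≠ ⊤)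
    (hc₂ : c₂ ≠ ⊤) (hr₁ : Reduces α s (emb j B u v₁) K S F₁ c₁)
    (hr₂ : Reduces α s (emb j B u v₂) K S F₂ c₂) :
    Reduces α s (emb j B u v) K S
      (fun i => ENNReal.ofReal lam * F₁ i + ENNReal.ofReal (1 - lam) * F₂ i)
      (‖v₁ - v₂‖ₑ + (c₁ + c₂)) := by
  refine Reduces.split hα0 hα1 hs h0 h1 (sub_ne_zero.2 hne) (i := 1) (j := j + 1) ?_ ?_ hc₁ hc₂
    hr₁ hr₂
  · rw [emb_add_snd]
    congr 1
    rw [hv]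
    ring
  · rw [emb_add_snd]
    congr 1
    rw [hv]
    ring

end Split

/-! ### Infinite iteration -/

/-- A stage of the iteration: a perturbation together with the set `A` on which the gradient is
still to be changed. -/
structure Stage (α : ℝ) (Ω : Set Plane) (M X : Mat) (H : ℝ) (B : ℝ≥0∞) where
  f : Plane → Plane
  Df : Plane → Mat
  𝒰 : Set (Set Plane)
  A : Set Plane
  pert : IsPerturbation α Ω f Df H 𝒰
  cover : A ⊆ ⋃₀ 𝒰
  sub : Subordinate 𝒰 A
  value : ∀ x ∈ A, M + Df x = X
  vol : volume A ≤ B * volume Ω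

/-- The relation between two successive stages; `E` is the exceptional set. -/
structure Stage.Step {α : ℝ} {Ω : Set Plane} {M X X' : Mat} {H H' : ℝ} {B B' : ℝ≥0∞}
    (T : Stage α Ω M X H B) (T' : Stage α Ω M X' H' B') (E : Set Plane) (s e : ℝ) (K : Set Mat)
    (c : ℝ≥0∞) : Prop where
  holder : ∀ x y, ‖(T'.f x - T.f x) - (T'.f y - T.f y)‖ ≤ 2 * e * ‖x - y‖ ^ α
  off : ∀ x ∉ T.A, T'.f x = T.f x ∧ T'.Df x = T.Df x
  exc_subset : E ⊆ T.A
  active_subset : T'.A ⊆ T.A \ E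
  value : ∀ x ∈ T.A \ E, M + T'.Df x ∈ K ∨ x ∈ T'.A
  err : ∫⁻ x in E, ENNReal.ofReal ((1 + matNorm (M + T'.Df x)) ^ s) ≤ ENNReal.ofReal e * volume Ω
  grad : ∫⁻ x, entrySum (T'.Df x - T.Df x) ≤ c * volume Ω
  refine : ∀ V ∈ T'.𝒰, ∃ U ∈ T.𝒰, V ⊆ U
  keep : ∀ U ∈ T.𝒰, Disjoint U T.A → U ∈ T'.𝒰
  exc_sub : Subordinate T'.𝒰 E

theorem Stage.exists_step {α s e H : ℝ} (hα : 0 < α) (he : 0 < e) {Ω : Set Plane}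
    (hΩ : IsRegularDomain Ω) {M X X' : Mat} {B β c : ℝ≥0∞} {K : Set Mat} (hc : c ≠ ⊤)
    (h : Reduces α s X (K ∪ {X'}) (fun _ : Unit => {X'}) (fun _ => β) c)
    (T : Stage α Ω M X H B) :
    ∃ (T' : Stage α Ω M X' (H + 2 * e) (B * β)) (E : Set Plane),
      T.Step T' E s e K (c * B) := by
  have hval := T.value
  obtain ⟨f', Df', 𝒰', E, hf', hold, hoff, hEA, hK', hErr', hS, hL', href, hkeep, hsubE, hcov'⟩ :=
    T.pert.patch (M := M) (s := s) (K := fun _ => K ∪ {X'}) (S := fun _ : Unit => {X'})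
      (F := fun _ _ => β) hα he.le hΩ T.cover T.sub hc (fun U hU hUA x hx => by
        rw [hval x (hUA hx)]
        exact h U (T.pert.regular U hU) e he)
  have hAm := T.pert.measurableSet_of_subordinate T.cover T.sub
  have hAΩ : T.A ⊆ Ω := fun x hx => by
    obtain ⟨U, hU, hxU⟩ := T.cover hx
    exact T.pert.subset U hU hxU
  -- The new active set consists of the non-exceptional points of the old one where the gradient is
  -- now X'; every other non-exceptional point of it has reached K and is never touched again.
  refine ⟨⟨f', Df', 𝒰', {x ∈ T.A \ E | M + Df' x = X'}, hf', fun x hx => hcov' hx.1, ?_,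
    fun x hx => hx.2, ?_⟩, E, ⟨hold, hoff, hEA, fun x hx => hx.1, ?_, ?_, ?_, href, hkeep, hsubE⟩⟩
  · intro V hV
    obtain ⟨Y, b, hY⟩ := hf'.affine V hV
    rcases (T.sub.of_refine href) V hV with h1 | h1
    · rcases hsubE V hV with h2 | h2
      · exact Or.inr (disjoint_left.2 fun x hx hx' => hx'.1.2 (h2 hx))
      · by_cases hYX : M + Y = X'
        · refine Or.inl fun x hx => ⟨⟨h1 hx, fun hE => h2.le_bot ⟨hx, hE⟩⟩, ?_⟩
          rw [(hY x hx).2, hYX]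
        · refine Or.inr (disjoint_left.2 fun x hx hx' => hYX ?_)
          rw [← (hY x hx).2]
          exact hx'.2
    · exact Or.inr (disjoint_left.2 fun x hx hx' => h1.le_bot ⟨hx, hx'.1.1⟩)
  · refine (hS ()).trans ?_
    rw [setLIntegral_const]
    calc β * volume T.A ≤ β * (B * volume Ω) := by gcongr; exact T.vol
      _ = B * β * volume Ω := by ring
  · intro x hx
    rcases hK' x hx with h' | h'
    · exact Or.inl h'
    · exact Or.inr ⟨hx, h'⟩
  · refine hErr'.trans ?_
    gcongr
  · have : (fun x => entrySum (Df' x - T.Df x)) =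
        T.A.indicator fun x => entrySum (Df' x - T.Df x) := by
      ext x
      by_cases hx : x ∈ T.A
      · rw [indicator_of_mem hx]
      · rw [indicator_of_notMem hx, (hoff x hx).2, sub_self, entrySum_zero]
    rw [this, lintegral_indicator hAm]
    refine hL'.trans ?_
    calc c * volume T.A ≤ c * (B * volume Ω) := by gcongr; exact T.vol
      _ = c * B * volume Ω := by ring

/-- A perturbation whose Hölder constant is unimportant vanishes outside of `Ω`, so that it is
controlled by its Hölder constant. -/
lemma norm_le_of_holder {α H : ℝ} {Ω : Set Plane} {f : Plane → Plane} {y : Plane} (hy : y ∉ Ω)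
    (h0 : ∀ x ∉ Ω, f x = 0) (h : ∀ x y, ‖f x - f y‖ ≤ H * ‖x - y‖ ^ α) (x : Plane) :
    ‖f x‖ ≤ H * ‖x - y‖ ^ α := by
  have := h x y
  rwa [h0 y hy, sub_zero] at this

/-- An infinite sequence of reductions of `P n` to `K n` and `P (n + 1)` can be iterated. -/
theorem Reduces.iterate {ι : Type} {α s : ℝ} (hα : 0 < α) {P : ℕ → Mat} {K : ℕ → Set Mat}
    {β c : ℕ → ℝ≥0∞} (hc : ∀ n, c n ≠ ⊤)
    (h : ∀ n, Reduces α s (P n) (K n ∪ {P (n + 1)}) (fun _ : Unit => {P (n + 1)})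
      (fun _ => β n) (c n)) {B : ℕ → ℝ≥0∞} (hB0 : B 0 = 1) (hBs : ∀ n, B (n + 1) = B n * β n)
    (hB : Filter.Tendsto B Filter.atTop (nhds 0))
    (hC : ∑' n, c n * B n ≠ ⊤) {S : ι → Set Mat} {F : ι → ℝ≥0∞}
    (hF : ∀ i, ∃ n, (∀ m < n, Disjoint (K m) (S i)) ∧ B n ≤ F i) :
    Reduces α s (P 0) (⋃ n, K n) S F (∑' n, c n * B n) := by
  intro Ω hΩ η hη
  -- Hölder constants grow by 2 `e n`, for a total of η, while the errors `e n` add up to η/2.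
  set e : ℕ → ℝ := fun n => η / 4 * (1 / 2) ^ n with he
  have he0 : ∀ n, 0 < e n := fun n => by positivity
  have hesum : HasSum e (η / 2) := by
    have := hasSum_geometric_two.mul_left (η / 4)
    rwa [show η / 4 * 2 = η / 2 by ring] at this
  have hstep : ∀ n (H : ℝ) (T : Stage α Ω (P 0) (P n) H (B n)),
      ∃ (T' : Stage α Ω (P 0) (P (n + 1)) (H + 2 * e n) (B (n + 1))) (E : Set Plane),
        T.Step T' E s (e n) (K n) (c n * B n) := by
    intro n H T
    rw [hBs]
    exact T.exists_step hα (he0 n) hΩ (hc n) (h n)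
  choose next exc hnext using hstep
  let T₀ : Stage α Ω (P 0) (P 0) 0 (B 0) :=
    { f := fun _ => 0, Df := fun _ => 0, 𝒰 := {Ω}, A := Ω, pert := isPerturbation_zero hΩ α le_rfl
      cover := by simp
      sub := fun U hU => Or.inl (le_of_eq hU)
      value := fun x _ => by simp
      vol := by simp [hB0] }
  let st : ∀ n, Σ H : ℝ, Stage α Ω (P 0) (P n) H (B n) := fun n =>
    -- The Hölder constant depends on the preceding steps, so it is carried along in the recursion.
    Nat.rec ⟨0, T₀⟩ (fun n T => ⟨T.1 + 2 * e n, next n T.1 T.2⟩) n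
  set T := fun n => (st n).2 with hT
  set E : ℕ → Set Plane := fun n => exc n (st n).1 (st n).2 with hE
  have hS : ∀ n, (T n).Step (T (n + 1)) (E n) s (e n) (K n) (c n * B n) := fun n =>
    hnext n (st n).1 (st n).2
  have hT0 : T 0 = T₀ := rfl
  have hHs : ∀ n, (st n).1 = ∑ k ∈ Finset.range n, 2 * e k := by
    intro n
    induction n with
    | zero => rfl
    | succ n ih => rw [Finset.sum_range_succ, ← ih]
  have hHη : ∀ n, (st n).1 ≤ η := by
    intro n
    rw [hHs, ← Finset.mul_sum]
    have := sum_le_hasSum (Finset.range n) (fun k _ => (he0 k).le) hesum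
    linarith
  have hpert : ∀ n, IsPerturbation α Ω (T n).f (T n).Df η (T n).𝒰 := fun n =>
    { (T n).pert with
      holder := fun x y => ((T n).pert.holder x y).trans
        (mul_le_mul_of_nonneg_right (hHη n) (by positivity)) }
  clear_value T E
  -- nestedness
  have hanti : Antitone fun n => (T n).A :=
    antitone_nat_of_succ_le fun n => (hS n).active_subset.trans sdiff_subset
  have hAm : ∀ n, MeasurableSet (T n).A := fun n =>
    (hpert n).measurableSet_of_subordinate (T n).cover (T n).sub
  have hoff : ∀ n m x, n ≤ m → x ∉ (T n).A →
      (T m).f x = (T n).f x ∧ (T m).Df x = (T n).Df x := by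
    intro n m x hnm hx
    induction m, hnm using Nat.le_induction with
    | base => exact ⟨rfl, rfl⟩
    | succ m hnm ih =>
      obtain ⟨h1, h2⟩ := (hS m).off x fun hxm => hx (hanti hnm hxm)
      exact ⟨h1.trans ih.1, h2.trans ih.2⟩
  have hkeep : ∀ n m U, n ≤ m → U ∈ (T n).𝒰 → Disjoint U (T n).A →
      U ∈ (T m).𝒰 ∧ Disjoint U (T m).A := by
    intro n m U hnm hU hd
    induction m, hnm using Nat.le_induction with
    | base => exact ⟨hU, hd⟩
    | succ m hnm ih =>
      exact ⟨(hS m).keep U ih.1 ih.2,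
        ih.2.mono_right (hanti (Nat.le_succ m))⟩
  have hexc : ∀ n m, n < m → Subordinate (T m).𝒰 (E n) := by
    intro n m hnm
    induction m, hnm using Nat.le_induction with
    | base => exact (hS n).exc_sub
    | succ m _ ih => exact ih.of_refine (hS m).refine
  have hAnull : volume (⋂ n, (T n).A) = 0 := by
    have h1 : Filter.Tendsto (fun n => B n * volume Ω) Filter.atTop (nhds 0) := by
      have := ENNReal.Tendsto.mul_const (b := volume Ω) hB (Or.inr hΩ.volume_lt_top.ne)
      simpa using this
    refine le_antisymm (ge_of_tendsto' h1 fun n => ?_) zero_le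
    exact (measure_mono (iInter_subset _ n)).trans (T n).vol
  -- the limit map
  obtain ⟨y₀, hy₀⟩ : ∃ y, y ∉ Ω := by
    by_contra! hall
    have : Ω = univ := eq_univ_of_forall hall
    have h2 := hΩ.volume_lt_top
    rw [this, measure_univ_of_isAddLeftInvariant] at h2
    exact lt_irrefl _ h2
  have hlim : ∀ x, ∃ l, Filter.Tendsto (fun n => (T n).f x) Filter.atTop (nhds l) := by
    intro x
    refine cauchySeq_tendsto_of_complete
      (cauchySeq_of_le_geometric (1 / 2) (η / 2 * ‖x - y₀‖ ^ α) (by norm_num) fun n => ?_)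
    rw [dist_comm, dist_eq_norm]
    have := norm_le_of_holder (f := fun x => (T (n + 1)).f x - (T n).f x) hy₀
      (fun x hx => by rw [(hpert _).zero x hx, (hpert _).zero x hx, sub_zero]) (hS n).holder x
    refine this.trans (le_of_eq ?_)
    simp only [he]
    ring
  choose f hf using hlim
  have hfoff : ∀ n x, x ∉ (T n).A → f x = (T n).f x := by
    intro n x hx
    refine tendsto_nhds_unique (hf x) (tendsto_const_nhds.congr' ?_)
    filter_upwards [Filter.eventually_ge_atTop n] with m hm
    exact (hoff n m x hm hx).1.symm
  classical
  -- The gradient is frozen when x first leaves the active set; the value 0 is taken only on the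
  -- null intersection of the active sets.
  set Df : Plane → Mat := fun x => if hx : ∃ n, x ∉ (T n).A then (T (Nat.find hx)).Df x else 0
    with hDf
  have hDfoff : ∀ n x, x ∉ (T n).A → Df x = (T n).Df x := by
    intro n x hx
    have hex : ∃ n, x ∉ (T n).A := ⟨n, hx⟩
    rw [hDf]
    simp only [dif_pos hex]
    exact (hoff _ n x (Nat.find_min' hex hx) (Nat.find_spec hex)).2.symm
  have hDfae : ∀ᵐ x, ∃ n, x ∉ (T n).A := by
    filter_upwards [compl_mem_ae_iff.2 hAnull] with x hx
    simpa using hx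
  have hDflim : ∀ᵐ x, ∀ i j,
      Filter.Tendsto (fun n => (T n).Df x i j) Filter.atTop (nhds (Df x i j)) := by
    filter_upwards [hDfae] with x hx i j
    obtain ⟨n, hn⟩ := hx
    refine tendsto_const_nhds.congr' ?_
    filter_upwards [Filter.eventually_ge_atTop n] with m hm
    rw [(hoff n m x hm hn).2, hDfoff n x hn]
  -- domination
  set D : Plane → ℝ≥0∞ := fun x => ∑' n, entrySum ((T (n + 1)).Df x - (T n).Df x) with hD
  have hdm : ∀ n, AEMeasurable fun x => entrySum ((T (n + 1)).Df x - (T n).Df x) := by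
    intro n
    simp only [entrySum, Matrix.sub_apply]
    exact Finset.aemeasurable_fun_sum _ fun i _ => Finset.aemeasurable_fun_sum _ fun j _ =>
      (((hpert _).integrable i j).sub ((hpert _).integrable i j)).aestronglyMeasurable.enorm
  have hDint : ∫⁻ x, D x ≤ (∑' n, c n * B n) * volume Ω := by
    rw [hD, lintegral_tsum hdm, ← ENNReal.tsum_mul_right]
    exact ENNReal.tsum_le_tsum fun n => (hS n).grad
  have hDfin : ∫⁻ x, D x ≠ ⊤ :=
    (hDint.trans_lt (ENNReal.mul_lt_top hC.lt_top hΩ.volume_lt_top)).ne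
  have hDm : AEMeasurable D := AEMeasurable.tsum hdm
  have hTD : ∀ n x, entrySum ((T n).Df x) ≤ D x := by
    intro n x
    refine le_trans ?_ (ENNReal.sum_le_tsum (Finset.range n))
    induction n with
    | zero => rw [hT0]; exact (entrySum_zero).le
    | succ n ih =>
      rw [Finset.sum_range_succ]
      calc entrySum ((T (n + 1)).Df x)
          = entrySum ((T n).Df x + ((T (n + 1)).Df x - (T n).Df x)) := by
            rw [add_sub_cancel]
        _ ≤ _ := (entrySum_add_le _ _).trans (add_le_add_left ih _)
  have hDfD : ∀ x, entrySum (Df x) ≤ D x := by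
    intro x
    by_cases hx : ∃ n, x ∉ (T n).A
    · obtain ⟨n, hn⟩ := hx
      rw [hDfoff n x hn]
      exact hTD n x
    · rw [hDf]
      simp only [dif_neg hx]
      rw [entrySum_zero]
      exact zero_le
  have hDreal : Integrable fun x => (D x).toReal := integrable_toReal_of_lintegral_ne_top hDm hDfin
  have hDlt : ∀ᵐ x, D x < ⊤ := ae_lt_top' hDm hDfin
  have hDfm : ∀ i j, AEStronglyMeasurable fun x => Df x i j := fun i j =>
    aestronglyMeasurable_of_tendsto_ae Filter.atTop
      (fun n => ((hpert n).integrable i j).aestronglyMeasurable)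
      (by filter_upwards [hDflim] with x hx using hx i j)
  have hbound : ∀ X : Mat, ∀ x, D x < ⊤ → entrySum X ≤ D x → ∀ i j, ‖X i j‖ ≤ (D x).toReal := by
    intro X x hx hX i j
    rw [← toReal_enorm]
    exact ENNReal.toReal_mono hx.ne ((enorm_entry_le X i j).trans hX)
  -- the pieces and the exceptional set
  set 𝒰 : Set (Set Plane) := ⋃ n, {U ∈ (T n).𝒰 | Disjoint U (T n).A} with h𝒰
  have hcommon : ∀ U ∈ 𝒰, ∀ V ∈ 𝒰, ∃ n, U ∈ (T n).𝒰 ∧ V ∈ (T n).𝒰 := by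
    intro U hU V hV
    obtain ⟨n, hU, hUd⟩ := mem_iUnion.1 hU
    obtain ⟨m, hV, hVd⟩ := mem_iUnion.1 hV
    exact ⟨max n m, (hkeep n _ U (le_max_left _ _) hU hUd).1,
      (hkeep m _ V (le_max_right _ _) hV hVd).1⟩
  have h𝒰null : volume (Ω \ ⋃₀ 𝒰) = 0 := by
    refine measure_mono_null (t := (⋃ n, (Ω \ ⋃₀ (T n).𝒰)) ∪ ⋂ n, (T n).A) ?_
      (measure_union_null (measure_iUnion_null fun n => (hpert n).null) hAnull)
    rintro x ⟨hx, hx'⟩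
    by_cases hxA : x ∈ ⋂ n, (T n).A
    · exact Or.inr hxA
    · left
      simp only [mem_iInter, not_forall] at hxA
      obtain ⟨n, hn⟩ := hxA
      refine mem_iUnion.2 ⟨n, hx, ?_⟩
      rintro ⟨U, hU, hxU⟩
      rcases (T n).sub U hU with hUA | hUA
      · exact hn (hUA hxU)
      · exact hx' ⟨U, mem_iUnion.2 ⟨n, hU, hUA⟩, hxU⟩
  -- Take the last stage n at which x is active. As x is not exceptional and leaves the active set,
  -- its gradient entered `K n`.
  have hlast : ∀ x ∈ Ω \ ((⋃ n, E n) ∪ (Ω \ ⋃₀ 𝒰)), ∃ n, x ∈ (T n).A ∧ P 0 + Df x ∈ K n := by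
    rintro x ⟨hxΩ, hx⟩
    simp only [mem_union, not_or, mem_sdiff, not_and, not_not] at hx
    obtain ⟨U, hU, hxU⟩ := hx.2 hxΩ
    obtain ⟨m, hU, hUd⟩ := mem_iUnion.1 hU
    have hex : ∃ n, x ∉ (T n).A := ⟨m, fun hxA => hUd.le_bot ⟨hxU, hxA⟩⟩
    have hspec := Nat.find_spec hex
    obtain ⟨k, hk⟩ : ∃ k, Nat.find hex = k + 1 := by
      refine Nat.exists_eq_succ_of_ne_zero fun h0 => ?_
      rw [h0, hT0] at hspec
      exact hspec hxΩ
    have hkA : x ∈ (T k).A := by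
      by_contra hkA
      have := Nat.find_min' hex hkA
      omega
    rw [hk] at hspec
    have hkE : x ∉ E k := fun hxE => hx.1 (mem_iUnion.2 ⟨k, hxE⟩)
    refine ⟨k, hkA, ?_⟩
    rw [hDfoff _ x hspec]
    exact ((hS k).value x ⟨hkA, hkE⟩).resolve_right hspec
  refine ⟨f, Df, 𝒰, (⋃ n, E n) ∪ (Ω \ ⋃₀ 𝒰), ?_, ?_, ?_, ?_, ?_, ?_, ?_, ?_⟩
  · refine ⟨?_, ?_, ?_, ?_, ?_, ?_, ?_, ?_, ?_, ?_, h𝒰null⟩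
    · intro x hx
      have : x ∉ (T 0).A := by rw [hT0]; exact hx
      rw [hfoff 0 x this]
      exact (hpert 0).zero x hx
    · intro x hx
      have : x ∉ (T 0).A := by rw [hT0]; exact hx
      rw [hDfoff 0 x this]
      exact (hpert 0).grad_zero x hx
    · intro x y
      exact le_of_tendsto' ((hf x).sub (hf y)).norm fun n => (hpert n).holder x y
    · intro i j
      refine hDreal.mono' (hDfm i j) ?_
      filter_upwards [hDlt] with x hx
      exact hbound _ x hx (hDfD x) i j
    · intro φ hφ hφc i j
      have hv := continuous_fderiv_apply_of_contDiff hφ (EuclideanSpace.single j 1)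
      have hvc := hasCompactSupport_fderiv_apply' hφc (EuclideanSpace.single j 1)
      have h1 : Filter.Tendsto (fun n => ∫ x, (T n).f x i *
          fderiv ℝ φ x (EuclideanSpace.single j 1)) Filter.atTop
          (nhds (∫ x, f x i * fderiv ℝ φ x (EuclideanSpace.single j 1))) := by
        have hpow : Continuous fun x : Plane => η * ‖x - y₀‖ ^ α :=
          continuous_const.mul ((continuous_id.sub continuous_const).norm.rpow_const
            fun _ => Or.inr hα.le)
        refine tendsto_integral_of_dominated_convergence
          (fun x => η * ‖x - y₀‖ ^ α * ‖fderiv ℝ φ x (EuclideanSpace.single j 1)‖)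
          (fun n => ?_) ?_ (fun n => ?_) ?_
        · exact ((continuous_entry (continuous_of_holder hα (hpert n).holder) i).mul
            hv).aestronglyMeasurable
        · exact (hpow.mul hv.norm).integrable_of_hasCompactSupport hvc.norm.mul_left
        · refine Filter.Eventually.of_forall fun x => ?_
          rw [norm_mul]
          refine mul_le_mul_of_nonneg_right ?_ (norm_nonneg _)
          exact (PiLp.norm_apply_le _ i).trans
            (norm_le_of_holder hy₀ (hpert n).zero (hpert n).holder x)
        · refine Filter.Eventually.of_forall fun x => ?_
          refine Filter.Tendsto.mul_const _ ?_
          exact ((EuclideanSpace.proj (𝕜 := ℝ) i).continuous.tendsto _).comp (hf x)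
      have h2 : Filter.Tendsto (fun n => ∫ x, (T n).Df x i j * φ x) Filter.atTop
          (nhds (∫ x, Df x i j * φ x)) := by
        refine tendsto_integral_of_dominated_convergence (fun x => (D x).toReal * ‖φ x‖)
          (fun n => ?_) ?_ (fun n => ?_) ?_
        · exact (integrable_mul_test ((hpert n).integrable i j) hφ.continuous
            hφc).aestronglyMeasurable
        · exact integrable_mul_test hDreal hφ.continuous.norm hφc.norm
        · filter_upwards [hDlt] with x hx
          rw [norm_mul]
          exact mul_le_mul_of_nonneg_right (hbound _ x hx (hTD n x) i j) (norm_nonneg _)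
        · filter_upwards [hDflim] with x hx
          exact (hx i j).mul_const _
      refine tendsto_nhds_unique h1 (h2.neg.congr fun n => ?_)
      exact ((hpert n).weak φ hφ hφc i j).symm
    · exact countable_iUnion fun n => (hpert n).countable.mono (sep_subset _ _)
    · intro U hU V hV hUV
      obtain ⟨n, h1, h2⟩ := hcommon U hU V hV
      exact (hpert n).disjoint h1 h2 hUV
    · intro U hU
      obtain ⟨n, hU, _⟩ := mem_iUnion.1 hU
      exact (hpert n).regular U hU
    · intro U hU
      obtain ⟨n, hU, _⟩ := mem_iUnion.1 hU
      exact (hpert n).subset U hU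
    · intro U hU
      obtain ⟨n, hU, hUd⟩ := mem_iUnion.1 hU
      obtain ⟨Y, b, hY⟩ := (hpert n).affine U hU
      refine ⟨Y, b, fun x hx => ?_⟩
      have hxA : x ∉ (T n).A := fun hxA => hUd.le_bot ⟨hx, hxA⟩
      rw [hfoff n x hxA, hDfoff n x hxA]
      exact hY x hx
  · refine union_subset (iUnion_subset fun n => ?_) sdiff_subset
    exact ((hS n).exc_subset.trans (hanti (Nat.zero_le n))).trans
      (show (T 0).A ⊆ Ω by rw [hT0])
  · intro U hU
    by_cases hex : ∃ k, U ⊆ E k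
    · obtain ⟨k, hk⟩ := hex
      exact Or.inl ((hk.trans (subset_iUnion E k)).trans subset_union_left)
    · right
      refine disjoint_union_right.2 ⟨disjoint_iUnion_right.2 fun k => ?_,
        disjoint_left.2 fun x hx hx' => hx'.2 ⟨U, hU, hx⟩⟩
      obtain ⟨n, hU, hUd⟩ := mem_iUnion.1 hU
      rcases lt_or_ge k n with hkn | hkn
      · exact (hexc k n hkn U hU).resolve_left fun hk => hex ⟨k, hk⟩
      · exact hUd.mono_right ((hS k).exc_subset.trans (hanti hkn))
  · rintro x ⟨hx, hx'⟩
    by_contra hxU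
    exact hx' (Or.inr ⟨hx, hxU⟩)
  · intro x hx
    obtain ⟨n, _, hn⟩ := hlast x hx
    exact mem_iUnion.2 ⟨n, hn⟩
  · refine (lintegral_union_le _ _ _).trans ?_
    rw [Measure.restrict_eq_zero.2 h𝒰null, lintegral_zero_measure, add_zero]
    refine (lintegral_iUnion_le _ _).trans ?_
    calc ∑' n, ∫⁻ x in E n, ENNReal.ofReal ((1 + matNorm (P 0 + Df x)) ^ s)
        ≤ ∑' n, ENNReal.ofReal (e n) * volume Ω := by
          refine ENNReal.tsum_le_tsum fun n => le_trans (le_of_eq ?_) (hS n).err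
          refine lintegral_congr_of_subset (hAm (n + 1)).compl
            (fun x hx hxA => ((hS n).active_subset hxA).2 hx) fun x hx => ?_
          rw [hDfoff (n + 1) x hx]
      _ = ENNReal.ofReal (η / 2) * volume Ω := by
          rw [ENNReal.tsum_mul_right, ← ENNReal.ofReal_tsum_of_nonneg (fun n => (he0 n).le)
            hesum.summable, hesum.tsum_eq]
      _ ≤ ENNReal.ofReal η * volume Ω := by
          gcongr
          linarith
  · intro i
    obtain ⟨n, hn, hBn⟩ := hF i
    calc volume {x ∈ Ω \ ((⋃ n, E n) ∪ (Ω \ ⋃₀ 𝒰)) | P 0 + Df x ∈ S i}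
        ≤ volume (T n).A := by
          refine measure_mono ?_
          -- A gradient in `S i` cannot have been produced before step n, so x was still active at
          -- stage n, and that set has volume at most B n.
          rintro x ⟨hx, hxS⟩
          obtain ⟨k, hkA, hkK⟩ := hlast x hx
          have hnk : n ≤ k := by
            by_contra! hlt
            exact (hn k hlt).le_bot ⟨hkK, hxS⟩
          exact hanti hnk hkA
      _ ≤ B n * volume Ω := (T n).vol
      _ ≤ F i * volume Ω := by gcongr
  · refine le_trans ?_ hDint
    exact (setLIntegral_le_lintegral _ _).trans (lintegral_mono hDfD)

/-! ### The staircase and its exponent -/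

/-- The loss of mass in one step of the staircase beats the exponent `q` for small steps. -/
lemma exists_step_size {k c q : ℝ} (hk : 0 < k) (hc : 0 < c) (hq : q < 1 / (1 + k) + k / (c + k)) :
    ∃ δ : ℝ, 0 < δ ∧ δ ≤ 1 ∧ ∀ r, 1 < r → r ≤ 1 + δ →
      (1 + k) / (r + k) * ((c * r + k) / ((c + k) * r)) ≤ r ^ (-q) := by
  -- Up to an additive constant, the logarithm of the claimed inequality. Its derivative at 1 is q -
  -- 1/(1+k) - k/(c+k), which is negative by hypothesis.
  set g : ℝ → ℝ := fun r => q * Real.log r + Real.log (c * r + k) - Real.log (r + k) - Real.log r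
    with hg
  have hck : 0 < c + k := by linarith
  have hd : HasDerivAt g (q * 1⁻¹ + (c * 1) / (c * 1 + k) - 1 / (1 + k) - 1⁻¹) 1 := by
    have h1 := (Real.hasDerivAt_log (one_ne_zero)).const_mul q
    have h2 : HasDerivAt (fun r => Real.log (c * r + k)) ((c * 1) / (c * 1 + k)) 1 :=
      (((hasDerivAt_id (1 : ℝ)).const_mul c).add_const k).log (by simp; linarith)
    have h3 : HasDerivAt (fun r => Real.log (r + k)) (1 / (1 + k)) 1 :=
      ((hasDerivAt_id (1 : ℝ)).add_const k).log (by simp; linarith)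
    exact ((h1.add h2).sub h3).sub (Real.hasDerivAt_log one_ne_zero)
  have hneg : q * 1⁻¹ + (c * 1) / (c * 1 + k) - 1 / (1 + k) - 1⁻¹ < 0 := by
    have : c / (c + k) = 1 - k / (c + k) := by field_simp; ring
    simp only [mul_one, inv_one, this]
    linarith
  have hev : ∀ᶠ r in nhdsWithin (1 : ℝ) {1}ᶜ, slope g 1 r < 0 :=
    (hasDerivAt_iff_tendsto_slope.1 hd).eventually_lt_const hneg
  obtain ⟨δ, hδ, hball⟩ := Metric.mem_nhdsWithin_iff.1 hev
  refine ⟨min (δ / 2) 1, by positivity, min_le_right _ _, fun r hr1 hr2 => ?_⟩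
  have hr0 : 0 < r := by linarith
  have hrδ : r ≤ 1 + δ / 2 := hr2.trans (by linarith [min_le_left (δ / 2) 1])
  have hs : slope g 1 r < 0 := hball ⟨by
    rw [Metric.mem_ball, Real.dist_eq, abs_of_pos (by linarith)]
    linarith, by simpa using hr1.ne'⟩
  rw [slope_def_field] at hs
  have hgr : g r < g 1 := by
    by_contra! h
    have := div_nonneg (sub_nonneg.2 h) (by linarith : 0 ≤ r - 1)
    linarith
  simp only [hg, Real.log_one, mul_one, mul_zero, zero_add, sub_zero] at hgr
  have hA : 0 < (1 + k) / (r + k) * ((c * r + k) / ((c + k) * r)) := by positivity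
  rw [← Real.log_le_log_iff hA (by positivity), Real.log_rpow hr0,
    Real.log_mul (by positivity) (by positivity), Real.log_div (by positivity) (by positivity),
    Real.log_div (by positivity) (by positivity), Real.log_mul (by positivity) (by positivity)]
  linarith

/-- The fraction of mass that stays on the staircase. -/
lemma staircase_mass_le {k c q δ : ℝ} (hk : 0 < k) (hc : 0 < c)
    (hδ : ∀ r, 1 < r → r ≤ 1 + δ →
      (1 + k) / (r + k) * ((c * r + k) / ((c + k) * r)) ≤ r ^ (-q))
    {x x' h g : ℝ} (hx : 0 < x) (hxx' : x < x') (hx' : x' ≤ (1 + δ) * x) (hh0 : 0 < h)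
    (hh : h ≤ k * x) (hg0 : 0 ≤ g) (hg : g ≤ c * x') :
    (x + h) / (x' + h) * ((g + k * x) / (g + k * x')) ≤ (x / x') ^ q := by
  have hx'0 : 0 < x' := hx.trans hxx'
  have hr := hδ (x' / x) (by rwa [one_lt_div hx]) (by rwa [div_le_iff₀ hx])
  -- The two factors increase in h and in g respectively, so the extreme values h = kx and g = cx'
  -- are the worst case.
  have e1 : (x + h) / (x' + h) ≤ (1 + k) / (x' / x + k) := by
    have : (1 + k) / (x' / x + k) = (x + k * x) / (x' + k * x) := by field_simp
    rw [this, div_le_div_iff₀ (by positivity) (by positivity)]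
    nlinarith
  have e2 : (g + k * x) / (g + k * x') ≤ (c * (x' / x) + k) / ((c + k) * (x' / x)) := by
    have : (c * (x' / x) + k) / ((c + k) * (x' / x)) = (c * x' + k * x) / (c * x' + k * x') := by
      field_simp
    rw [this, div_le_div_iff₀ (by positivity) (by positivity)]
    nlinarith [mul_nonneg hk.le (mul_nonneg (sub_nonneg.2 hg) (sub_nonneg.2 hxx'.le))]
  calc _ ≤ (1 + k) / (x' / x + k) * ((c * (x' / x) + k) / ((c + k) * (x' / x))) :=
        mul_le_mul e1 e2 (by positivity) (by positivity)
    _ ≤ (x' / x) ^ (-q) := hr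
    _ = (x / x') ^ q := by
        rw [Real.rpow_neg (by positivity), ← Real.inv_rpow (by positivity), inv_div]

/-- The matrices whose entries `(0, j)` and `(1, j + 1)` have absolute values with sum greater than
`t`. -/
def largePair (j : Fin 2) (t : Ioi (0 : ℝ)) : Set Mat := {A | t.1 < |A 0 j| + |A 1 (j + 1)|}

/-- The infinite staircase. -/
theorem reduces_staircase {α s : ℝ} (hα0 : 0 < α) (hα1 : α < 1) (hs : 0 ≤ s)
    {k c q δ R : ℝ} (hk : 0 < k) (hk1 : k ≤ 1) (hc : 0 < c) (hc1 : c ≤ 1) (hq : 1 < q)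
    (hδ0 : 0 < δ) (hδ1 : δ ≤ 1)
    (hδ : ∀ r, 1 < r → r ≤ 1 + δ →
      (1 + k) / (r + k) * ((c * r + k) / ((c + k) * r)) ≤ r ^ (-q))
    {g : ℝ → ℝ} (hg1 : ∀ y, R ≤ y → ∃ h, 0 < h ∧ h ≤ y ∧ g (-h) = -y)
    (hg2 : ∀ x, R ≤ x → ∃ x', x ≤ x' ∧ x' ≤ x + 2 ∧ 0 ≤ g x' ∧ g x' ≤ c * x')
    {e₁ e₂ : ℝ} (he₁ : |e₁| = 1) (he₂ : |e₂| = 1) (j : Fin 2)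
    {x₀ : ℝ} (hx₀ : 0 < x₀) (hR : R ≤ k * x₀) (hx₀δ : 4 / δ ≤ x₀) :
    ∃ C : ℝ≥0∞, C ≠ ⊤ ∧ ∀ B : Mat,
      Reduces α s (emb j B (e₁ * x₀) (e₂ * -(k * x₀)))
        {A | ∃ u, u ≠ 0 ∧ A = emb j B (e₁ * u) (e₂ * g u)} (largePair j)
        (fun t => ENNReal.ofReal ((4 * x₀ / t.1) ^ q)) C := by
  have hnext : ∀ x : ℝ, ∃ x', x₀ ≤ x → (1 + δ / 2) * x ≤ x' ∧ x' ≤ (1 + δ) * x ∧ 0 ≤ g x' ∧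
      g x' ≤ c * x' := by
    intro x
    by_cases hx : x₀ ≤ x
    · have h4 : 4 ≤ x * δ := by
        rw [div_le_iff₀ hδ0] at hx₀δ
        nlinarith
      -- The waiting window of length 2 fits between (1 + δ/2)x and (1 + δ)x, because δx/2 ≥ 2.
      obtain ⟨x', h1, h2, h3, h4⟩ := hg2 ((1 + δ / 2) * x) (by nlinarith)
      exact ⟨x', fun _ => ⟨h1, by linarith, h3, h4⟩⟩
    · exact ⟨0, fun h => (hx h).elim⟩
  have hhit : ∀ x : ℝ, ∃ h, x₀ ≤ x → 0 < h ∧ h ≤ k * x ∧ g (-h) = -(k * x) := by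
    intro x
    by_cases hx : x₀ ≤ x
    · obtain ⟨h, h1⟩ := hg1 (k * x) (by nlinarith)
      exact ⟨h, fun _ => h1⟩
    · exact ⟨0, fun h => (hx h).elim⟩
  choose nxt hnxt using hnext
  choose hit hhit using hhit
  set X : ℕ → ℝ := fun n => nxt^[n] x₀ with hX
  have hX0 : X 0 = x₀ := rfl
  have hXs : ∀ n, X (n + 1) = nxt (X n) := fun n => Function.iterate_succ_apply' _ _ _
  have hXge : ∀ n, x₀ ≤ X n := by
    intro n
    induction n with
    | zero => exact le_rfl
    | succ n ih =>
      rw [hXs]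
      have := (hnxt _ ih).1
      nlinarith
  have hXpos : ∀ n, 0 < X n := fun n => hx₀.trans_le (hXge n)
  have hstep : ∀ n, (1 + δ / 2) * X n ≤ X (n + 1) ∧ X (n + 1) ≤ (1 + δ) * X n ∧ 0 ≤ g (X (n + 1)) ∧
      g (X (n + 1)) ≤ c * X (n + 1) := fun n => by
    rw [hXs]
    exact hnxt _ (hXge n)
  have hgrow : ∀ n, (1 + δ / 2) ^ n * x₀ ≤ X n := by
    intro n
    induction n with
    | zero => simp [hX0]
    | succ n ih =>
      refine le_trans ?_ (hstep n).1
      rw [pow_succ]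
      nlinarith
  have hratio : ∀ n, x₀ / X n ≤ ((1 + δ / 2)⁻¹) ^ n := by
    intro n
    rw [div_le_iff₀ (hXpos n), inv_pow, inv_mul_eq_div, le_div_iff₀ (by positivity)]
    linarith [hgrow n]
  have hρ1 : (1 + δ / 2)⁻¹ < 1 := inv_lt_one_of_one_lt₀ (by linarith)
  have hρ0 : 0 < (1 + δ / 2)⁻¹ := by positivity
  have hr0 : ∀ n, 0 < x₀ / X n := fun n => div_pos hx₀ (hXpos n)
  have hr1 : ∀ n, x₀ / X n ≤ 1 := fun n => (div_le_one (hXpos n)).2 (hXge n)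
  set Bd : ℕ → ℝ≥0∞ := fun n => ENNReal.ofReal ((x₀ / X n) ^ q) with hBd
  have hBlim : Filter.Tendsto Bd Filter.atTop (nhds 0) := by
    have h1 : Filter.Tendsto (fun n : ℕ => ((1 + δ / 2)⁻¹) ^ n) Filter.atTop (nhds 0) :=
      tendsto_pow_atTop_nhds_zero_of_lt_one hρ0.le hρ1
    have h2 : Filter.Tendsto (fun n => (x₀ / X n) ^ q) Filter.atTop (nhds 0) := by
      refine squeeze_zero (fun n => Real.rpow_nonneg (hr0 n).le _) (fun n => ?_) h1
      refine le_trans ?_ (hratio n)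
      conv_rhs => rw [← Real.rpow_one (x₀ / X n)]
      exact Real.rpow_le_rpow_of_exponent_ge (hr0 n) (hr1 n) hq.le
    have := ENNReal.tendsto_ofReal h2
    rwa [ENNReal.ofReal_zero] at this
  -- A step at position X n changes gradients by at most 7 X n on a set of relative volume (x₀/X
  -- n)^q. For q > 1 the products decay geometrically.
  have hsum : ∑' n, ENNReal.ofReal (7 * X n) * Bd n ≠ ⊤ := by
    have hgeo : Summable fun n : ℕ => 7 * x₀ * (((1 + δ / 2)⁻¹) ^ (q - 1)) ^ n :=
      (summable_geometric_of_lt_one (by positivity)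
        (Real.rpow_lt_one hρ0.le hρ1 (by linarith))).mul_left _
    refine ne_top_of_le_ne_top hgeo.tsum_ofReal_ne_top (ENNReal.tsum_le_tsum fun n => ?_)
    rw [hBd, ← ENNReal.ofReal_mul (by linarith [hXpos n])]
    refine ENNReal.ofReal_le_ofReal ?_
    have e1 : 7 * X n * (x₀ / X n) ^ q = 7 * x₀ * (x₀ / X n) ^ (q - 1) := by
      rw [Real.rpow_sub_one (hr0 n).ne']
      have := (hXpos n).ne'
      field_simp
    rw [e1, ← Real.rpow_natCast, ← Real.rpow_mul hρ0.le, mul_comm (q - 1), Real.rpow_mul hρ0.le,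
      Real.rpow_natCast]
    refine mul_le_mul_of_nonneg_left ?_ (by linarith)
    exact Real.rpow_le_rpow (hr0 n).le (hratio n) (by linarith)
  have habs1 : ∀ u, |e₁ * u| = |u| := fun u => by rw [abs_mul, he₁, one_mul]
  have habs2 : ∀ u, |e₂ * u| = |u| := fun u => by rw [abs_mul, he₂, one_mul]
  have he₁0 : e₁ ≠ 0 := fun h => by simp [h] at he₁
  have he₂0 : e₂ ≠ 0 := fun h => by simp [h] at he₂
  refine ⟨_, hsum, fun B => ?_⟩
  set P : ℕ → Mat := fun n => emb j B (e₁ * X n) (e₂ * -(k * X n)) with hP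
  -- The size bound records that step n produces only matrices of size comparable to X n, as the
  -- tail estimate needs.
  set K : ℕ → Set Mat := fun n =>
    {A | ∃ u, u ≠ 0 ∧ A = emb j B (e₁ * u) (e₂ * g u) ∧ |u| + |g u| ≤ 4 * X n} with hK
  have hred : ∀ n, Reduces α s (P n) (K n ∪ {P (n + 1)}) (fun _ : Unit => {P (n + 1)})
      (fun _ => ENNReal.ofReal ((X n / X (n + 1)) ^ q)) (ENNReal.ofReal (7 * X n)) := by
    intro n
    obtain ⟨a1, a2, a3, a4⟩ := hstep n
    obtain ⟨b1, b2, b3⟩ := hhit _ (hXge n)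
    have hx := hXpos n
    have hx' := hXpos (n + 1)
    set x := X n
    set x' := X (n + 1)
    set h := hit x
    have hxx' : x < x' := by nlinarith
    have hx'2 : x' ≤ 2 * x := by nlinarith
    have hkx : k * x ≤ x := by nlinarith
    have hkx0 : 0 < k * x := by positivity
    have hkx' : k * x' ≤ x' := by nlinarith
    have hkx'0 : 0 < k * x' := by positivity
    have hkxx : k * x < k * x' := by nlinarith
    have hcx' : g x' ≤ x' := by nlinarith
    -- Landing on the graph: no further perturbation, and no mass at the next corner, from which the
    -- abscissa -h < 0 < x' differs.
    have m1 : Reduces α s (emb j B (e₁ * -h) (e₂ * -(k * x))) (K n ∪ {P (n + 1)})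
        (fun _ : Unit => {P (n + 1)}) (fun _ => 0) 0 := by
      have hle : |-h| + |g (-h)| ≤ 4 * x := by
        rw [b3, abs_neg, abs_neg, abs_of_pos b1, abs_of_pos hkx0]
        linarith
      refine reduces_of_mem (Or.inl ⟨-h, by linarith, by rw [b3], hle⟩) fun _ hmem => ?_
      have h1 : e₁ * -h = e₁ * x' := (emb_fst j B _ _).symm.trans
        ((congrFun (congrFun hmem 0) j).trans (emb_fst j B _ _))
      have := mul_left_cancel₀ he₁0 h1
      linarith
    have m2 : Reduces α s (emb j B (e₁ * x') (e₂ * g x')) (K n ∪ {P (n + 1)})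
        (fun _ : Unit => {P (n + 1)}) (fun _ => 0) 0 := by
      have hle : |x'| + |g x'| ≤ 4 * x := by
        rw [abs_of_pos hx', abs_of_nonneg a3]
        linarith
      refine reduces_of_mem (Or.inl ⟨x', hx'.ne', rfl, hle⟩) fun _ hmem => ?_
      have h1 : e₂ * g x' = e₂ * -(k * x') := (emb_snd j B _ _).symm.trans
        ((congrFun (congrFun hmem 1) (j + 1)).trans (emb_snd j B _ _))
      have := mul_left_cancel₀ he₂0 h1
      linarith
    have m3 : Reduces α s (emb j B (e₁ * x') (e₂ * -(k * x'))) (K n ∪ {P (n + 1)})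
        (fun _ : Unit => {P (n + 1)}) (fun _ => 1) 0 :=
      reduces_of_mem (Or.inr rfl) fun _ _ => le_rfl
    -- Barycentric weights: this one for the vertical splitting of (x', -kx) into (x', g x') and
    -- (x', -kx'), `hla0` below for the horizontal splitting of (x, -kx) into (-h, -kx) and (x',
    -- -kx).
    have hmu0 : 0 < (k * x' - k * x) / (g x' + k * x') := div_pos (by linarith) (by linarith)
    have hmu : 1 - (k * x' - k * x) / (g x' + k * x') = (g x' + k * x) / (g x' + k * x') := by
      rw [eq_div_iff (by linarith), sub_mul, div_mul_cancel₀ _ (by linarith)]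
      ring
    have hmu1 : (k * x' - k * x) / (g x' + k * x') < 1 := by
      have : 0 < (g x' + k * x) / (g x' + k * x') := div_pos (by linarith) (by linarith)
      linarith
    have m4 := Reduces.split_snd hα0 hα1 hs hmu0 hmu1 (v := e₂ * -(k * x))
      (fun h => by
        have := mul_left_cancel₀ he₂0 h
        linarith)
      (by
        rw [hmu]
        field_simp
        ring) ENNReal.zero_ne_top ENNReal.zero_ne_top m2 m3
    have hla0 : 0 < (x' - x) / (x' + h) := div_pos (by linarith) (by linarith)
    have hla : 1 - (x' - x) / (x' + h) = (x + h) / (x' + h) := by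
      rw [eq_div_iff (by linarith), sub_mul, div_mul_cancel₀ _ (by linarith)]
      ring
    have hla1 : (x' - x) / (x' + h) < 1 := by
      have : 0 < (x + h) / (x' + h) := div_pos (by linarith) (by linarith)
      linarith
    have m5 := Reduces.split_fst hα0 hα1 hs hla0 hla1 (u := e₁ * x)
      (fun h => by
        have := mul_left_cancel₀ he₁0 h
        linarith)
      (by
        rw [hla]
        field_simp
        ring) ENNReal.zero_ne_top (by simp) m1 m4
    refine m5.mono Subset.rfl (fun _ => ?_) ?_
    · rw [mul_zero, mul_zero, zero_add, zero_add, mul_one, hla, hmu,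
        ← ENNReal.ofReal_mul (div_nonneg (by linarith) (by linarith))]
      exact ENNReal.ofReal_le_ofReal (staircase_mass_le hk hc hδ hx hxx' a2 b1 b2 a3 a4)
    · rw [add_zero, add_zero, zero_add, ← mul_sub, ← mul_sub, Real.enorm_eq_ofReal_abs,
        Real.enorm_eq_ofReal_abs, habs1, habs2,
        ← ENNReal.ofReal_add (abs_nonneg _) (abs_nonneg _)]
      refine ENNReal.ofReal_le_ofReal ?_
      -- The total displacement is (h + x') + (g x' + kx') ≤ 3x + 4x, using x' ≤ 2x.
      rw [abs_of_neg (by linarith), abs_of_nonneg (by linarith)]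
      linarith
  have hfinal := Reduces.iterate hα0 (P := P) (K := K)
    (β := fun n => ENNReal.ofReal ((X n / X (n + 1)) ^ q))
    (c := fun n => ENNReal.ofReal (7 * X n)) (fun _ => ENNReal.ofReal_ne_top) hred (B := Bd)
    (by rw [hBd]; simp [hX0, div_self hx₀.ne'])
    (fun n => by
      have h1 := hXpos n
      have h2 := hXpos (n + 1)
      simp only [hBd]
      rw [← ENNReal.ofReal_mul (by positivity), ← Real.mul_rpow (by positivity) (by positivity)]
      congr 2
      field_simp)
    hBlim hsum (S := largePair j) (F := fun t => ENNReal.ofReal ((4 * x₀ / t.1) ^ q)) ?_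
  · refine hfinal.mono ?_ (fun _ => le_rfl) le_rfl
    rintro A hA
    obtain ⟨n, u, hu, rfl, _⟩ := mem_iUnion.1 hA
    exact ⟨u, hu, rfl⟩
  · rintro ⟨t, ht⟩
    have ht0 : 0 < t := ht
    have hex : ∃ n, t < 4 * X n := by
      obtain ⟨n, hn⟩ := pow_unbounded_of_one_lt (t / x₀) (by linarith : 1 < 1 + δ / 2)
      rw [div_lt_iff₀ hx₀] at hn
      exact ⟨n, by linarith [hgrow n, hXpos n]⟩
    -- Before the first n with t < 4 X n only matrices of size at most t are produced; and x₀ / X n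
    -- ≤ 4x₀ / t for this n.
    refine ⟨Nat.find hex, fun m hm => disjoint_left.2 ?_, ?_⟩
    · rintro A ⟨u, hu, rfl, hle⟩ hA
      have := Nat.find_min hex hm
      simp only [largePair, mem_ofPred_eq, emb_fst, emb_snd, habs1, habs2] at hA
      linarith
    · have hn := Nat.find_spec hex
      set n := Nat.find hex
      refine ENNReal.ofReal_le_ofReal (Real.rpow_le_rpow (hr0 n).le ?_ (by linarith))
      rw [div_le_div_iff₀ (hXpos n) ht0]
      nlinarith

/-! ### The oscillating nonlinearity -/

/-- The scalar nonlinearity `t (1 + τ sin (π t))`. -/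
def oscillation (τ t : ℝ) : ℝ := t * (1 + τ * Real.sin (Real.pi * t))

lemma oscillation_neg (τ t : ℝ) : oscillation τ (-t) = -oscillation (-τ) t := by
  simp only [oscillation, mul_neg, Real.sin_neg]
  ring

lemma oscillation_natCast (τ : ℝ) (N : ℕ) : oscillation τ N = N := by
  rw [oscillation, mul_comm Real.pi, Real.sin_nat_mul_pi]
  ring

lemma exists_sin_eq (a x : ℝ) :
    ∃ z, x ≤ z ∧ z ≤ x + 2 ∧ Real.sin (Real.pi * z) = Real.sin (Real.pi * a) := by
  refine ⟨a + 2 * ⌈(x - a) / 2⌉, ?_, ?_, ?_⟩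
  · linarith [Int.le_ceil ((x - a) / 2)]
  · linarith [Int.ceil_lt_add_one ((x - a) / 2)]
  · rw [show Real.pi * (a + 2 * ⌈(x - a) / 2⌉) = Real.pi * a + ⌈(x - a) / 2⌉ * (2 * Real.pi) by ring,
      Real.sin_add_int_mul_two_pi]

lemma exists_mul_sin_eq (τ x : ℝ) :
    ∃ z, x ≤ z ∧ z ≤ x + 2 ∧ τ * Real.sin (Real.pi * z) = -|τ| := by
  rcases le_total 0 τ with h | h
  · obtain ⟨z, h1, h2, h3⟩ := exists_sin_eq (-(1 / 2)) x
    refine ⟨z, h1, h2, ?_⟩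
    rw [h3, show Real.pi * -(1 / 2) = -(Real.pi / 2) by ring, Real.sin_neg, Real.sin_pi_div_two,
      abs_of_nonneg h]
    ring
  · obtain ⟨z, h1, h2, h3⟩ := exists_sin_eq (1 / 2) x
    refine ⟨z, h1, h2, ?_⟩
    rw [h3, show Real.pi * (1 / 2) = Real.pi / 2 by ring, Real.sin_pi_div_two, abs_of_nonpos h]
    ring

/-- Within one period, of length 2, the sine term reaches its minimum -|τ|, where the slope is 1 -
|τ| ≤ 1 - σ. -/
lemma exists_oscillation_small {τ σ x : ℝ} (hσ : σ ≤ |τ|) (hτ : |τ| ≤ 1) (hx : 0 ≤ x) :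
    ∃ x', x ≤ x' ∧ x' ≤ x + 2 ∧ 0 ≤ oscillation τ x' ∧ oscillation τ x' ≤ (1 - σ) * x' := by
  obtain ⟨z, h1, h2, h3⟩ := exists_mul_sin_eq τ x
  have hz : 0 ≤ z := hx.trans h1
  refine ⟨z, h1, h2, ?_, ?_⟩
  · rw [oscillation, h3]
    exact mul_nonneg hz (by linarith)
  · rw [oscillation, h3]
    nlinarith

/-- On the negative half-line the sine enters with the opposite sign. In the window from y - 2 to y
there is a crest, where the modulus is at least (y - 2)(1 + σ) ≥ y once yσ ≥ 4; the intermediate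
value theorem gives h. -/
lemma exists_oscillation_hit {τ σ y : ℝ} (hσ0 : 0 < σ) (hσ1 : σ < 1) (hσ : σ ≤ |τ|)
    (hy : 4 / σ ≤ y) : ∃ h, 0 < h ∧ h ≤ y ∧ oscillation τ (-h) = -y := by
  have hy4 : 4 ≤ y * σ := by rwa [div_le_iff₀ hσ0] at hy
  have hy2 : 2 ≤ y := by nlinarith
  obtain ⟨z, h1, h2, h3⟩ := exists_mul_sin_eq τ (y - 2)
  have hz0 : 0 ≤ z := by linarith
  have hcont : Continuous (oscillation (-τ)) := by
    unfold oscillation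
    fun_prop
  have h0 : oscillation (-τ) 0 = 0 := by simp [oscillation]
  have hzy : y ≤ oscillation (-τ) z := by
    have : oscillation (-τ) z = z * (1 + |τ|) := by
      rw [oscillation, neg_mul, h3]
      ring
    rw [this]
    nlinarith
  obtain ⟨h, ⟨hh0, hhz⟩, hh⟩ := intermediate_value_Icc hz0 hcont.continuousOn
    (show y ∈ Icc (oscillation (-τ) 0) (oscillation (-τ) z) from ⟨by rw [h0]; linarith, hzy⟩)
  refine ⟨h, lt_of_le_of_ne hh0 ?_, by linarith, by rw [oscillation_neg, hh]⟩
  rintro rfl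
  rw [h0] at hh
  linarith

/-! ### Reducing one pair of entries, then both -/

/-- The matrices which agree with `B` off the entries `(0, j)` and `(1, j + 1)`, while these are
related by the nonlinearity. -/
def pairGood (τ e : ℝ) (j : Fin 2) (B : Mat) : Set Mat :=
  {A | ∃ u, u ≠ 0 ∧ A = emb j B u (e * oscillation τ u)}

lemma ofReal_mul_add_ofReal_one_sub_mul {lam : ℝ} (h0 : 0 < lam) (h1 : lam < 1) (F : ℝ≥0∞) :
    ENNReal.ofReal lam * F + ENNReal.ofReal (1 - lam) * F = F := by
  rw [← add_mul, ← ENNReal.ofReal_add h0.le (by linarith)]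
  simp

/-- Every pair of entries can be reduced to the graph of the nonlinearity. -/
theorem reduces_pairGood {k q σ : ℝ} (hk : 0 < k) (hk1 : k ≤ 1) (hq : 1 < q) (hσ0 : 0 < σ)
    (hσ1 : σ < 1) (hqk : q < 1 / (1 + k) + k / (1 - σ + k)) :
    ∃ R : ℝ, 0 < R ∧ ∀ τ : ℝ, σ ≤ |τ| → |τ| ≤ 1 → ∀ {α s : ℝ}, 0 < α → α < 1 → 0 ≤ s →
      ∀ e : ℝ, |e| = 1 → ∀ (j : Fin 2) (x z : ℝ) (N : ℕ), R ≤ N → |x| < N → |z| < k * N →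
      ∃ C : ℝ≥0∞, C ≠ ⊤ ∧ ∀ B : Mat, Reduces α s (emb j B x z) (pairGood τ e j B) (largePair j)
        (fun t => ENNReal.ofReal ((4 * N / t.1) ^ q)) C := by
  obtain ⟨δ, hδ0, hδ1, hδ⟩ := exists_step_size hk (by linarith : 0 < 1 - σ) hqk
  -- The first term makes kN large enough to hit the graph on the opposite side; the second makes N
  -- large enough for the staircase steps.
  refine ⟨max (4 / σ / k) (4 / δ), lt_max_of_lt_left (by positivity), ?_⟩
  intro τ hτσ hτ1 α s hα0 hα1 hs e he j x z N hN hxN hzN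
  have hN1 : 4 / σ ≤ k * N := by
    have := (le_max_left _ _).trans hN
    rw [div_le_iff₀ hk] at this
    linarith
  have hN2 : 4 / δ ≤ N := (le_max_right _ _).trans hN
  have hN0 : (0 : ℝ) < N := lt_of_lt_of_le (by positivity) hN2
  have hkN0 : 0 < k * N := by positivity
  have hkN : k * N ≤ N := by nlinarith
  have stair : ∀ τ' e₁ e₂ : ℝ, |τ'| = |τ| → |e₁| = 1 → |e₂| = 1 →
      ∃ C : ℝ≥0∞, C ≠ ⊤ ∧ ∀ B : Mat, Reduces α s (emb j B (e₁ * N) (e₂ * -(k * N)))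
        {A | ∃ u, u ≠ 0 ∧ A = emb j B (e₁ * u) (e₂ * oscillation τ' u)} (largePair j)
        (fun t => ENNReal.ofReal ((4 * N / t.1) ^ q)) C := by
    intro τ' e₁ e₂ hτ' he₁ he₂
    refine reduces_staircase hα0 hα1 hs hk hk1 (c := 1 - σ) (by linarith) (by linarith) hq hδ0 hδ1 hδ
      (R := 4 / σ) (fun y hy => exists_oscillation_hit hσ0 hσ1 (by rwa [hτ']) hy)
      (fun x hx => exists_oscillation_small (by rwa [hτ']) (by rwa [hτ'])
        (le_trans (by positivity) hx)) he₁ he₂ j hN0 hN1 hN2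
  obtain ⟨C₁, hC₁, stair₁⟩ := stair τ 1 e rfl (by simp) he
  -- The staircase to the left is the reflection through the origin of a staircase to the right for
  -- -τ.
  obtain ⟨C₂, hC₂, stair₂⟩ := stair (-τ) (-1) (-e) (by simp) (by simp) (by simpa using he)
  have he2 : e * e = 1 := by rw [← abs_mul_abs_self, he, one_mul]
  have he0 : e ≠ 0 := fun h => by simp [h] at he
  obtain ⟨hx1, hx2⟩ := abs_lt.1 hxN
  have hez : |e * z| < k * N := by rwa [abs_mul, he, one_mul]
  obtain ⟨hz1, hz2⟩ := abs_lt.1 hez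
  have hone : ∀ A : Mat, |A 0 j| + |A 1 (j + 1)| ≤ 4 * N → ∀ t : Ioi (0 : ℝ),
      A ∈ largePair j t → 1 ≤ ENNReal.ofReal ((4 * N / t.1) ^ q) := by
    intro A hA t ht
    have ht0 : 0 < t.1 := t.2
    have ht' : t.1 < |A 0 j| + |A 1 (j + 1)| := ht
    rw [← ENNReal.ofReal_one]
    refine ENNReal.ofReal_le_ofReal (Real.one_le_rpow ?_ (by linarith))
    rw [le_div_iff₀ ht0]
    linarith
  -- Split (x, z) horizontally between abscissas N and -N, then each half vertically between (±N,
  -- ±eN), which lies on the graph as sin vanishes at multiples of π, and the staircase corner (±N,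
  -- ∓ekN).
  set lam := (x + N) / (2 * N) with hlam
  have hlam0 : 0 < lam := div_pos (by linarith) (by linarith)
  have hlam1 : lam < 1 := by rw [hlam, div_lt_one (by linarith)]; linarith
  set mu := (e * z + k * N) / (N + k * N) with hmu
  have hmu0 : 0 < mu := div_pos (by linarith) (by linarith)
  have hmu1 : mu < 1 := by rw [hmu, div_lt_one (by linarith)]; linarith
  set nu := (k * N - e * z) / (N + k * N) with hnu
  have hnu0 : 0 < nu := div_pos (by linarith) (by linarith)
  have hnu1 : nu < 1 := by rw [hnu, div_lt_one (by linarith)]; linarith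
  have hmuE : mu * (N + k * N) = e * z + k * N := div_mul_cancel₀ _ (by linarith)
  have hnuE : nu * (N + k * N) = k * N - e * z := div_mul_cancel₀ _ (by linarith)
  have hlamE : lam * (2 * N) = x + N := div_mul_cancel₀ _ (by linarith)
  refine ⟨‖(N : ℝ) - -N‖ₑ + ((‖e * N - e * -(k * N)‖ₑ + (0 + C₁)) +
    (‖e * -N - e * (k * N)‖ₑ + (0 + C₂))), by simp [hC₁, hC₂], fun B => ?_⟩
  have g1 : Reduces α s (emb j B N (e * N)) (pairGood τ e j B) (largePair j)
      (fun t => ENNReal.ofReal ((4 * N / t.1) ^ q)) 0 := by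
    refine reduces_of_mem (show _ ∈ pairGood τ e j B from
      ⟨N, hN0.ne', by rw [oscillation_natCast]⟩) (hone _ ?_)
    rw [emb_fst, emb_snd, abs_mul, he, abs_of_pos hN0]
    linarith
  have g2 : Reduces α s (emb j B (-N) (e * -N)) (pairGood τ e j B) (largePair j)
      (fun t => ENNReal.ofReal ((4 * N / t.1) ^ q)) 0 := by
    refine reduces_of_mem (show _ ∈ pairGood τ e j B from
      ⟨-N, by linarith, by rw [oscillation_neg, oscillation_natCast]⟩) (hone _ ?_)
    rw [emb_fst, emb_snd, abs_mul, he, abs_neg, abs_of_pos hN0]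
    linarith
  have s1 : Reduces α s (emb j B N (e * -(k * N))) (pairGood τ e j B) (largePair j)
      (fun t => ENNReal.ofReal ((4 * N / t.1) ^ q)) C₁ := by
    have := stair₁ B
    rw [one_mul] at this
    refine this.mono ?_ (fun _ => le_rfl) le_rfl
    rintro A ⟨u, hu, rfl⟩
    exact ⟨u, hu, by rw [one_mul]⟩
  have s2 : Reduces α s (emb j B (-N) (e * (k * N))) (pairGood τ e j B) (largePair j)
      (fun t => ENNReal.ofReal ((4 * N / t.1) ^ q)) C₂ := by
    have := stair₂ B
    rw [neg_one_mul, neg_mul_neg] at this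
    refine this.mono ?_ (fun _ => le_rfl) le_rfl
    rintro A ⟨u, hu, rfl⟩
    exact ⟨-u, neg_ne_zero.2 hu, by rw [oscillation_neg, neg_one_mul, neg_mul, mul_neg]⟩
  have t1 := Reduces.split_snd hα0 hα1 hs hmu0 hmu1 (v := z)
    (fun h => by
      have := mul_left_cancel₀ he0 h
      linarith)
    (by
      have : e * (e * z) = e * (mu * (N + k * N) - k * N) := by rw [hmuE]; ring
      rw [← mul_assoc, he2, one_mul] at this
      rw [this]
      ring) ENNReal.zero_ne_top hC₁ g1 s1
  have t2 := Reduces.split_snd hα0 hα1 hs hnu0 hnu1 (v := z)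
    (fun h => by
      have := mul_left_cancel₀ he0 h
      linarith)
    (by
      have : e * (e * z) = e * (k * N - nu * (N + k * N)) := by rw [hnuE]; ring
      rw [← mul_assoc, he2, one_mul] at this
      rw [this]
      ring) ENNReal.zero_ne_top hC₂ g2 s2
  have t3 := Reduces.split_fst hα0 hα1 hs hlam0 hlam1 (u := x) (by linarith)
    (by linarith) (by simp [hC₁]) (by simp [hC₂]) t1 t2
  refine t3.mono Subset.rfl (fun t => ?_) le_rfl
  rw [ofReal_mul_add_ofReal_one_sub_mul hmu0 hmu1, ofReal_mul_add_ofReal_one_sub_mul hnu0 hnu1,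
    ofReal_mul_add_ofReal_one_sub_mul hlam0 hlam1]

/-- The signs come from `matJ`: the pair on the diagonal satisfies x₄ = -a(x₁), the other one x₃ =
a(x₂). -/
lemma emb_mem_goodSet {θ u v : ℝ} {M : Mat} (hu : u ≠ 0) (hv : v ≠ 0) :
    emb 1 (emb 0 M u (-1 * oscillation (√θ) u)) v (1 * oscillation (√θ) v) ∈ goodSet θ := by
  refine ⟨?_, ?_, ?_⟩
  · simpa [emb] using hu
  · simpa [emb] using hv
  · ext i
    fin_cases i <;> simp [emb, fieldA, matJ, oscillation]

/-- A reduction in the pair of entries `1` keeps the pair of entries `0`. -/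
lemma ReducesOn.of_pairGood {α s τ e η : ℝ} {Ω : Set Plane} {X : Mat} {c : ℝ≥0∞}
    {F : Ioi (0 : ℝ) → ℝ≥0∞}
    (h : ReducesOn α s Ω X (pairGood τ e 1 X) (largePair 1) F c η) :
    ReducesOn α s Ω X (pairGood τ e 1 X) (fun i : Fin 2 × Ioi (0 : ℝ) => largePair i.1 i.2)
      (fun i => if i.1 = 0 then (largePair 0 i.2).indicator 1 X else F i.2) c η := by
  obtain ⟨f, Df, 𝒰, E, hf, hE, hsub, hcov, hval, hErr, hS, hL⟩ := h
  refine ⟨f, Df, 𝒰, E, hf, hE, hsub, hcov, hval, hErr, ?_, hL⟩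
  rintro ⟨p, t⟩
  by_cases hp : p = 0
  · subst hp
    have hiff : ∀ x ∈ Ω \ E, (X + Df x ∈ largePair 0 t ↔ X ∈ largePair 0 t) := by
      intro x hx
      obtain ⟨u, -, hu⟩ := hval x hx
      rw [hu]
      simp [largePair, emb]
    simp only [if_true]
    by_cases hX : X ∈ largePair 0 t
    · rw [indicator_of_mem hX, Pi.one_apply, one_mul]
      exact measure_mono fun x hx => hx.1.1
    · have : {x ∈ Ω \ E | X + Df x ∈ largePair 0 t} = ∅ :=
        eq_empty_of_forall_notMem fun x hx => hX ((hiff x hx.1).1 hx.2)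
      simp only [this, measure_empty, zero_le]
  · have hp1 : p = 1 := by omega
    subst hp1
    simpa using hS t

/-- Every matrix can be reduced to the good set. -/
theorem reduces_goodSet {k q σ : ℝ} (hk : 0 < k) (hk1 : k ≤ 1) (hq : 1 < q) (hσ0 : 0 < σ)
    (hσ1 : σ < 1) (hqk : q < 1 / (1 + k) + k / (1 - σ + k)) :
    ∃ C : ℝ, 0 < C ∧ ∀ θ : ℝ, σ ≤ √θ → √θ ≤ 1 → ∀ {α s : ℝ}, 0 < α → α < 1 → 0 ≤ s → ∀ M : Mat,
      ∃ c : ℝ≥0∞, Reduces α s M (goodSet θ)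
        (fun i : Fin 2 × Ioi (0 : ℝ) => largePair i.1 i.2)
        (fun i => ENNReal.ofReal ((C * (1 + matNorm M) / i.2.1) ^ q)) c := by
  obtain ⟨R, hR, hred⟩ := reduces_pairGood hk hk1 hq hσ0 hσ1 hqk
  refine ⟨4 * (R + 1 + 1 / k), by positivity, ?_⟩
  intro θ hθσ hθ1 α s hα0 hα1 hs M
  have hm : 0 ≤ matNorm M := matNorm_nonneg M
  -- Large enough for kN to exceed the norm of M, yet bounded by a multiple of 1 + |M|, which gives
  -- the right dependence on M in the weak bound.
  set N : ℕ := ⌈R + (matNorm M + 1) / k⌉₊ with hN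
  have hN1 : R + (matNorm M + 1) / k ≤ N := Nat.le_ceil _
  have hN2 : (N : ℝ) < R + (matNorm M + 1) / k + 1 := Nat.ceil_lt_add_one (by positivity)
  have hkm : matNorm M < k * N := by
    have : (matNorm M + 1) / k ≤ N := by linarith
    rw [div_le_iff₀ hk] at this
    linarith
  have hRN : R ≤ N := by
    have : 0 ≤ (matNorm M + 1) / k := by positivity
    linarith
  have hN0 : (0 : ℝ) < N := by linarith
  have hmN : matNorm M < N := by nlinarith
  have hlt : ∀ i j, |M i j| < N := fun i j => (abs_entry_le_matNorm M i j).trans_lt hmN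
  have hltk : ∀ i j, |M i j| < k * N := fun i j => (abs_entry_le_matNorm M i j).trans_lt hkm
  have hθ0 : |√θ| = √θ := abs_of_nonneg (Real.sqrt_nonneg θ)
  obtain ⟨c₁, -, h₁⟩ := hred (√θ) (by rwa [hθ0]) (by rwa [hθ0]) hα0 hα1 hs (-1) (by simp) 0
    (M 0 0) (M 1 1) N hRN (hlt _ _) (hltk _ _)
  -- The first reduction leaves the entries (0, 1) and (1, 0) unchanged, so this single constant
  -- serves all the gradients it produces.
  obtain ⟨c₂, hc₂, h₂⟩ := hred (√θ) (by rwa [hθ0]) (by rwa [hθ0]) hα0 hα1 hs 1 (by simp) 1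
    (M 0 1) (M 1 0) N hRN (hlt _ _) (hltk _ _)
  have hbound : ∀ t : Ioi (0 : ℝ), ENNReal.ofReal ((4 * N / t.1) ^ q) ≤
      ENNReal.ofReal ((4 * (R + 1 + 1 / k) * (1 + matNorm M) / t.1) ^ q) := by
    intro t
    have ht : 0 < t.1 := t.2
    refine ENNReal.ofReal_le_ofReal (Real.rpow_le_rpow (by positivity) ?_ (by linarith))
    have : (N : ℝ) ≤ (R + 1 + 1 / k) * (1 + matNorm M) := by
      have h : (R + 1 + 1 / k) * (1 + matNorm M) =
        R + (matNorm M + 1) / k + 1 + (R + 1) * matNorm M := by ring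
      have : 0 ≤ (R + 1) * matNorm M := by positivity
      linarith
    refine div_le_div_of_nonneg_right ?_ ht.le
    linarith
  refine ⟨c₁ + c₂, fun Ω hΩ η hη => ?_⟩
  have h₁M := h₁ M
  rw [show emb 0 M (M 0 0) (M 1 1) = M from emb_self 0 M] at h₁M
  obtain ⟨f, Df, 𝒰, E, hf, hE, hsub, hcov, hval, hErr, hS, hL⟩ := h₁M Ω hΩ (η / 3) (by linarith)
  have hmeas : MeasurableSet (Ω \ E) := by
    refine hf.measurableSet_of_subordinate hcov fun U hU => ?_
    rcases hsub U hU with h | h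
    · exact Or.inr (disjoint_left.2 fun x hx hx' => hx'.2 (h hx))
    · exact Or.inl fun x hx => ⟨hf.subset U hU hx, fun hE => h.le_bot ⟨hx, hE⟩⟩
  refine hf.reducesOn (η := η / 3) (η₁ := η / 3) (K := fun X => pairGood (√θ) 1 1 X)
    (F := fun X i => if i.1 = 0 then (largePair 0 i.2).indicator 1 X else
      ENNReal.ofReal ((4 * N / i.2.1) ^ q)) hα0 (by linarith) (by linarith) hΩ hE hsub hcov hErr
    hL hc₂ ?_ ?_ ?_ (by linarith) (by linarith)
  · intro U hU hUE x hx
    refine ReducesOn.of_pairGood (F := fun t => ENNReal.ofReal ((4 * N / t.1) ^ q)) ?_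
    have h := h₂ (M + Df x)
    have h01 : (M + Df x) 0 1 = M 0 1 ∧ (M + Df x) 1 0 = M 1 0 := by
      obtain ⟨u, -, hu⟩ := hval x (hUE hx)
      rw [hu]
      exact ⟨emb_other_fst 0 M u _, emb_other_snd 0 M u _⟩
    rw [← h01.1, ← h01.2, show emb 1 (M + Df x) ((M + Df x) 0 1) ((M + Df x) 1 0) = M + Df x from
      emb_self 1 _] at h
    exact h U (hf.regular U hU) _ (by linarith)
  · intro x hx A hA
    obtain ⟨u, hu, hux⟩ := hval x hx
    obtain ⟨v, hv, rfl⟩ := hA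
    rw [hux]
    exact emb_mem_goodSet hu hv
  · rintro ⟨p, t⟩
    refine le_trans ?_ (mul_le_mul_left (hbound t) (volume Ω))
    by_cases hp : p = 0
    · subst hp
      simp only [if_true]
      refine le_trans ?_ (hS t)
      calc ∫⁻ x in Ω \ E, (largePair 0 t).indicator 1 (M + Df x)
          = ∫⁻ x in Ω \ E, {x | M + Df x ∈ largePair 0 t}.indicator 1 x := rfl
        _ ≤ (volume.restrict (Ω \ E)) {x | M + Df x ∈ largePair 0 t} := lintegral_indicator_one_le _
        _ ≤ _ := by
            rw [Measure.restrict_apply' hmeas]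
            exact measure_mono fun x hx => ⟨hx.2, hx.1⟩
    · simp only [hp, if_false, lintegral_const, Measure.restrict_apply_univ]
      exact mul_le_mul_right (measure_mono sdiff_subset) _

/-! ### Uniformity in θ -/

/-- For fixed q and L, the condition on θ is a lower bound θ > σ₂, with q_L = q at θ = σ₂. The
staircase sees the amplitude √θ ≥ √σ₂ > σ₂, so σ = √σ₂ satisfies the strict inequality with a margin
that does not depend on θ. -/
lemma exists_amplitude_bound {q : ℝ} {L : ℕ} (hL : 0 < L) (hq : 1 < q)
    (h : ∃ θ ∈ Ioo (0 : ℝ) 1, q < qExp θ L) :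
    ∃ σ : ℝ, 0 < σ ∧ σ < 1 ∧ q < 1 / (1 + 1 / (L : ℝ)) + 1 / (L : ℝ) / (1 - σ + 1 / (L : ℝ)) ∧
      ∀ θ ∈ Ioo (0 : ℝ) 1, q < qExp θ L → σ ≤ √θ := by
  have hL0 : (0 : ℝ) < L := by exact_mod_cast hL
  set u := q - 1 + 1 / (1 + (L : ℝ)) with hu
  have hu0 : 1 / (1 + (L : ℝ)) < u := by linarith
  have hup : 0 < u := lt_trans (by positivity) hu0
  have key : ∀ θ ∈ Ioo (0 : ℝ) 1, q < qExp θ L → 1 + L * (1 - θ) < 1 / u := by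
    intro θ hθ h
    have hp : 0 < 1 + (L : ℝ) * (1 - θ) := by
      have : 0 ≤ (L : ℝ) * (1 - θ) := mul_nonneg hL0.le (by linarith [hθ.2])
      linarith
    rw [lt_one_div hp hup]
    rw [qExp] at h
    linarith
  set σ₂ := 1 - (1 / u - 1) / L with hσ₂
  have hmul : L * (1 - σ₂) = 1 / u - 1 := by rw [hσ₂]; field_simp; ring
  have hlow : ∀ θ ∈ Ioo (0 : ℝ) 1, q < qExp θ L → σ₂ ≤ θ := by
    intro θ hθ h
    have := key θ hθ h
    by_contra! hc
    have : (L : ℝ) * (1 - σ₂) ≤ L * (1 - θ) := mul_le_mul_of_nonneg_left (by linarith) hL0.le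
    nlinarith
  have hσ0 : 0 < σ₂ := by
    have : 1 / u < 1 + L := by rwa [one_div_lt hup (by positivity)]
    have : (1 / u - 1) / L < 1 := by rw [div_lt_one hL0]; linarith
    linarith
  have hσ1 : σ₂ < 1 := by
    obtain ⟨θ, hθ, h⟩ := h
    linarith [hlow θ hθ h, hθ.2]
  have hs0 : 0 < √σ₂ := Real.sqrt_pos.2 hσ0
  have hs1 : √σ₂ < 1 := by rw [Real.sqrt_lt' one_pos]; simpa using hσ1
  have hs2 : σ₂ < √σ₂ := by
    have := Real.mul_self_sqrt hσ0.le
    nlinarith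
  refine ⟨√σ₂, hs0, hs1, ?_, fun θ hθ h => Real.sqrt_le_sqrt (hlow θ hθ h)⟩
  have e1 : 1 / (1 + 1 / (L : ℝ)) = 1 - 1 / (1 + L) := by field_simp; ring
  have e2 : 1 / (L : ℝ) / (1 - √σ₂ + 1 / (L : ℝ)) = 1 / (1 + L * (1 - √σ₂)) := by
    have : 0 < 1 - √σ₂ := by linarith
    field_simp
    ring
  have e3 : u < 1 / (1 + L * (1 - √σ₂)) := by
    rw [lt_one_div hup (by nlinarith)]
    nlinarith
  rw [e1, e2]
  linarith

/-! ### From reductions to Sobolev maps with weak bounds -/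

section AffineMap

variable {α H : ℝ} {Ω : Set Plane} {f : Plane → Plane} {Df : Plane → Mat} {𝒰 : Set (Set Plane)}

lemma continuous_affineMap (M : Mat) (b : Plane) : Continuous (affineMap M b) :=
  (LinearMap.continuous_of_finiteDimensional (Matrix.toEuclideanLin M)).add continuous_const

lemma fderiv_affineMap_entry (M : Mat) (b : Plane) (i j : Fin 2) (x : Plane) :
    DifferentiableAt ℝ (fun x => affineMap M b x i) x ∧
      fderiv ℝ (fun x => affineMap M b x i) x (EuclideanSpace.single j 1) = M i j := by
  have h : HasFDerivAt (fun x => affineMap M b x i)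
      ((EuclideanSpace.proj (𝕜 := ℝ) i).comp
        (LinearMap.toContinuousLinearMap (Matrix.toEuclideanLin M))) x := by
    have := ((EuclideanSpace.proj (𝕜 := ℝ) i).comp
      (LinearMap.toContinuousLinearMap (Matrix.toEuclideanLin M))).hasFDerivAt (x := x)
    exact this.add_const (b i)
  refine ⟨h.differentiableAt, ?_⟩
  rw [h.fderiv]
  simp [Matrix.toLpLin_apply]

lemma integral_affineMap_mul_fderiv (M : Mat) (b : Plane) {φ : Plane → ℝ} (hφ : ContDiff ℝ ∞ φ)
    (hc : HasCompactSupport φ) (i j : Fin 2) :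
    ∫ x, affineMap M b x i * fderiv ℝ φ x (EuclideanSpace.single j 1) = -∫ x, M i j * φ x := by
  have hcont := continuous_entry (continuous_affineMap M b) i
  rw [integral_mul_fderiv_eq_neg_fderiv_mul_of_integrable]
  · simp only [(fderiv_affineMap_entry M b i j _).2]
  · simp only [(fderiv_affineMap_entry M b i j _).2]
    exact (hφ.continuous.integrable_of_hasCompactSupport hc).const_mul _
  · exact (hcont.mul (continuous_fderiv_apply_of_contDiff hφ _)).integrable_of_hasCompactSupport
      (hasCompactSupport_fderiv_apply' hc _).mul_left
  · exact (hcont.mul hφ.continuous).integrable_of_hasCompactSupport hc.mul_left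
  · exact fun x _ => (fderiv_affineMap_entry M b i j x).1
  · exact fun x _ => (hφ.differentiable (by simp)) x

lemma IsPerturbation.isW11WithGradient (hα : 0 < α) (hΩ : IsRegularDomain Ω)
    (hf : IsPerturbation α Ω f Df H 𝒰) (M : Mat) (b : Plane) :
    IsW11WithGradient Ω (fun x => affineMap M b x + f x) (fun x => M + Df x) := by
  have hcont := continuous_of_holder hα hf.holder
  have hint : Integrable f := integrable_of_holder hΩ.isBounded hα hf.holder hf.zero
  refine ⟨?_, fun i j => ?_, fun φ hφ hc hsupp i j => ?_⟩
  · exact (((continuous_affineMap M b).add hcont).continuousOn.integrableOn_compact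
      hΩ.isBounded.isCompact_closure).mono_set subset_closure
  · exact (integrableOn_const hΩ.volume_lt_top.ne).add (hf.integrable i j).integrableOn
  · have h0 : ∀ x ∉ Ω, φ x = 0 := fun x hx => image_eq_zero_of_notMem_tsupport fun h => hx (hsupp h)
    have h1 : ∀ x ∉ Ω, fderiv ℝ φ x (EuclideanSpace.single j 1) = 0 := fun x hx => by
      rw [image_eq_zero_of_notMem_tsupport fun h => hx (hsupp (tsupport_fderiv_subset ℝ h))]
      rfl
    rw [setIntegral_eq_integral_of_forall_compl_eq_zero fun x hx => by rw [h1 x hx, mul_zero],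
      setIntegral_eq_integral_of_forall_compl_eq_zero fun x hx => by rw [h0 x hx, mul_zero]]
    have e1 : ∀ x, (affineMap M b x + f x) i * fderiv ℝ φ x (EuclideanSpace.single j 1) =
        affineMap M b x i * fderiv ℝ φ x (EuclideanSpace.single j 1) +
          f x i * fderiv ℝ φ x (EuclideanSpace.single j 1) := fun x => add_mul _ _ _
    have e2 : ∀ x, (M + Df x) i j * φ x = M i j * φ x + Df x i j * φ x := fun x => add_mul _ _ _
    have hD := continuous_fderiv_apply_of_contDiff hφ (EuclideanSpace.single j 1)
    have hDc := hasCompactSupport_fderiv_apply' hc (EuclideanSpace.single j 1)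
    simp only [e1, e2]
    rw [integral_add, integral_add, integral_affineMap_mul_fderiv M b hφ hc, hf.weak φ hφ hc,
      neg_add]
    · exact (hφ.continuous.integrable_of_hasCompactSupport hc).const_mul _
    · exact integrable_mul_test (hf.integrable i j) hφ.continuous hc
    · exact ((continuous_entry (continuous_affineMap M b) i).mul hD).integrable_of_hasCompactSupport
        hDc.mul_left
    · exact integrable_mul_test (Integrable.entry hint i) hD hDc

lemma IsPerturbation.isPiecewiseAffineOn (hf : IsPerturbation α Ω f Df H 𝒰) (M : Mat) (b : Plane) :
    IsPiecewiseAffineOn Ω (fun x => affineMap M b x + f x) := by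
  refine ⟨𝒰, hf.countable, hf.disjoint, fun U hU => ⟨hf.regular U hU, hf.subset U hU, ?_⟩, hf.null⟩
  obtain ⟨Y, c, h⟩ := hf.affine U hU
  exact ⟨M + Y, b + c, fun x hx => by
    simp only [(h x hx).1, affineMap_add]⟩

lemma IsPerturbation.exists_holderOnWith {α : ℝ≥0} (hα1 : α < 1) (hΩ : IsRegularDomain Ω)
    (hH : 0 ≤ H) (hf : IsPerturbation α Ω f Df H 𝒰) (M : Mat) (b : Plane) :
    ∃ H' : ℝ≥0, HolderOnWith H' α (fun x => affineMap M b x + f x) (closure Ω) := by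
  obtain ⟨D, hD⟩ := Metric.isBounded_iff.1 hΩ.isBounded.closure
  have hD0 : 0 ≤ D := by
    obtain ⟨x, hx⟩ := hΩ.isConnected.nonempty.closure
    simpa using hD hx hx
  set A := LinearMap.toContinuousLinearMap (Matrix.toEuclideanLin M)
  have hα' : (0 : ℝ) ≤ 1 - α := by
    have : (α : ℝ) < 1 := hα1
    linarith
  -- On the bounded closure, |x - y| ≤ D^(1-α) |x - y|^α makes the affine part Hölder.
  set H' : ℝ := ‖A‖ * D ^ (1 - (α : ℝ)) + H
  have hH' : 0 ≤ H' := by positivity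
  refine ⟨H'.toNNReal, fun x hx y hy => ?_⟩
  have h1 : ‖affineMap M b x - affineMap M b y‖ ≤ ‖A‖ * D ^ (1 - (α : ℝ)) * ‖x - y‖ ^ (α : ℝ) := by
    have e : affineMap M b x - affineMap M b y = A (x - y) := by
      simp [affineMap, A]
    have hd : ‖x - y‖ ≤ D ^ (1 - (α : ℝ)) * ‖x - y‖ ^ (α : ℝ) := by
      calc ‖x - y‖ = ‖x - y‖ ^ (1 - (α : ℝ) + α) := by rw [sub_add_cancel, Real.rpow_one]
        _ = ‖x - y‖ ^ (1 - (α : ℝ)) * ‖x - y‖ ^ (α : ℝ) :=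
            Real.rpow_add_of_nonneg (norm_nonneg _) hα' α.2
        _ ≤ _ := by
            gcongr
            rw [← dist_eq_norm]
            exact hD hx hy
    rw [e, mul_assoc]
    exact (A.le_opNorm _).trans (mul_le_mul_of_nonneg_left hd (norm_nonneg _))
  have h2 : dist (affineMap M b x + f x) (affineMap M b y + f y) ≤ H' * dist x y ^ (α : ℝ) := by
    rw [dist_eq_norm, dist_eq_norm, add_sub_add_comm, add_mul]
    exact (norm_add_le _ _).trans (add_le_add h1 (hf.holder x y))
  rw [edist_dist, edist_dist, ENNReal.ofReal_rpow_of_nonneg dist_nonneg α.coe_nonneg]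
  refine (ENNReal.ofReal_le_ofReal h2).trans (le_of_eq ?_)
  rw [ENNReal.ofReal_mul hH']
  rfl

lemma IsPerturbation.aemeasurable_matNorm (hf : IsPerturbation α Ω f Df H 𝒰) (M : Mat) :
    AEMeasurable fun x => matNorm (M + Df x) := by
  simp only [matNorm]
  refine AEMeasurable.sqrt (Finset.aemeasurable_fun_sum _ fun i _ =>
    Finset.aemeasurable_fun_sum _ fun j _ => AEMeasurable.pow_const ?_ 2)
  exact (hf.integrable i j).aemeasurable.const_add (M i j)

end AffineMap

lemma one_add_rpow_le {m q : ℝ} (hm : 0 ≤ m) (hq : 0 ≤ q) : (1 + m) ^ q ≤ 2 ^ q * (1 + m ^ q) := by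
  have hmq : 0 ≤ m ^ q := Real.rpow_nonneg hm q
  have h2 : (0 : ℝ) ≤ 2 ^ q := by positivity
  rcases le_total m 1 with h | h
  · calc (1 + m) ^ q ≤ 2 ^ q := Real.rpow_le_rpow (by linarith) (by linarith) hq
      _ ≤ _ := le_mul_of_one_le_right h2 (by linarith)
  · calc (1 + m) ^ q ≤ (2 * m) ^ q := Real.rpow_le_rpow (by linarith) (by linarith) hq
      _ = 2 ^ q * m ^ q := Real.mul_rpow (by norm_num) hm
      _ ≤ _ := mul_le_mul_of_nonneg_left (by linarith) h2

lemma subset_largePair_of_lt_matNorm {t : ℝ} (ht : 0 < t / 2) {A : Mat} (h : t < matNorm A) :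
    A ∈ largePair 0 ⟨t / 2, ht⟩ ∨ A ∈ largePair 1 ⟨t / 2, ht⟩ := by
  by_contra! hc
  obtain ⟨h0, h1⟩ := hc
  simp only [largePair, mem_ofPred_eq, not_lt] at h0 h1
  have := h.trans_le (matNorm_le_absSum A)
  simp only [absSum, Fin.sum_univ_two] at this
  have e : (1 : Fin 2) + 1 = 0 := rfl
  rw [e] at h1
  rw [zero_add] at h0
  linarith

/-- The weak-type bound for the gradient of a reduction. -/
lemma IsPerturbation.volume_lt_matNorm_le {α H s q C m : ℝ} {Ω E : Set Plane} {f : Plane → Plane}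
    {Df : Plane → Mat} {𝒰 : Set (Set Plane)} (hf : IsPerturbation α Ω f Df H 𝒰) {M : Mat}
    (hq : 0 < q) (hqs : q ≤ s) (hC : 0 < C) (hm : 0 ≤ m)
    (hErr : ∫⁻ x in E, ENNReal.ofReal ((1 + matNorm (M + Df x)) ^ s) ≤ volume Ω)
    (hS : ∀ i : Fin 2 × Ioi (0 : ℝ), volume {x ∈ Ω \ E | M + Df x ∈ largePair i.1 i.2} ≤
      ENNReal.ofReal ((C * (1 + m) / i.2.1) ^ q) * volume Ω) {t : ℝ} (ht : 0 < t) :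
    volume {x ∈ Ω | t < matNorm (M + Df x)} ≤
      ENNReal.ofReal ((2 * (4 * C) ^ q + 1) * (1 + m ^ q) * t ^ (-q)) * volume Ω := by
  have ht2 : 0 < t / 2 := by positivity
  have htq : 0 < t ^ q := Real.rpow_pos_of_pos ht q
  have htq' : 0 < t ^ (-q) := Real.rpow_pos_of_pos ht _
  have hmq : 0 ≤ m ^ q := Real.rpow_nonneg hm q
  have hsub : {x ∈ Ω | t < matNorm (M + Df x)} ⊆
      {x ∈ Ω \ E | M + Df x ∈ largePair 0 ⟨t / 2, ht2⟩} ∪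
      {x ∈ Ω \ E | M + Df x ∈ largePair 1 ⟨t / 2, ht2⟩} ∪
      ({x | ENNReal.ofReal (t ^ q) ≤ ENNReal.ofReal ((1 + matNorm (M + Df x)) ^ s)} ∩ E) := by
    rintro x ⟨hx, hxt⟩
    by_cases hE : x ∈ E
    · refine Or.inr ⟨ENNReal.ofReal_le_ofReal ?_, hE⟩
      calc t ^ q ≤ (1 + matNorm (M + Df x)) ^ q := Real.rpow_le_rpow ht.le (by linarith) hq.le
        _ ≤ _ := Real.rpow_le_rpow_of_exponent_le
          (by linarith [matNorm_nonneg (M + Df x)]) hqs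
    · left
      rcases subset_largePair_of_lt_matNorm ht2 hxt with h | h
      · exact Or.inl ⟨⟨hx, hE⟩, h⟩
      · exact Or.inr ⟨⟨hx, hE⟩, h⟩
  -- Chebyshev on the exceptional set; the exponent s ≥ q gives decay t^(-q).
  have hcheb : volume ({x | ENNReal.ofReal (t ^ q) ≤
      ENNReal.ofReal ((1 + matNorm (M + Df x)) ^ s)} ∩ E) ≤
      ENNReal.ofReal (t ^ (-q)) * volume Ω := by
    have hae : AEMeasurable (fun x => ENNReal.ofReal ((1 + matNorm (M + Df x)) ^ s))
        (volume.restrict E) :=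
      (((hf.aemeasurable_matNorm M).const_add 1).pow_const s).ennreal_ofReal.restrict
    have h := (mul_meas_ge_le_lintegral₀ hae (ENNReal.ofReal (t ^ q))).trans hErr
    have h' := (mul_le_mul_right (Measure.le_restrict_apply (μ := volume) E
      {x | ENNReal.ofReal (t ^ q) ≤ ENNReal.ofReal ((1 + matNorm (M + Df x)) ^ s)})
      (ENNReal.ofReal (t ^ q))).trans h
    have h'' := mul_le_mul_right h' (ENNReal.ofReal (t ^ (-q)))
    rwa [← mul_assoc, ← ENNReal.ofReal_mul htq'.le, ← Real.rpow_add ht, neg_add_cancel,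
      Real.rpow_zero, ENNReal.ofReal_one, one_mul] at h''
  have hp : ∀ p : Fin 2, volume {x ∈ Ω \ E | M + Df x ∈ largePair p ⟨t / 2, ht2⟩} ≤
      ENNReal.ofReal ((4 * C) ^ q * (1 + m ^ q) * t ^ (-q)) * volume Ω := by
    intro p
    refine (hS (p, ⟨t / 2, ht2⟩)).trans (mul_le_mul_left (ENNReal.ofReal_le_ofReal ?_) _)
    calc (C * (1 + m) / (t / 2)) ^ q = (2 * C) ^ q * (1 + m) ^ q * t ^ (-q) := by
          rw [show C * (1 + m) / (t / 2) = 2 * C * (1 + m) * t⁻¹ by field_simp,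
            Real.mul_rpow (by positivity) (by positivity),
            Real.mul_rpow (by positivity) (by positivity), Real.inv_rpow ht.le, Real.rpow_neg ht.le]
      _ ≤ (2 * C) ^ q * (2 ^ q * (1 + m ^ q)) * t ^ (-q) := by
          gcongr
          exact one_add_rpow_le hm hq.le
      _ = _ := by
          rw [show 4 * C = 2 * C * 2 by ring, Real.mul_rpow (x := 2 * C) (by positivity) (by norm_num)]
          ring
  have hle : t ^ (-q) ≤ (1 + m ^ q) * t ^ (-q) := le_mul_of_one_le_left htq'.le (by linarith)
  calc volume {x ∈ Ω | t < matNorm (M + Df x)}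
      ≤ _ := measure_mono hsub
    _ ≤ _ := (measure_union_le _ _).trans (add_le_add_left (measure_union_le _ _) _)
    _ ≤ ENNReal.ofReal ((4 * C) ^ q * (1 + m ^ q) * t ^ (-q)) * volume Ω +
        ENNReal.ofReal ((4 * C) ^ q * (1 + m ^ q) * t ^ (-q)) * volume Ω +
        ENNReal.ofReal ((1 + m ^ q) * t ^ (-q)) * volume Ω :=
      add_le_add (add_le_add (hp 0) (hp 1)) (hcheb.trans
        (mul_le_mul_left (ENNReal.ofReal_le_ofReal hle) _))
    _ = _ := by
        rw [← add_mul, ← add_mul, ← ENNReal.ofReal_add (by positivity) (by positivity),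
          ← ENNReal.ofReal_add (by positivity) (by positivity)]
        congr 2
        ring

/-- A reduction yields a piecewise affine map with the given affine boundary values. -/
theorem exists_map_of_reduces {θ q C s ε : ℝ} {α : ℝ≥0} (hq : 0 < q) (hC : 0 < C) (hα0 : 0 < α)
    (hα1 : α < 1) (hs : 0 ≤ s) (hε0 : 0 < ε) (hε1 : ε < 1) {M : Mat} {c : ℝ≥0∞}
    (hred : Reduces α (max s q) M (goodSet θ)
      (fun i : Fin 2 × Ioi (0 : ℝ) => largePair i.1 i.2)
      (fun i => ENNReal.ofReal ((C * (1 + matNorm M) / i.2.1) ^ q)) c)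
    (b : Plane) {Ω : Set Plane} (hΩ : IsRegularDomain Ω) :
    ∃ (w : Plane → Plane) (Dw : Plane → Mat),
      IsW11WithGradient Ω w Dw ∧ IsPiecewiseAffineOn Ω w ∧
      (∃ H : ℝ≥0, HolderOnWith H α w (closure Ω)) ∧
      (∀ x ∈ frontier Ω, w x = affineMap M b x) ∧
      volume (errorSet Ω Dw (goodSet θ)) < ENNReal.ofReal ε * volume Ω ∧
      ∫⁻ x in errorSet Ω Dw (goodSet θ), ENNReal.ofReal ((1 + matNorm (Dw x)) ^ s) <
        ENNReal.ofReal ε * volume Ω ∧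
      ∀ t : ℝ, 0 < t → volume {x ∈ Ω | t < matNorm (Dw x)} ≤
        ENNReal.ofReal ((2 * (4 * C) ^ q + 1) * (1 + matNorm M ^ q) * t ^ (-q)) * volume Ω := by
  -- Half of ε yields strict inequalities. The exponent max s q serves both the error integral and
  -- the weak bound.
  obtain ⟨f, Df, 𝒰, E, hf, -, -, -, hval, hErr, hS, -⟩ := hred Ω hΩ (ε / 2) (by linarith)
  have herr : errorSet Ω (fun x => M + Df x) (goodSet θ) ⊆ E := by
    rintro x ⟨hx, hx'⟩
    by_contra hE
    exact hx' (hval x ⟨hx, hE⟩)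
  have hlt : ENNReal.ofReal (ε / 2) * volume Ω < ENNReal.ofReal ε * volume Ω :=
    ENNReal.mul_lt_mul_left hΩ.volume_pos.ne' hΩ.volume_lt_top.ne
      ((ENNReal.ofReal_lt_ofReal_iff hε0).2 (by linarith))
  have hone : ∀ x, 1 ≤ 1 + matNorm (M + Df x) := fun x => by linarith [matNorm_nonneg (M + Df x)]
  have hint : ∫⁻ x in errorSet Ω (fun x => M + Df x) (goodSet θ),
      ENNReal.ofReal ((1 + matNorm (M + Df x)) ^ s) < ENNReal.ofReal ε * volume Ω := by
    refine lt_of_le_of_lt ((lintegral_mono_set herr).trans ((lintegral_mono fun x => ?_).trans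
      hErr)) hlt
    exact ENNReal.ofReal_le_ofReal
      (Real.rpow_le_rpow_of_exponent_le (hone x) (le_max_left s q))
  refine ⟨fun x => affineMap M b x + f x, fun x => M + Df x, hf.isW11WithGradient hα0 hΩ M b,
    hf.isPiecewiseAffineOn M b, hf.exists_holderOnWith hα1 hΩ (by linarith) M b, ?_, ?_, hint, ?_⟩
  · intro x hx
    have : x ∉ Ω := fun h => by
      rw [hΩ.isOpen.frontier_eq] at hx
      exact hx.2 h
    simp only [hf.zero x this, add_zero]
  · refine lt_of_le_of_lt ?_ hint
    rw [← setLIntegral_one]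
    refine lintegral_mono fun x => ?_
    rw [← ENNReal.ofReal_one]
    exact ENNReal.ofReal_le_ofReal (Real.one_le_rpow (hone x) hs)
  · intro t ht
    refine hf.volume_lt_matNorm_le hq (le_max_right s q) hC (matNorm_nonneg M)
      (hErr.trans ?_) hS ht
    refine mul_le_of_le_one_left zero_le ?_
    rw [← ENNReal.ofReal_one]
    exact ENNReal.ofReal_le_ofReal (by linarith)

end ConvexIntegration

end

theorem mainTheorem4 :
    -- for `1 < q < q̄` there is a positive even integer `L` with `q < q_L`
    (∀ θ ∈ Ioo (0 : ℝ) 1, ∀ q : ℝ, 1 < q → q < ConvexIntegration.qBar θ →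
      ∃ L : ℕ, 0 < L ∧ Even L ∧ q < ConvexIntegration.qExp θ L) ∧
    -- for `q`, `L` there is a constant `C = C(q, L)` as follows
    (∀ (q : ℝ) (L : ℕ), 1 < q → 0 < L → Even L →
      ∃ C : ℝ, 1 ≤ C ∧
        ∀ θ ∈ Ioo (0 : ℝ) 1, q < ConvexIntegration.qExp θ L →
        ∀ (M : ConvexIntegration.Mat) (b : ConvexIntegration.Plane),
        ∀ ε ∈ Ioo (0 : ℝ) 1, ∀ α ∈ Ioo (0 : ℝ≥0) 1, ∀ s ∈ Ioi (1 : ℝ),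
        ∀ Ω : Set ConvexIntegration.Plane, ConvexIntegration.IsRegularDomain Ω →
        ∃ (w : ConvexIntegration.Plane → ConvexIntegration.Plane)
          (Dw : ConvexIntegration.Plane → ConvexIntegration.Mat),
          ConvexIntegration.IsW11WithGradient Ω w Dw ∧
          ConvexIntegration.IsPiecewiseAffineOn Ω w ∧
          (∃ H : ℝ≥0, HolderOnWith H α w (closure Ω)) ∧
          (∀ x ∈ frontier Ω, w x = ConvexIntegration.affineMap M b x) ∧
          volume (ConvexIntegration.errorSet Ω Dw (ConvexIntegration.goodSet θ)) <
            ENNReal.ofReal ε * volume Ω ∧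
          ∫⁻ x in ConvexIntegration.errorSet Ω Dw (ConvexIntegration.goodSet θ),
              ENNReal.ofReal ((1 + ConvexIntegration.matNorm (Dw x)) ^ s) <
            ENNReal.ofReal ε * volume Ω ∧
          ∀ t : ℝ, 0 < t →
            volume {x ∈ Ω | t < ConvexIntegration.matNorm (Dw x)} ≤
              ENNReal.ofReal (C * (1 + ConvexIntegration.matNorm M ^ q) * t ^ (-q)) *
                volume Ω) := by
  refine ⟨fun θ _ q _ hq => ?_, fun q L hq hL _ => ?_⟩
  · obtain ⟨_, ⟨L, hL, rfl⟩, h⟩ := exists_lt_of_lt_csSup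
      (show (ConvexIntegration.qExp θ '' {L : ℕ | 0 < L ∧ Even L}).Nonempty from
        ⟨_, 2, ⟨two_pos, even_two⟩, rfl⟩) hq
    exact ⟨L, hL.1, hL.2, h⟩
  · by_cases h : ∃ θ ∈ Ioo (0 : ℝ) 1, q < ConvexIntegration.qExp θ L
    · obtain ⟨σ, hσ0, hσ1, hσq, hσ⟩ := ConvexIntegration.exists_amplitude_bound hL hq h
      have hL1 : (1 : ℝ) ≤ L := by exact_mod_cast hL
      obtain ⟨C, hC, hred⟩ := ConvexIntegration.reduces_goodSet (k := 1 / L) (by positivity)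
        (by rw [div_le_one (by positivity)]; exact hL1) hq hσ0 hσ1 hσq
      have hC' : 0 ≤ (4 * C) ^ q := Real.rpow_nonneg (by linarith) q
      refine ⟨2 * (4 * C) ^ q + 1, by linarith, ?_⟩
      intro θ hθ hθq M b ε hε α hα s hs Ω hΩ
      have hs1 : (1 : ℝ) < s := hs
      obtain ⟨c, hc⟩ := hred θ (hσ θ hθ hθq) (Real.sqrt_le_one.2 hθ.2.le) (α := α)
        (s := max s q) hα.1 hα.2 (le_max_of_le_left (by linarith)) M
      exact ConvexIntegration.exists_map_of_reduces (by linarith) hC hα.1 hα.2 (by linarith)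
        hε.1 hε.2 hc b hΩ
    · exact ⟨1, le_rfl, fun θ hθ hq => (h ⟨θ, hθ, hq⟩).elim⟩
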